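/- **Model.** Let $q$ be prime, $r\le g$ and $c$ integers, $\theta\in[0,(q-1)/q)$ and $\alpha\ge\beta\ge\gamma>0$; all of these are constants. For each $x\in[c]$ let $\Phi^{(x)}\in\mathbb F_q^{g\times r}$ be a known generator matrix of a linear $(g,r)$ MDS code (all nonzero codewords $\Phi^{(x)}b$ have Hamming weight at least $g-r+1$). There are $n$ users and $m$ items. A ground truth $M=(\mathcal V,\mathcal Z)$ consists of basis matrices $B^{(x)}\in\mathbb F_q^{r\times m}$ of rank $r$ ($x\in[c]$), which give the rating vectors $v_i^{(x)}=$ the $i$-th row of $\Phi^{(x)}B^{(x)}$ ($i\in[g]$), and of a partition $\mathcal Z=\{Z(x,i)\}_{x\in[c],\,i\in[g]}$ of $[n]$ into $c$ clusters of $g$ groups, all groups of size $n/(gc)$. Its rating matrix in $\mathbb F_q^{n\times m}$ has row $v^{(x)}_i$ for every user in $Z(x,i)$; we also write $M$ for this matrix. Observed are: a matrix $Y$, whose entries are independent, each being unobserved with probability $1-p$, equal to the true rating with probability $p(1-\theta)$, and equal to each of the other $q-1$ elements of $\mathbb F_q$ with probability $p\theta/(q-1)$; and, independently, a random graph $G$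 on $[n]$ with independent edges, two users being adjacent with probability $\alpha\frac{\log n}{n}$ if they are in the same group, $\beta\frac{\log n}{n}$ if they are in different groups of the same cluster, and $\gamma\frac{\log n}{n}$ if they are in different clusters. The minimum normalized distances of $M$ are $\frac1m\min_{x}\min_{i\ne j}d_H(v_i^{(x)},v_j^{(x)})$ (inside clusters) and $\frac1m\min_{x\neq y}\min_{i,j}d_H(v_i^{(x)},v_j^{(y)})$ (across clusters). For $\delta=(\delta_g,\delta_c)$ let $\mathcal M^{(\delta)}$ be the set of ground truths whose minimum normalized distances are at least $\delta_g$ and $\delta_c$, respectively. An estimator $\psi$ maps $(Y,G)$ to a matrix in $\mathbb F_q^{n\times m}$, and $P_e^{(\delta)}(\psi)=\max_{M\in\mathcal M^{(\delta)}}\mathbb P_M[\psi(Y,G)\ne M]$. A maximum-likelihood estimator outputs the rating matrix of some $X\in\mathcal M^{(\delta)}$ that maximizes over $\mathcal M^{(\delta)}$ the probability of the observed $(Y,G)$, ties being broken arbitrarily. For $s\in\mathbb R$ put $$p^\star(s)=\frac{1}{\bigl(\sqrt{1-\theta}-\sqrt{\theta/(q-1)}\bigr)^{2}}\max\Bigl\{\tfrac{gc\,s}{g-r+1}\tfrac{\log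 m}{n},\ \tfrac{\log n}{\delta_g m}\Bigl(s-\tfrac{(\sqrt\alpha-\sqrt\beta)^2}{gc}\Bigr),\ \tfrac{\log n}{\delta_c m}\Bigl(s-\tfrac{(\sqrt\alpha-\sqrt\gamma)^2+(g-1)(\sqrt\beta-\sqrt\gamma)^2}{gc}\Bigr)\Bigr\}.$$ **Theorem 1 (Optimal Sample Complexity).** Consider a sequence of such problems with $n\to\infty$, $m=\omega(\log n)$, $\log m=o(n)$ and $p\in[0,1]$, in which $m$, $p$ and $\delta$ may vary with the problem. Assume that $\delta_g$ and $\delta_c$ are bounded away from $0$ and that $(\delta_g,\delta_c)$ is, in each problem, the pair of minimum normalized distances of some ground truth. Let $\epsilon>0$ be a constant. 1. If $p\ge p^\star(1+\epsilon)$ for all large $n$, then maximum-likelihood estimators exist, and every sequence $\psi$ of them satisfies $P_e^{(\delta)}(\psi)\to0$. 2. Assume that $\delta$ is not extremal, that is, for some constant $\eta>0$ the set $\mathcal M^{(\delta_g+\eta,\,\delta_c+\eta)}$ is nonempty for all large $n$. If $p\le p^\star(1-\epsilon)$ for all large $n$, then for every sequence of estimators $\psi$ the error probability $P_e^{(\delta)}(\psi)$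 is bounded away from $0$ for all large $n$. In this sense, the optimal observation probability is $p^\star=p^\star(1)$. -/

import Mathlib

open Filter Topology Asymptotics
open scoped Matrix

noncomputable section

namespace HierSBM

/-- `Φ` is a generator matrix of a `(g, r)` linear MDS code: its code has length `g`,
dimension `r`, and every nonzero codeword has weight at least `g - r + 1`
(for `r ≤ g` this makes `b ↦ Φ *ᵥ b` injective). -/
def IsMDS {F : Type*} [Field F] [DecidableEq F] {g r : ℕ}
    (Φ : Matrix (Fin g) (Fin r) F) : Prop :=
  r ≤ g ∧ ∀ b : Fin r → F, b ≠ 0 → g + 1 ≤ r + hammingNorm (Φ *ᵥ b)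

/-- The constants of the model: `c` clusters of `g` groups, an (a priori known) code for each
cluster with generator matrix in `F_q^{g × r}`, the noise level `θ`, and the constants
`α, β, γ` of the edge probabilities. -/
structure Model (q c g r : ℕ) where
  /-- generator matrices of the codes of the clusters -/
  code : Fin c → Matrix (Fin g) (Fin r) (ZMod q)
  /-- flip probability of an observed entry -/
  θ : ℝ
  /-- edge constant inside a group -/
  α : ℝ
  /-- edge constant across groups of one cluster -/
  β : ℝ
  /-- edge constant across clusters -/
  γ : ℝ

/-- A ground truth `(V, Z)`: for each cluster the `r × m` basis matrix, from which the rating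
vectors of its groups are obtained through the code, and for each of the `n` users its cluster
and group. -/
structure Instance (q c g r n m : ℕ) where
  /-- basis matrices of the clusters -/
  basis : Fin c → Matrix (Fin r) (Fin m) (ZMod q)
  /-- cluster and group of a user -/
  part : Fin n → Fin c × Fin g

variable {q c g r n m : ℕ}

/-- The rating vector of group `i` in cluster `x`. -/
def Instance.vec (P : Model q c g r) (M : Instance q c g r n m) (x : Fin c) (i : Fin g) :
    Fin m → ZMod q :=
  (P.code x * M.basis x) i

/-- The `n × m` rating matrix: the row of a user is the rating vector of its group. -/
def Instance.mat (P : Model q c g r) (M : Instance q c g r n m) :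
    Matrix (Fin n) (Fin m) (ZMod q) :=
  fun a => M.vec P (M.part a).1 (M.part a).2

/-- The basis matrices have rank `r`, and all `c * g` groups have exactly `n / (c * g)` users. -/
def Instance.WellFormed (M : Instance q c g r n m) : Prop :=
  (∀ x, (M.basis x).rank = r) ∧
    ∀ x i, c * g * (Finset.univ.filter fun a => M.part a = (x, i)).card = n

/-- Normalized Hamming distances of the rating vectors of two groups of the same cluster. -/
def Instance.intraDistances (P : Model q c g r) (M : Instance q c g r n m) : Set ℝ :=
  {d | ∃ (x : Fin c) (i j : Fin g), i ≠ j ∧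
    d = (hammingDist (M.vec P x i) (M.vec P x j) : ℝ) / m}

/-- Normalized Hamming distances of the rating vectors of two groups of different clusters. -/
def Instance.interDistances (P : Model q c g r) (M : Instance q c g r n m) : Set ℝ :=
  {d | ∃ (x y : Fin c) (i j : Fin g), x ≠ y ∧
    d = (hammingDist (M.vec P x i) (M.vec P y j) : ℝ) / m}

/-- The set of ground truths whose minimum normalized distances inside clusters and across
clusters are at least `δg` and `δc`. -/
def matSet (P : Model q c g r) (n m : ℕ) (δg δc : ℝ) : Set (Instance q c g r n m) :=
  {M | M.WellFormed ∧ δg ∈ lowerBounds (M.intraDistances P) ∧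
    δc ∈ lowerBounds (M.interDistances P)}

/-- What is observed: the ratings (`none` for an unobserved entry) and the similarity graph. -/
abbrev Obs (q n m : ℕ) : Type :=
  Matrix (Fin n) (Fin m) (Option (ZMod q)) × SimpleGraph (Fin n)

/-- The law of one observed entry whose true value is `u`. -/
def entryProb (p θ : ℝ) (u : ZMod q) : Option (ZMod q) → ℝ
  | none => 1 - p
  | some y => if y = u then p * (1 - θ) else p * (θ / ((q : ℝ) - 1))

/-- The probability of an edge between a user of (cluster, group) `s` and one of `t`:
`α`, `β` or `γ` times `log n / n`. (The truncation at `1` is void for all large `n`.) -/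
def edgeProb (P : Model q c g r) (n : ℕ) (s t : Fin c × Fin g) : ℝ :=
  min 1 ((if s = t then P.α else if s.1 = t.1 then P.β else P.γ) * (Real.log n / n))

open Classical in
/-- The likelihood of the observation `ω = (Y, G)` under the ground truth `M`: all entries of
`Y` and all potential edges of `G` are independent. -/
def likelihood (P : Model q c g r) (p : ℝ) (M : Instance q c g r n m) (ω : Obs q n m) : ℝ :=
  (∏ a : Fin n, ∏ t : Fin m, entryProb p P.θ (M.mat P a t) (ω.1 a t)) *
    ∏ a : Fin n, ∏ b ∈ Finset.Ioi a,
      if ω.2.Adj a b then edgeProb P n (M.part a) (M.part b)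
      else 1 - edgeProb P n (M.part a) (M.part b)

/-- An estimator maps an observation to a completed rating matrix. -/
abbrev Estimator (q n m : ℕ) : Type := Obs q n m → Matrix (Fin n) (Fin m) (ZMod q)

open Classical in
/-- The probability, under the ground truth `M`, that `ψ` does not output the rating matrix
of `M`. -/
def errorProb [NeZero q] (P : Model q c g r) (p : ℝ) (ψ : Estimator q n m)
    (M : Instance q c g r n m) : ℝ :=
  ∑ ω : Obs q n m, if ψ ω ≠ M.mat P then likelihood P p M ω else 0

/-- The worst-case probability of error over `matSet P n m δg δc`. -/
def worstError [NeZero q] (P : Model q c g r) (p δg δc : ℝ) (ψ : Estimator q n m) : ℝ :=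
  ⨆ M : matSet P n m δg δc, errorProb P p ψ M.1

/-- `ψ` is a maximum-likelihood estimator over `matSet P n m δg δc` (ties broken arbitrarily);
in particular it outputs rating matrices of members of that set. -/
def IsMaxLikelihood (P : Model q c g r) (p δg δc : ℝ) (ψ : Estimator q n m) : Prop :=
  ∀ ω, ∃ X ∈ matSet P n m δg δc, ψ ω = X.mat P ∧
    ∀ X' ∈ matSet P n m δg δc, likelihood P p X' ω ≤ likelihood P p X ω

/-- The threshold with margin `s`. The optimal observation probability is the value at `s = 1`;
the sufficient and the necessary condition use `s = 1 + ε` and `s = 1 - ε`. -/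
def threshold (P : Model q c g r) (n m : ℕ) (δg δc s : ℝ) : ℝ :=
  1 / (√(1 - P.θ) - √(P.θ / ((q : ℝ) - 1))) ^ 2 *
    max ((g : ℝ) * c * s / ((g : ℝ) - r + 1) * (Real.log m / n))
      (max
        (Real.log n / (δg * m) * (s - (√P.α - √P.β) ^ 2 / ((g : ℝ) * c)))
        (Real.log n / (δc * m) *
          (s - ((√P.α - √P.γ) ^ 2 + ((g : ℝ) - 1) * (√P.β - √P.γ) ^ 2) / ((g : ℝ) * c))))

end HierSBM

end

/-! An observation is a family of independent coordinates, so two ground truths are compared through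
two product measures, and what counts is the product of the Bhattacharyya coefficients of the
coordinates. With `I = (√(1-θ) - √(θ/(q-1)))²`, an entry with two different candidate values
contributes `1 - pI`, and a pair of users with candidate edge probabilities `e`, `f` contributes
about `1 - (√e - √f)²/2`. Each term of the threshold balances the cost of a cheapest confusion
against the logarithm of the number of places where it may occur. Changing one column of a basis
matrix changes the ratings of at least `g-r+1` groups by the MDS property, costs `pI(g-r+1)n/(gc)`,
and may happen in `m` columns. Moving a user to another group at distance `δm` costs `pIδm + J log
n/(gc)`, with `J` the graph term, and may happen to `n` users.

Achievability is a union bound over all competitors (`errorProb_le_sum`,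
`errorProb_le_of_exponents`). A competitor whose labelling is far from every relabelling of the true
one has an exponent larger than the logarithm of the number of all ground truths
(`exponent_ge_of_not_isAligned`). For a competitor close to a relabelling `π`, triangle inequalities
split the exponent into a cost for each wrong user and a cost for each wrong column
(`exponent_ge_of_isAligned`), unless `π` violates the cluster structure, which costs order `n log
n`. The sum over close competitors then factors into products over users and columns
(`sum_aligned_le`), and a margin `1 + ε` makes all of them tend to zero.

The converse uses that no estimator can succeed on a finite family of ground truths if, under each
of them, another member is often at least as likely (`half_le_worstError`). That one exchange looks
favourable has probability at least the product of the Bhattacharyya coefficients up to a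
subexponential factor: this follows by tilting to the normalized geometric mean, a second moment
bound, and a symmetry exchanging the two measures (`half_bhatt_le_sum_ite`). Below the threshold
there are enough independent chances that one of them succeeds. For columns these are the shifts of
single columns by a codeword of minimum weight, and the slack in `δ` keeps the shifted ground truths
admissible. For users one finds a user of each of two groups that looks like a member of the other
group. Independence of the candidates is obtained by restricting to `n^(1-ε/4)` users of each group
and ignoring the pairs among them, which almost surely carry no edge at the two selected users. -/

namespace HierSBM

/-! ### Product weights: bounds by Bhattacharyya coefficients from above and below -/

section ProductWeights

open scoped Classical

variable {ι κ : Type*} [Fintype ι] [DecidableEq ι] [Fintype κ]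

theorem sum_prod_apply (f : ι → κ → ℝ) :
    ∑ w : ι → κ, ∏ i, f i (w i) = ∏ i, ∑ k, f i k := by
  rw [Finset.prod_univ_sum, Fintype.piFinset_univ]

/-- Union-type bound: the mass where a competing product weight is at least as large is bounded
by the product of the Bhattacharyya coefficients. -/
theorem sum_ite_prod_le_prod_sum_sqrt (f g : ι → κ → ℝ) (hf : ∀ i k, 0 ≤ f i k)
    (hg : ∀ i k, 0 ≤ g i k) :
    ∑ w : ι → κ, (if ∏ i, f i (w i) ≤ ∏ i, g i (w i) then ∏ i, f i (w i) else 0)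
      ≤ ∏ i, ∑ k, √(f i k * g i k) := by
  rw [← sum_prod_apply]
  refine Finset.sum_le_sum fun w _ => ?_
  have h0 : 0 ≤ ∏ i, f i (w i) := Finset.prod_nonneg fun i _ => hf _ _
  rw [← Real.sqrt_prod _ fun i _ => mul_nonneg (hf _ _) (hg _ _), Finset.prod_mul_distrib]
  split_ifs with h
  · exact Real.le_sqrt_of_sq_le (by rw [sq]; exact mul_le_mul_of_nonneg_left h h0)
  · exact Real.sqrt_nonneg _

theorem sum_prod_mul_apply_mul_apply (Q X : ι → κ → ℝ) (hQ : ∀ i, ∑ k, Q i k = 1) (i j : ι) :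
    ∑ w : ι → κ, (∏ l, Q l (w l)) * (X i (w i) * X j (w j)) =
      if i = j then ∑ k, Q i k * X i k ^ 2
      else (∑ k, Q i k * X i k) * ∑ k, Q j k * X j k := by
  -- Both variables are written as products over all coordinates, trivial away from `i` and `j`, so
  -- that the sum becomes a product of one-coordinate sums.
  have h1 : ∀ w : ι → κ, (∏ l, Q l (w l)) * (X i (w i) * X j (w j)) =
      ∏ l, (Q l (w l) * ((if l = i then X l (w l) else 1) * (if l = j then X l (w l) else 1))) := by
    intro w
    rw [Finset.prod_mul_distrib, Finset.prod_mul_distrib, Finset.prod_ite_eq', Finset.prod_ite_eq']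
    simp
  simp_rw [h1]
  rw [sum_prod_apply (fun l k => Q l k * ((if l = i then X l k else 1) *
    (if l = j then X l k else 1)))]
  split_ifs with hij
  · subst hij
    rw [Finset.prod_eq_single i]
    · simp [sq]
    · intro b _ hb
      simp [hb, hQ]
    · simp
  · have h2 : ∀ l, (∑ k, Q l k * ((if l = i then X l k else 1) * (if l = j then X l k else 1))) =
        (if l = i then ∑ k, Q l k * X l k else 1) * (if l = j then ∑ k, Q l k * X l k else 1) := by
      intro l
      by_cases hi : l = i
      · have hj : l ≠ j := fun h => hij (hi.symm.trans h)
        subst hi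
        simp [hj]
      · by_cases hj : l = j
        · subst hj
          simp [hi]
        · simp [hi, hj, hQ]
    simp_rw [h2]
    rw [Finset.prod_mul_distrib, Finset.prod_ite_eq', Finset.prod_ite_eq']
    simp

/-- Second moment of a sum of independent variables whose means sum to zero. -/
theorem sum_prod_mul_sq_le (Q X : ι → κ → ℝ) (hQ : ∀ i, ∑ k, Q i k = 1)
    (h0 : ∑ i, ∑ k, Q i k * X i k = 0) :
    ∑ w : ι → κ, (∏ l, Q l (w l)) * (∑ i, X i (w i)) ^ 2 ≤ ∑ i, ∑ k, Q i k * X i k ^ 2 := by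
  have h1 : ∀ w : ι → κ, (∏ l, Q l (w l)) * (∑ i, X i (w i)) ^ 2 =
      ∑ i, ∑ j, (∏ l, Q l (w l)) * (X i (w i) * X j (w j)) := by
    intro w
    rw [sq, Finset.sum_mul_sum, Finset.mul_sum]
    simp_rw [Finset.mul_sum]
  simp_rw [h1]
  rw [Finset.sum_comm]
  -- The sum over `j` is the variance of `X i` plus the mean of `X i` times the sum of all means,
  -- which vanishes by `h0`.
  have h2 : ∀ i, ∑ w : ι → κ, ∑ j, (∏ l, Q l (w l)) * (X i (w i) * X j (w j)) =
      ∑ k, Q i k * X i k ^ 2 - (∑ k, Q i k * X i k) ^ 2 := by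
    intro i
    rw [Finset.sum_comm]
    simp_rw [sum_prod_mul_apply_mul_apply Q X hQ]
    have h3 : ∀ j, (if i = j then ∑ k, Q i k * X i k ^ 2
        else (∑ k, Q i k * X i k) * ∑ k, Q j k * X j k) =
        (if i = j then ∑ k, Q i k * X i k ^ 2 - (∑ k, Q i k * X i k) ^ 2 else 0) +
        (∑ k, Q i k * X i k) * ∑ k, Q j k * X j k := by
      intro j
      split_ifs with h
      · subst h; ring
      · ring
    simp_rw [h3]
    rw [Finset.sum_add_distrib, ← Finset.mul_sum, h0]
    simp
  simp_rw [h2]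
  exact Finset.sum_le_sum fun i _ => by linarith [sq_nonneg (∑ k, Q i k * X i k)]

/-- The logarithmic likelihood ratio of one coordinate. -/
noncomputable def llr (f g : ι → κ → ℝ) (i : ι) (k : κ) : ℝ := Real.log (f i k) - Real.log (g i k)

/-- The Bhattacharyya coefficient of one coordinate. -/
noncomputable def bhatt (f g : ι → κ → ℝ) (i : ι) : ℝ := ∑ k, √(f i k * g i k)

/-- The minimum is the geometric mean times `exp (-|log x - log y| / 2)`. By AM-GM the distance is
at most `((log x - log y)² / T + T) / 2`, and `exp z ≥ 1 + z` makes the bound linear in the squared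
log-ratio. After summation a second moment is therefore all that is needed, without a separate
Chebyshev step. -/
theorem min_ge_sqrt_mul {x y T : ℝ} (hx : 0 < x) (hy : 0 < y) (hT : 0 < T) :
    √(x * y) * (Real.exp (-T / 2) * (1 - ((Real.log x - Real.log y) ^ 2 / T - T) / 4)) ≤ min x y := by
  wlog hxy : x ≤ y generalizing x y
  · have := this hy hx (le_of_not_ge hxy)
    rw [min_comm, mul_comm x y, ← neg_sub (Real.log y), neg_sq]
    exact this
  set u := Real.log x with hu
  set v := Real.log y with hv
  have hxe : x = Real.exp u := (Real.exp_log hx).symm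
  have hye : y = Real.exp v := (Real.exp_log hy).symm
  have huv : u ≤ v := Real.log_le_log hx hxy
  rw [min_eq_left hxy]
  have hs : √(x * y) = Real.exp ((u + v) / 2) := by
    rw [hxe, hye, ← Real.exp_add, Real.sqrt_eq_iff_mul_self_eq (Real.exp_nonneg _)
      (Real.exp_nonneg _), ← Real.exp_add]
    ring_nf
  have h1 : 1 - ((u - v) ^ 2 / T - T) / 4 ≤ Real.exp (-((v - u) - T) / 2) := by
    have h2 := Real.add_one_le_exp (-((v - u) - T) / 2)
    have h3 : v - u ≤ ((u - v) ^ 2 / T + T) / 2 := by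
      rw [div_add' _ _ _ hT.ne', div_div, le_div_iff₀ (by positivity)]
      nlinarith [sq_nonneg (v - u - T)]
    linarith
  calc √(x * y) * (Real.exp (-T / 2) * (1 - ((u - v) ^ 2 / T - T) / 4))
      ≤ Real.exp ((u + v) / 2) * (Real.exp (-T / 2) * Real.exp (-((v - u) - T) / 2)) := by
        rw [hs]; gcongr
    _ = x := by rw [← Real.exp_add, ← Real.exp_add, hxe]; ring_nf

/-- Lower bound for the overlap of two product weights, by tilting to the geometric mean. -/
theorem prod_bhatt_mul_exp_le_sum_min (f g : ι → κ → ℝ) (hf : ∀ i k, 0 ≤ f i k)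
    (hg : ∀ i k, 0 ≤ g i k) (hZ : ∀ i, 0 < bhatt f g i)
    (h0 : ∑ i, (∑ k, √(f i k * g i k) * llr f g i k) / bhatt f g i = 0) {T : ℝ} (hT : 0 < T)
    (hV : ∑ i, (∑ k, √(f i k * g i k) * llr f g i k ^ 2) / bhatt f g i ≤ T ^ 2) :
    (∏ i, bhatt f g i) * Real.exp (-T / 2) ≤
      ∑ w : ι → κ, min (∏ i, f i (w i)) (∏ i, g i (w i)) := by
  set Q : ι → κ → ℝ := fun i k => √(f i k * g i k) / bhatt f g i with hQdef
  set Z := ∏ i, bhatt f g i with hZdef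
  have hZpos : 0 < Z := Finset.prod_pos fun i _ => hZ i
  have hQ1 : ∀ i, ∑ k, Q i k = 1 := fun i => by
    simp only [hQdef]
    rw [← Finset.sum_div]
    exact div_self (hZ i).ne'
  have hQw : ∀ w : ι → κ, ∏ i, √(f i (w i) * g i (w i)) = Z * ∏ i, Q i (w i) := fun w => by
    rw [hZdef, ← Finset.prod_mul_distrib]
    exact Finset.prod_congr rfl fun i _ => (mul_div_cancel₀ _ (hZ i).ne').symm
  have hQs : ∀ (X : ι → κ → ℝ) (i : ι), ∑ k, Q i k * X i k =
      (∑ k, √(f i k * g i k) * X i k) / bhatt f g i := fun X i => by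
    rw [Finset.sum_div]
    exact Finset.sum_congr rfl fun k _ => by simp only [hQdef]; ring
  have hpt : ∀ w : ι → κ, Z * Real.exp (-T / 2) * ((∏ i, Q i (w i)) * (1 + T / 4) -
      ((∏ i, Q i (w i)) * (∑ i, llr f g i (w i)) ^ 2) / (4 * T)) ≤
      min (∏ i, f i (w i)) (∏ i, g i (w i)) := by
    intro w
    have hfw : 0 ≤ ∏ i, f i (w i) := Finset.prod_nonneg fun i _ => hf _ _
    have hgw : 0 ≤ ∏ i, g i (w i) := Finset.prod_nonneg fun i _ => hg _ _
    have hs : √((∏ i, f i (w i)) * ∏ i, g i (w i)) = Z * ∏ i, Q i (w i) := by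
      rw [← hQw, ← Real.sqrt_prod _ fun i _ => mul_nonneg (hf _ _) (hg _ _),
        Finset.prod_mul_distrib]
    -- Where one of the products vanishes the tilted weight vanishes too, so the value of `Real.log
    -- 0` does not matter.
    rcases hfw.eq_or_lt with h | hfp
    · rw [← h, zero_mul, Real.sqrt_zero] at hs
      have : ∏ i, Q i (w i) = 0 := by
        rcases mul_eq_zero.1 hs.symm with h' | h'
        · exact absurd h' hZpos.ne'
        · exact h'
      rw [this]
      simp [hfw, hgw]
    rcases hgw.eq_or_lt with h | hgp
    · rw [← h, mul_zero, Real.sqrt_zero] at hs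
      have : ∏ i, Q i (w i) = 0 := by
        rcases mul_eq_zero.1 hs.symm with h' | h'
        · exact absurd h' hZpos.ne'
        · exact h'
      rw [this]
      simp [hfw, hgw]
    refine le_trans (le_of_eq ?_) (min_ge_sqrt_mul hfp hgp hT)
    have hl : Real.log (∏ i, f i (w i)) - Real.log (∏ i, g i (w i)) = ∑ i, llr f g i (w i) := by
      rw [Real.log_prod fun i hi h => hfp.ne' (Finset.prod_eq_zero hi h),
        Real.log_prod fun i hi h => hgp.ne' (Finset.prod_eq_zero hi h), ← Finset.sum_sub_distrib]
      rfl
    rw [hl, hs]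
    field_simp
    ring
  refine le_trans ?_ (Finset.sum_le_sum fun w _ => hpt w)
  rw [← Finset.mul_sum, Finset.sum_sub_distrib, ← Finset.sum_mul, ← Finset.sum_div,
    sum_prod_apply, Finset.prod_congr rfl fun i _ => hQ1 i, Finset.prod_const_one]
  have h2 := sum_prod_mul_sq_le Q (llr f g) hQ1 (by simp_rw [hQs (llr f g)]; exact h0)
  simp_rw [hQs (fun i k => llr f g i k ^ 2)] at h2
  have h3 := h2.trans hV
  -- With a second moment of at most `T ^ 2` the loss is at most the gain `T / 4`, which leaves
  -- exactly the factor `exp (-T / 2)`.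
  have h4 : (∑ w : ι → κ, (∏ i, Q i (w i)) * (∑ i, llr f g i (w i)) ^ 2) / (4 * T) ≤ T / 4 := by
    rw [div_le_div_iff₀ (by positivity) (by positivity)]
    nlinarith
  have h5 : 0 < Z * Real.exp (-T / 2) := by positivity
  nlinarith

/-- For two product weights exchanged by a symmetry, the second one is at least as large as the
first with probability at least half the overlap; tilting bounds the latter from below. -/
theorem half_bhatt_le_sum_ite (f g : ι → κ → ℝ) (hf : ∀ i k, 0 ≤ f i k)
    (hg : ∀ i k, 0 ≤ g i k) (hZ : ∀ i, 0 < bhatt f g i)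
    (e : Equiv.Perm ι) (σ : ι → Equiv.Perm κ) (hfg : ∀ i k, f i (σ i k) = g (e i) k)
    (hgf : ∀ i k, g i (σ i k) = f (e i) k) {T : ℝ} (hT : 0 < T)
    (hV : ∑ i, (∑ k, √(f i k * g i k) * llr f g i k ^ 2) / bhatt f g i ≤ T ^ 2) :
    (∏ i, bhatt f g i) * Real.exp (-T / 2) / 2 ≤
      ∑ w : ι → κ, (if ∏ i, f i (w i) ≤ ∏ i, g i (w i) then ∏ i, f i (w i) else 0) := by
  have hb : ∀ i, bhatt f g (e i) = bhatt f g i := fun i => by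
    unfold bhatt
    rw [← Equiv.sum_comp (σ i) (fun k => √(f i k * g i k))]
    exact Finset.sum_congr rfl fun k _ => by rw [hfg, hgf, mul_comm]
  -- The symmetry turns the tilted mean at `i` into minus the one at `e i`, so their sum equals its
  -- own negative. Hence the equal tilt is already centred.
  have h0 : ∑ i, (∑ k, √(f i k * g i k) * llr f g i k) / bhatt f g i = 0 := by
    have h1 : ∀ i, (∑ k, √(f i k * g i k) * llr f g i k) / bhatt f g i =
        -((∑ k, √(f (e i) k * g (e i) k) * llr f g (e i) k) / bhatt f g (e i)) := by
      intro i
      rw [hb, ← neg_div, ← Finset.sum_neg_distrib,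
        ← Equiv.sum_comp (σ i) (fun k => √(f i k * g i k) * llr f g i k)]
      congr 1
      refine Finset.sum_congr rfl fun k _ => ?_
      unfold llr
      rw [hfg, hgf, mul_comm (g (e i) k)]
      ring
    have h2 := Finset.sum_congr rfl fun i (_ : i ∈ Finset.univ) => h1 i
    rw [Finset.sum_neg_distrib, Equiv.sum_comp e
      (fun i => (∑ k, √(f i k * g i k) * llr f g i k) / bhatt f g i)] at h2
    linarith
  have hmin := prod_bhatt_mul_exp_le_sum_min f g hf hg hZ h0 hT hV
  -- This bijection of the outcomes exchanges the two product weights. The two events "the other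
  -- weight is at least as large" thus have the same mass, and together these masses dominate the
  -- overlap.
  let φ : (ι → κ) ≃ (ι → κ) :=
    { toFun := fun w i => σ i (w (e i))
      invFun := fun w i => (σ (e.symm i)).symm (w (e.symm i))
      left_inv := fun w => by funext i; simp
      right_inv := fun w => by funext i; simp }
  have hφf : ∀ w, ∏ i, f i (φ w i) = ∏ i, g i (w i) := fun w => by
    rw [← Equiv.prod_comp e (fun i => g i (w i))]
    exact Finset.prod_congr rfl fun i _ => hfg _ _
  have hφg : ∀ w, ∏ i, g i (φ w i) = ∏ i, f i (w i) := fun w => by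
    rw [← Equiv.prod_comp e (fun i => f i (w i))]
    exact Finset.prod_congr rfl fun i _ => hgf _ _
  set A := ∑ w : ι → κ, (if ∏ i, f i (w i) ≤ ∏ i, g i (w i) then ∏ i, f i (w i) else 0) with hA
  have hA' : A = ∑ w : ι → κ,
      (if ∏ i, g i (w i) ≤ ∏ i, f i (w i) then ∏ i, g i (w i) else 0) := by
    rw [hA, ← Equiv.sum_comp φ]
    exact Finset.sum_congr rfl fun w _ => by rw [hφf, hφg]
  have hle : ∑ w : ι → κ, min (∏ i, f i (w i)) (∏ i, g i (w i)) ≤ A + A := by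
    nth_rewrite 2 [hA']
    rw [hA, ← Finset.sum_add_distrib]
    refine Finset.sum_le_sum fun w _ => ?_
    have hfw : 0 ≤ ∏ i, f i (w i) := Finset.prod_nonneg fun i _ => hf _ _
    have hgw : 0 ≤ ∏ i, g i (w i) := Finset.prod_nonneg fun i _ => hg _ _
    rcases le_total (∏ i, f i (w i)) (∏ i, g i (w i)) with h | h
    · rw [min_eq_left h, if_pos h]
      split_ifs <;> linarith
    · rw [min_eq_right h, if_pos h]
      split_ifs <;> linarith
  linarith

/-- Independent coordinates: the probability that no event of a family occurs. -/
theorem sum_ite_forall_not_le {A Θ : Type*} [Fintype A] [DecidableEq A] [Fintype Θ] (μ : A → Θ → ℝ)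
    (hμ0 : ∀ a u, 0 ≤ μ a u) (hμ : ∀ a, ∑ u, μ a u = 1) (S : A → Θ → Prop) (A₁ : Finset A)
    {t : ℝ} (ht : ∀ a ∈ A₁, t ≤ ∑ u, if S a u then μ a u else 0) :
    ∑ u : A → Θ, (if ∀ a ∈ A₁, ¬ S a (u a) then ∏ a, μ a (u a) else 0) ≤
      Real.exp (-(t * A₁.card)) := by
  have h1 : ∀ u : A → Θ, (if ∀ a ∈ A₁, ¬ S a (u a) then ∏ a, μ a (u a) else 0) =
      ∏ a, (if a ∈ A₁ ∧ S a (u a) then 0 else μ a (u a)) := by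
    intro u
    split_ifs with h
    · exact Finset.prod_congr rfl fun a _ => by
        rw [if_neg]; exact fun h' => h a h'.1 h'.2
    · push Not at h
      obtain ⟨a, ha, hS⟩ := h
      exact (Finset.prod_eq_zero (Finset.mem_univ a) (by rw [if_pos ⟨ha, hS⟩])).symm
  simp_rw [h1]
  rw [sum_prod_apply (fun a u => if a ∈ A₁ ∧ S a u then 0 else μ a u)]
  calc ∏ a, ∑ u, (if a ∈ A₁ ∧ S a u then 0 else μ a u)
      ≤ ∏ a, (if a ∈ A₁ then Real.exp (-t) else 1) := by
        refine Finset.prod_le_prod (fun a _ => Finset.sum_nonneg fun u _ => ?_) fun a _ => ?_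
        · split_ifs
          · exact le_rfl
          · exact hμ0 _ _
        · split_ifs with ha
          · have h2 : ∑ u, (if a ∈ A₁ ∧ S a u then 0 else μ a u) =
                1 - ∑ u, if S a u then μ a u else 0 := by
              rw [← hμ a, ← Finset.sum_sub_distrib]
              refine Finset.sum_congr rfl fun u _ => ?_
              by_cases hS : S a u <;> simp [ha, hS]
            rw [h2]
            linarith [ht a ha, Real.add_one_le_exp (-t)]
          · simp [ha, hμ a]
    _ = Real.exp (-(t * A₁.card)) := by
        rw [Finset.prod_ite_mem, Finset.univ_inter, Finset.prod_const, ← Real.exp_nat_mul]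
        ring_nf

end ProductWeights

/-! ### Observations as independent coordinates over a single alphabet -/

noncomputable section Encoding

open scoped Classical

variable {q c g r n m : ℕ}

/-- Coordinates of an observation: the entries of the matrix, and the pairs of users (the
diagonal pairs carry irrelevant noise). -/
abbrev Coord (n m : ℕ) : Type := (Fin n × Fin m) ⊕ Sym2 (Fin n)

/-- An edge indicator in the alphabet of the entries: `none` means that there is no edge. -/
def edgeLaw (q : ℕ) (e : ℝ) : Option (ZMod q) → ℝ
  | none => 1 - e
  | some _ => e / q

theorem edgeProb_comm (P : Model q c g r) (n : ℕ) (s t : Fin c × Fin g) :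
    edgeProb P n s t = edgeProb P n t s := by
  unfold edgeProb
  simp only [eq_comm (a := s), eq_comm (a := s.1)]

/-- The edge probability of a pair of users. -/
def pairProb (P : Model q c g r) (part : Fin n → Fin c × Fin g) : Sym2 (Fin n) → ℝ :=
  Sym2.lift ⟨fun a b => edgeProb P n (part a) (part b), fun _ _ => edgeProb_comm P n _ _⟩

/-- The law of a coordinate under a ground truth. -/
def law (P : Model q c g r) (p : ℝ) (M : Instance q c g r n m) :
    Coord n m → Option (ZMod q) → ℝ
  | .inl at' => entryProb p P.θ (M.mat P at'.1 at'.2)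
  | .inr e => edgeLaw q (pairProb P M.part e)

/-- The observation encoded by a family of coordinates. -/
def decode (w : Coord n m → Option (ZMod q)) : Obs q n m :=
  (fun a t => w (.inl (a, t)),
    { Adj := fun a b => a ≠ b ∧ w (.inr s(a, b)) ≠ none
      symm := ⟨fun a b h => ⟨h.1.symm, by rw [Sym2.eq_swap]; exact h.2⟩⟩
      loopless := ⟨fun _ h => h.1 rfl⟩ })

/-- The part of the law of a coordinate that does not depend on the ground truth. -/
def baseWeight (P : Model q c g r) : Coord n m → Option (ZMod q) → ℝ
  | .inl _, _ => 1
  | .inr e, k => if e.IsDiag then edgeLaw q (min 1 (P.α * (Real.log n / n))) k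
      else if k = none then 1 else 1 / q

/-- Passes from unordered pairs, which index the coordinates, to the pairs `a < b` of `likelihood`.
-/
theorem prod_sym2_eq (f : Sym2 (Fin n) → ℝ) :
    ∏ e : Sym2 (Fin n), (if e.IsDiag then 1 else f e) =
      ∏ a : Fin n, ∏ b ∈ Finset.Ioi a, f s(a, b) := by
  have h : ∏ i ∈ (Finset.univ : Finset (Fin n)).sym2 with ¬ i.IsDiag, f i =
      ∏ i ∈ (Finset.univ : Finset (Fin n)).offDiag with i.1 < i.2, f s(i.1, i.2) :=
    Finset.sum_sym2_filter_not_isDiag (M := Additive ℝ) Finset.univ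
      fun e => Additive.ofMul (f e)
  rw [Finset.sym2_univ] at h
  rw [Finset.prod_ite, Finset.prod_const_one, one_mul, h, Finset.prod_sigma']
  refine Finset.prod_bij' (fun i _ => ⟨i.1, i.2⟩) (fun i _ => (i.1, i.2)) ?_ ?_ ?_ ?_ ?_
  · intro i hi; simp at hi ⊢; exact hi.2
  · intro i hi; simp at hi ⊢; exact ⟨hi.ne, hi⟩
  · intro i _; rfl
  · intro i _; rfl
  · intro i _; rfl

/-- Diagonal coordinates have the same law under every ground truth, which lets `baseWeight` absorb
them. -/
theorem edgeProb_self (P : Model q c g r) (n : ℕ) (s : Fin c × Fin g) :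
    edgeProb P n s s = min 1 (P.α * (Real.log n / n)) := by
  simp [edgeProb]

/-- The randomness added by the encoding, namely the symbol attached to an edge and the diagonal
pairs, has a weight that does not depend on the ground truth. Inequalities between likelihoods
therefore pass to products over coordinates. -/
theorem prod_law (P : Model q c g r) (p : ℝ) (M : Instance q c g r n m)
    (w : Coord n m → Option (ZMod q)) :
    ∏ i, law P p M i (w i) = likelihood P p M (decode w) * ∏ i, baseWeight P i (w i) := by
  rw [Fintype.prod_sum_type, Fintype.prod_sum_type, likelihood, Fintype.prod_prod_type]
  have h1 : ∏ e : Sym2 (Fin n), law P p M (.inr e) (w (.inr e)) =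
      (∏ e : Sym2 (Fin n), if e.IsDiag then 1 else
        (if w (.inr e) = none then 1 - pairProb P M.part e else pairProb P M.part e)) *
      ∏ e : Sym2 (Fin n), baseWeight (n := n) (m := m) P (.inr e) (w (.inr e)) := by
    rw [← Finset.prod_mul_distrib]
    refine Finset.prod_congr rfl fun e _ => ?_
    induction e using Sym2.ind with
    | _ a b =>
      simp only [law, baseWeight, Sym2.mk_isDiag_iff, pairProb, Sym2.lift_mk]
      by_cases hab : a = b
      · subst hab
        simp [edgeProb_self]
      · rcases hk : w (.inr s(a, b)) with _ | k
        · simp [hab, edgeLaw]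
        · simp [hab, edgeLaw, div_eq_mul_inv]
  rw [h1, prod_sym2_eq]
  have h2 : ∏ i : Fin n × Fin m, baseWeight (n := n) (m := m) P (.inl i) (w (.inl i)) = 1 :=
    Finset.prod_eq_one fun _ _ => rfl
  rw [h2, one_mul, ← mul_assoc]
  congr 1
  refine congrArg₂ _ rfl ?_
  refine Finset.prod_congr rfl fun a _ => Finset.prod_congr rfl fun b hb => ?_
  have hab : a ≠ b := (Finset.mem_Ioi.1 hb).ne
  simp only [decode, pairProb, Sym2.lift_mk]
  by_cases hk : w (.inr s(a, b)) = none <;> simp [hab, hk]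

theorem baseWeight_nonneg [NeZero q] (P : Model q c g r) (hα : 0 ≤ P.α) (i : Coord n m)
    (k : Option (ZMod q)) : 0 ≤ baseWeight P i k := by
  rcases i with i | e
  · simp [baseWeight]
  · have h1 : 0 ≤ min 1 (P.α * (Real.log n / n)) :=
      le_min zero_le_one (mul_nonneg hα (div_nonneg (Real.log_natCast_nonneg n) n.cast_nonneg))
    have h2 : min 1 (P.α * (Real.log n / n)) ≤ 1 := min_le_left _ _
    simp only [baseWeight]
    split_ifs
    · cases k
      · simp only [edgeLaw]; linarith
      · simp only [edgeLaw]; positivity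
    · exact zero_le_one
    · positivity

theorem sum_edgeLaw [NeZero q] (e : ℝ) : ∑ k, edgeLaw q e k = 1 := by
  have : (q : ℝ) ≠ 0 := NeZero.ne _
  rw [Fintype.sum_option]
  simp [edgeLaw, ZMod.card]
  field_simp
  ring

/-- The fibre of `decode` is a product set, so the sum factors. Each factor is one: an entry is
determined, an edge allows `q` symbols of weight `1 / q`, a missing edge only `none`, and a diagonal
pair everything. -/
theorem sum_baseWeight [NeZero q] (P : Model q c g r) (ω : Obs q n m) :
    ∑ w : Coord n m → Option (ZMod q),
      (if decode w = ω then ∏ i, baseWeight P i (w i) else 0) = 1 := by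
  let S : Coord n m → Finset (Option (ZMod q)) := fun i => match i with
    | .inl i => {ω.1 i.1 i.2}
    | .inr e => if e.IsDiag then Finset.univ else
        if e ∈ ω.2.edgeSet then Finset.univ.filter (· ≠ none) else {none}
  have hS : ∀ w : Coord n m → Option (ZMod q), decode w = ω ↔ w ∈ Fintype.piFinset S := by
    intro w
    rw [Fintype.mem_piFinset]
    constructor
    · rintro rfl i
      rcases i with i | e
      · simp [S, decode]
      · induction e using Sym2.ind with
        | _ a b =>
          simp only [S, Sym2.mk_isDiag_iff, SimpleGraph.mem_edgeSet, decode]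
          by_cases hab : a = b
          · simp [hab]
          · by_cases hk : w (.inr s(a, b)) = none <;> simp [hab, hk]
    · intro h
      refine Prod.ext ?_ ?_
      · funext a t
        exact Finset.mem_singleton.1 (h (.inl (a, t)))
      · ext a b
        have := h (.inr s(a, b))
        simp only [S, Sym2.mk_isDiag_iff, SimpleGraph.mem_edgeSet] at this
        simp only [decode]
        by_cases hab : a = b
        · subst hab; simp
        · by_cases hadj : ω.2.Adj a b
          · simpa [hab, hadj] using this
          · simpa [hab, hadj] using this
  simp_rw [hS]
  rw [← Finset.sum_filter, Finset.filter_mem_eq_inter, Finset.univ_inter,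
    ← Finset.prod_univ_sum]
  refine Finset.prod_eq_one fun i _ => ?_
  have hq : (q : ℝ) ≠ 0 := NeZero.ne _
  rcases i with i | e
  · simp [S, baseWeight]
  · simp only [S, baseWeight]
    split_ifs with h1 h2
    · exact sum_edgeLaw _
    · rw [Finset.sum_filter, Fintype.sum_option]
      simp [ZMod.card, hq]
    · simp

/-- Expectations under a ground truth, in terms of independent coordinates. -/
theorem sum_likelihood_mul [NeZero q] (P : Model q c g r) (p : ℝ) (M : Instance q c g r n m)
    (φ : Obs q n m → ℝ) :
    ∑ ω, likelihood P p M ω * φ ω =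
      ∑ w : Coord n m → Option (ZMod q), (∏ i, law P p M i (w i)) * φ (decode w) := by
  calc ∑ ω, likelihood P p M ω * φ ω
      = ∑ ω, ∑ w : Coord n m → Option (ZMod q),
          (if decode w = ω then (∏ i, baseWeight P i (w i)) *
            (likelihood P p M (decode w) * φ (decode w)) else 0) := by
        refine Finset.sum_congr rfl fun ω _ => ?_
        rw [← one_mul (likelihood P p M ω * φ ω), ← sum_baseWeight P ω, Finset.sum_mul]
        refine Finset.sum_congr rfl fun w _ => ?_
        split_ifs with h
        · rw [h]
        · rw [zero_mul]
    _ = _ := by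
        rw [Finset.sum_comm]
        refine Finset.sum_congr rfl fun w _ => ?_
        rw [Finset.sum_ite_eq, if_pos (Finset.mem_univ _), prod_law]
        ring

theorem errorProb_eq [NeZero q] (P : Model q c g r) (p : ℝ) (ψ : Estimator q n m)
    (M : Instance q c g r n m) :
    errorProb P p ψ M = ∑ w : Coord n m → Option (ZMod q),
      (if ψ (decode w) ≠ M.mat P then ∏ i, law P p M i (w i) else 0) := by
  have h := sum_likelihood_mul P p M (fun ω => if ψ ω ≠ M.mat P then 1 else 0)
  unfold errorProb
  simp only [mul_ite, mul_one, mul_zero] at h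
  convert h using 2

theorem prod_law_le_of_likelihood_le [NeZero q] (P : Model q c g r) (hα : 0 ≤ P.α) (p : ℝ)
    {M X : Instance q c g r n m} {w : Coord n m → Option (ZMod q)}
    (h : likelihood P p M (decode w) ≤ likelihood P p X (decode w)) :
    ∏ i, law P p M i (w i) ≤ ∏ i, law P p X i (w i) := by
  rw [prod_law, prod_law]
  exact mul_le_mul_of_nonneg_right h (Finset.prod_nonneg fun i _ => baseWeight_nonneg P hα _ _)

section Laws

variable [Fact q.Prime]

theorem two_le_cast_prime : (2 : ℝ) ≤ q := by exact_mod_cast (Fact.out : q.Prime).two_le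

theorem entryProb_nonneg {p θ : ℝ} (hp : p ∈ Set.Icc (0 : ℝ) 1) (hθ : θ ∈ Set.Icc (0 : ℝ) 1)
    (u : ZMod q) (k : Option (ZMod q)) : 0 ≤ entryProb p θ u k := by
  have := two_le_cast_prime (q := q)
  cases k with
  | none => simp only [entryProb]; linarith [hp.2]
  | some y =>
    simp only [entryProb]
    split_ifs
    · exact mul_nonneg hp.1 (by linarith [hθ.2])
    · exact mul_nonneg hp.1 (div_nonneg hθ.1 (by linarith))

/-- A sum over the alphabet of two functions of the entry that only distinguish one symbol. -/
theorem sum_zmod_ite_eq (u : ZMod q) (x y : ℝ) :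
    ∑ k : ZMod q, (if k = u then x else y) = x + (q - 1) * y := by
  have h1 : ∀ k : ZMod q, (if k = u then x else y) = (if k = u then x - y else 0) + y := by
    intro k; split_ifs <;> ring
  simp_rw [h1]
  rw [Finset.sum_add_distrib]
  simp [ZMod.card]
  ring

theorem sum_entryProb (p θ : ℝ) (u : ZMod q) : ∑ k, entryProb p θ u k = 1 := by
  have h2 := two_le_cast_prime (q := q)
  have h3 : (q : ℝ) - 1 ≠ 0 := by linarith
  rw [Fintype.sum_option]
  simp only [entryProb]
  rw [sum_zmod_ite_eq]
  field_simp
  ring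

theorem edgeLaw_nonneg {e : ℝ} (he : e ∈ Set.Icc (0 : ℝ) 1) (k : Option (ZMod q)) :
    0 ≤ edgeLaw q e k := by
  have := two_le_cast_prime (q := q)
  cases k with
  | none => simp only [edgeLaw]; linarith [he.2]
  | some y => exact div_nonneg he.1 (by linarith)

end Laws

end Encoding

/-! ### Bhattacharyya coefficients of entries and edges -/

noncomputable section Coefficients

open scoped Classical

variable {q c g r n m : ℕ}

/-- The information of an observed entry. -/
def entryInfo (q : ℕ) (θ : ℝ) : ℝ := (√(1 - θ) - √(θ / ((q : ℝ) - 1))) ^ 2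

theorem edgeProb_mem (P : Model q c g r) (hα : 0 ≤ P.α) (hβ : 0 ≤ P.β) (hγ : 0 ≤ P.γ) (n : ℕ)
    (s t : Fin c × Fin g) : edgeProb P n s t ∈ Set.Icc (0 : ℝ) 1 := by
  unfold edgeProb
  refine ⟨le_min zero_le_one (mul_nonneg ?_ (div_nonneg (Real.log_natCast_nonneg n)
    n.cast_nonneg)), min_le_left _ _⟩
  split_ifs <;> assumption

theorem pairProb_mem (P : Model q c g r) (hα : 0 ≤ P.α) (hβ : 0 ≤ P.β) (hγ : 0 ≤ P.γ)
    (part : Fin n → Fin c × Fin g) (e : Sym2 (Fin n)) :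
    pairProb P part e ∈ Set.Icc (0 : ℝ) 1 := by
  induction e using Sym2.ind with
  | _ a b => exact edgeProb_mem P hα hβ hγ n _ _

/-- Constants of the edge probabilities. -/
def edgeConst (P : Model q c g r) (s t : Fin c × Fin g) : ℝ :=
  if s = t then P.α else if s.1 = t.1 then P.β else P.γ

theorem edgeConst_comm (P : Model q c g r) (s t : Fin c × Fin g) : edgeConst P s t = edgeConst P t s := by
  simp only [edgeConst, eq_comm (a := s), eq_comm (a := s.1)]

theorem edgeProb_eq_of_le (P : Model q c g r) {n : ℕ} (hγβ : P.γ ≤ P.β) (hβα : P.β ≤ P.α)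
    (h : P.α * (Real.log n / n) ≤ 1) (s t : Fin c × Fin g) :
    edgeProb P n s t = edgeConst P s t * (Real.log n / n) := by
  unfold edgeProb edgeConst
  have h0 : 0 ≤ Real.log n / n := div_nonneg (Real.log_natCast_nonneg n) n.cast_nonneg
  refine min_eq_right (le_trans (mul_le_mul_of_nonneg_right ?_ h0) h)
  split_ifs <;> linarith

variable [Fact q.Prime]

theorem sub_one_pos : (0 : ℝ) < (q : ℝ) - 1 := by
  linarith [two_le_cast_prime (q := q)]

theorem entryInfo_eq {θ : ℝ} (h0 : 0 ≤ θ) (h1 : θ ≤ 1) :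
    entryInfo q θ = (1 - θ) + θ / ((q : ℝ) - 1) - 2 * √((1 - θ) * (θ / ((q : ℝ) - 1))) := by
  have h2 : 0 ≤ θ / ((q : ℝ) - 1) := div_nonneg h0 (sub_one_pos (q := q)).le
  unfold entryInfo
  rw [Real.sqrt_mul (by linarith), sub_sq, Real.sq_sqrt (by linarith), Real.sq_sqrt h2]
  ring

theorem theta_lt_one {θ : ℝ} (h1 : θ < ((q : ℝ) - 1) / q) : θ < 1 := by
  have := two_le_cast_prime (q := q)
  refine h1.trans ?_
  rw [div_lt_one (by linarith)]
  linarith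

/-- The bound on `θ` says precisely that the true value is more likely than each single wrong one,
`θ / (q - 1) < 1 - θ`. -/
theorem entryInfo_pos {θ : ℝ} (h0 : 0 ≤ θ) (h1 : θ < ((q : ℝ) - 1) / q) : 0 < entryInfo q θ := by
  have h2 := two_le_cast_prime (q := q)
  have h3 := sub_one_pos (q := q)
  have h4 : θ / ((q : ℝ) - 1) < 1 - θ := by
    rw [lt_div_iff₀ (by linarith)] at h1
    rw [div_lt_iff₀ h3]
    linarith
  have h5 := Real.sqrt_lt_sqrt (div_nonneg h0 h3.le) h4
  unfold entryInfo
  exact pow_pos (by linarith) 2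

/-- A sum over the alphabet of a function of the entry that only distinguishes two symbols. -/
theorem sum_zmod_ite_ite {u v : ZMod q} (huv : u ≠ v) (x y z : ℝ) :
    ∑ k : ZMod q, (if k = u then x else if k = v then y else z) = x + y + (q - 2) * z := by
  have h1 : ∀ k : ZMod q, (if k = u then x else if k = v then y else z) =
      (if k = u then x - z else 0) + ((if k = v then y - z else 0) + z) := by
    intro k
    by_cases hu : k = u
    · subst hu; simp [huv]
    · by_cases hv : k = v
      · subst hv; simp [hu]
      · simp [hu, hv]
  simp_rw [h1]
  rw [Finset.sum_add_distrib, Finset.sum_add_distrib]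
  simp [ZMod.card]
  ring

theorem sum_sqrt_entryProb_self {p θ : ℝ} (hp : p ∈ Set.Icc (0 : ℝ) 1)
    (hθ : θ ∈ Set.Icc (0 : ℝ) 1) (u : ZMod q) :
    ∑ k, √(entryProb p θ u k * entryProb p θ u k) = 1 := by
  rw [← sum_entryProb (q := q) p θ u]
  exact Finset.sum_congr rfl fun k _ => Real.sqrt_mul_self (entryProb_nonneg hp hθ u k)

theorem sum_sqrt_entryProb {p θ : ℝ} (hp : p ∈ Set.Icc (0 : ℝ) 1)
    (hθ : θ ∈ Set.Icc (0 : ℝ) 1) {u v : ZMod q} (huv : u ≠ v) :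
    ∑ k, √(entryProb p θ u k * entryProb p θ v k) = 1 - p * entryInfo q θ := by
  have h3 := sub_one_pos (q := q)
  have h2 : 0 ≤ θ / ((q : ℝ) - 1) := div_nonneg hθ.1 h3.le
  have h1 : 0 ≤ 1 - θ := by linarith [hθ.2]
  rw [Fintype.sum_option]
  have h4 : ∀ k : ZMod q, √(entryProb p θ u (some k) * entryProb p θ v (some k)) =
      if k = u then p * √((1 - θ) * (θ / ((q : ℝ) - 1))) else
        if k = v then p * √((1 - θ) * (θ / ((q : ℝ) - 1))) else p * (θ / ((q : ℝ) - 1)) := by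
    intro k
    have h5 : ∀ a b : ℝ, √(p * a * (p * b)) = p * √(a * b) := fun a b => by
      rw [show p * a * (p * b) = p ^ 2 * (a * b) by ring, Real.sqrt_mul (sq_nonneg p),
        Real.sqrt_sq hp.1]
    simp only [entryProb]
    by_cases hu : k = u
    · have hv : k ≠ v := fun h => huv (hu.symm.trans h)
      simp only [hu, if_true, huv, if_false]
      rw [h5]
    · by_cases hv : k = v
      · simp only [hv, if_true, huv.symm, if_false]
        rw [h5, mul_comm (θ / _)]
      · simp only [hu, hv, if_false]
        rw [h5, Real.sqrt_mul_self h2]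
  simp_rw [h4]
  rw [sum_zmod_ite_ite huv]
  simp only [entryProb]
  rw [Real.sqrt_mul_self (by linarith [hp.2]), entryInfo_eq hθ.1 hθ.2]
  field_simp
  ring

theorem sum_sqrt_edgeLaw {e f : ℝ} (he : e ∈ Set.Icc (0 : ℝ) 1) (hf : f ∈ Set.Icc (0 : ℝ) 1) :
    ∑ k, √(edgeLaw q e k * edgeLaw q f k) = √((1 - e) * (1 - f)) + √(e * f) := by
  have h2 := two_le_cast_prime (q := q)
  rw [Fintype.sum_option]
  simp only [edgeLaw]
  have h1 : √(e / q * (f / q)) = √(e * f) / q := by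
    rw [show e / q * (f / q) = e * f / (q : ℝ) ^ 2 by field_simp,
      Real.sqrt_div (mul_nonneg he.1 hf.1), Real.sqrt_sq (by linarith)]
  rw [h1]
  simp [ZMod.card]
  field_simp

/-- AM-GM for the symbol `none`: the geometric mean of `1 - e` and `1 - f` is at most `1 - (e + f) /
2`. -/
theorem sum_sqrt_edgeLaw_le {e f : ℝ} (he : e ∈ Set.Icc (0 : ℝ) 1) (hf : f ∈ Set.Icc (0 : ℝ) 1) :
    ∑ k, √(edgeLaw q e k * edgeLaw q f k) ≤ 1 - (√e - √f) ^ 2 / 2 := by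
  rw [sum_sqrt_edgeLaw he hf, sub_sq, Real.sq_sqrt he.1, Real.sq_sqrt hf.1, Real.sqrt_mul he.1]
  have h1 : √((1 - e) * (1 - f)) ≤ 1 - (e + f) / 2 := by
    rw [Real.sqrt_le_left (by linarith [he.2, hf.2])]
    nlinarith [sq_nonneg (e - f)]
  linarith

/-- The reverse bound for the converse. For edge probabilities of order `log n / n` the quadratic
errors sum to order `log² n / n` over the pairs of one user, which is negligible. -/
theorem sum_sqrt_edgeLaw_ge {e f : ℝ} (he : e ∈ Set.Icc (0 : ℝ) 1) (hf : f ∈ Set.Icc (0 : ℝ) 1) :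
    1 - (√e - √f) ^ 2 / 2 - (e ^ 2 + f ^ 2) ≤ ∑ k, √(edgeLaw q e k * edgeLaw q f k) := by
  rw [sum_sqrt_edgeLaw he hf, sub_sq, Real.sq_sqrt he.1, Real.sq_sqrt hf.1, Real.sqrt_mul he.1]
  have h1 : 1 - (e + f) / 2 - (e ^ 2 + f ^ 2) ≤ √((1 - e) * (1 - f)) := by
    by_cases h0 : 0 ≤ 1 - (e + f) / 2 - (e ^ 2 + f ^ 2)
    · refine Real.le_sqrt_of_sq_le ?_
      have : 0 ≤ e * f := mul_nonneg he.1 hf.1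
      nlinarith [sq_nonneg (e - f), sq_nonneg e, sq_nonneg f, he.1, hf.1]
    · exact (not_le.1 h0).le.trans (Real.sqrt_nonneg _)
  linarith

variable (P : Model q c g r)

theorem law_nonneg (hα : 0 ≤ P.α) (hβ : 0 ≤ P.β) (hγ : 0 ≤ P.γ) {p : ℝ}
    (hp : p ∈ Set.Icc (0 : ℝ) 1) (hθ : P.θ ∈ Set.Icc (0 : ℝ) 1) (M : Instance q c g r n m)
    (i : Coord n m) (k : Option (ZMod q)) : 0 ≤ law P p M i k := by
  rcases i with i | e
  · exact entryProb_nonneg hp hθ _ _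
  · exact edgeLaw_nonneg (pairProb_mem P hα hβ hγ _ _) _

theorem sum_law (p : ℝ) (M : Instance q c g r n m) (i : Coord n m) :
    ∑ k, law P p M i k = 1 := by
  rcases i with i | e
  · exact sum_entryProb _ _ _
  · exact sum_edgeLaw _

end Coefficients

/-! ### The union bound, and a lower bound valid for every estimator -/

noncomputable section MaximumLikelihood

open scoped Classical

variable {q c g r n m : ℕ} [Fact q.Prime]

instance : Finite (Instance q c g r n m) :=
  Finite.of_injective (fun M : Instance q c g r n m => (M.basis, M.part)) fun M M' h => by
    cases M; cases M'; simp_all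

instance : Fintype (Instance q c g r n m) := Fintype.ofFinite _

theorem errorProb_le_worstError (P : Model q c g r) (p δg δc : ℝ) (ψ : Estimator q n m)
    {M : Instance q c g r n m} (hM : M ∈ matSet P n m δg δc) :
    errorProb P p ψ M ≤ worstError P p δg δc ψ :=
  le_ciSup (f := fun M : matSet P n m δg δc => errorProb P p ψ M.1) (Set.finite_range _).bddAbove
    ⟨M, hM⟩

theorem worstError_le {P : Model q c g r} {p δg δc : ℝ} {ψ : Estimator q n m} {b : ℝ}
    (hne : (matSet P n m δg δc).Nonempty)
    (h : ∀ M ∈ matSet P n m δg δc, errorProb P p ψ M ≤ b) : worstError P p δg δc ψ ≤ b := by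
  have := hne.to_subtype
  exact ciSup_le fun M => h M.1 M.2

theorem exists_isMaxLikelihood (P : Model q c g r) (p δg δc : ℝ)
    (hne : (matSet P n m δg δc).Nonempty) :
    ∃ ψ : Estimator q n m, IsMaxLikelihood P p δg δc ψ := by
  have h : ∀ ω : Obs q n m, ∃ X ∈ matSet P n m δg δc, ∀ X' ∈ matSet P n m δg δc,
      likelihood P p X' ω ≤ likelihood P p X ω := fun ω =>
    Set.exists_max_image _ (fun X => likelihood P p X ω) (Set.toFinite _) hne
  choose X hX hmax using h
  exact ⟨fun ω => (X ω).mat P, fun ω => ⟨X ω, hX ω, rfl, hmax ω⟩⟩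

/-- The union bound for maximum-likelihood estimators. -/
theorem errorProb_le_sum (P : Model q c g r) (hα : 0 ≤ P.α) (hβ : 0 ≤ P.β) (hγ : 0 ≤ P.γ) {p : ℝ}
    (hp : p ∈ Set.Icc (0 : ℝ) 1) (hθ : P.θ ∈ Set.Icc (0 : ℝ) 1) {δg δc : ℝ}
    {ψ : Estimator q n m} (hψ : IsMaxLikelihood P p δg δc ψ)
    {M : Instance q c g r n m}
    (hM : M ∈ matSet P n m δg δc) :
    errorProb P p ψ M ≤ ∑ X : Instance q c g r n m,
      if X ∈ matSet P n m δg δc ∧ X.mat P ≠ M.mat P then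
        ∏ i, ∑ k, √(law P p M i k * law P p X i k) else 0 := by
  rw [errorProb_eq]
  have hl := law_nonneg P hα hβ hγ hp hθ (n := n) (m := m)
  calc _ ≤ ∑ w : Coord n m → Option (ZMod q), ∑ X : Instance q c g r n m,
        (if X ∈ matSet P n m δg δc ∧ X.mat P ≠ M.mat P then
          (if ∏ i, law P p M i (w i) ≤ ∏ i, law P p X i (w i) then ∏ i, law P p M i (w i) else 0)
          else 0) := by
        refine Finset.sum_le_sum fun w _ => ?_
        have h0 : 0 ≤ ∏ i, law P p M i (w i) := Finset.prod_nonneg fun i _ => hl _ _ _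
        have hn : ∀ X : Instance q c g r n m, 0 ≤ (if X ∈ matSet P n m δg δc ∧ X.mat P ≠ M.mat P then
          (if ∏ i, law P p M i (w i) ≤ ∏ i, law P p X i (w i) then ∏ i, law P p M i (w i) else 0)
          else 0) := fun X => by split_ifs <;> first | exact h0 | exact le_rfl
        split_ifs with h
        -- An error is charged to the selected member itself, which is a competitor at least as
        -- likely as `M`.
        · obtain ⟨X, hX, hmat, hmax⟩ := hψ (decode w)
          refine le_trans ?_ (Finset.single_le_sum (fun X _ => hn X) (Finset.mem_univ X))
          rw [if_pos ⟨hX, hmat ▸ h⟩,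
            if_pos (prod_law_le_of_likelihood_le P hα p (hmax M hM))]
        · exact Finset.sum_nonneg fun X _ => hn X
    _ ≤ _ := by
        rw [Finset.sum_comm]
        refine Finset.sum_le_sum fun X _ => ?_
        by_cases h : X ∈ matSet P n m δg δc ∧ X.mat P ≠ M.mat P
        · simp only [if_pos h]
          exact sum_ite_prod_le_prod_sum_sqrt (law P p M) (law P p X) (hl M) (hl X)
        · simp only [if_neg h, Finset.sum_const_zero, le_refl]

/-- If under every member of a family of ground truths with distinct matrices some other member
is at least as likely with probability `κ`, then no estimator has worst-case error below `κ / 2`. -/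
theorem half_le_worstError (P : Model q c g r) (hα : 0 ≤ P.α) (hβ : 0 ≤ P.β) (hγ : 0 ≤ P.γ)
    {p : ℝ} (hp : p ∈ Set.Icc (0 : ℝ) 1) (hθ : P.θ ∈ Set.Icc (0 : ℝ) 1) {δg δc : ℝ}
    (ψ : Estimator q n m) (F : Finset (Instance q c g r n m)) (hne : F.Nonempty)
    (hF : ∀ M ∈ F, M ∈ matSet P n m δg δc)
    (hinj : ∀ M ∈ F, ∀ X ∈ F, M.mat P = X.mat P → M = X) {κ : ℝ}
    (hκ : ∀ M ∈ F, κ ≤ ∑ w : Coord n m → Option (ZMod q),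
      if ∃ X ∈ F, X ≠ M ∧ ∏ i, law P p M i (w i) ≤ ∏ i, law P p X i (w i) then
        ∏ i, law P p M i (w i) else 0) :
    κ / 2 ≤ worstError P p δg δc ψ := by
  have hl := law_nonneg P hα hβ hγ hp hθ (n := n) (m := m)
  set W : Instance q c g r n m → (Coord n m → Option (ZMod q)) → ℝ :=
    fun M w => ∏ i, law P p M i (w i) with hW
  have hW0 : ∀ M w, 0 ≤ W M w := fun M w => Finset.prod_nonneg fun i _ => hl _ _ _
  have hpt : ∀ w, ∑ M ∈ F, (if ∃ X ∈ F, X ≠ M ∧ W M w ≤ W X w then W M w else 0) ≤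
      2 * ∑ M ∈ F, (if ψ (decode w) ≠ M.mat P then W M w else 0) := by
    intro w
    have hn : ∀ M ∈ F, 0 ≤ (if ψ (decode w) ≠ M.mat P then W M w else 0) := fun M _ => by
      split_ifs <;> first | exact hW0 _ _ | exact le_rfl
    -- Since the matrices are distinct, at most one member `M₁` is estimated correctly at `w`, and
    -- only its weight is missing on the right. That weight is at most the one of `X`, which is
    -- estimated wrongly and so is present: hence the factor 2.
    by_cases hex : ∃ M₁ ∈ F, ψ (decode w) = M₁.mat P ∧ ∃ X ∈ F, X ≠ M₁ ∧ W M₁ w ≤ W X w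
    · obtain ⟨M₁, hM₁, hψ₁, X, hX, hXM, hle⟩ := hex
      have h1 : W X w ≤ ∑ M ∈ F, (if ψ (decode w) ≠ M.mat P then W M w else 0) := by
        refine le_trans ?_ (Finset.single_le_sum hn hX)
        rw [if_pos]
        rw [hψ₁]
        exact fun h => hXM (hinj _ hM₁ _ hX h).symm
      have h2 : ∑ M ∈ F, (if ∃ X ∈ F, X ≠ M ∧ W M w ≤ W X w then W M w else 0) ≤
          ∑ M ∈ F, ((if ψ (decode w) ≠ M.mat P then W M w else 0) +
            if M = M₁ then W M₁ w else 0) := by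
        refine Finset.sum_le_sum fun M hM => ?_
        by_cases hMM : M = M₁
        · subst hMM
          rw [if_pos rfl]
          have := hn M hM
          split_ifs <;> linarith [hW0 M w]
        · rw [if_neg hMM, add_zero, if_pos (c := ψ (decode w) ≠ M.mat P)]
          · split_ifs
            · exact le_rfl
            · exact hW0 _ _
          · rw [hψ₁]
            exact fun h => hMM (hinj _ hM₁ _ hM h).symm
      rw [Finset.sum_add_distrib, Finset.sum_ite_eq' , if_pos hM₁] at h2
      linarith
    · have h2 : ∑ M ∈ F, (if ∃ X ∈ F, X ≠ M ∧ W M w ≤ W X w then W M w else 0) ≤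
          ∑ M ∈ F, (if ψ (decode w) ≠ M.mat P then W M w else 0) := by
        refine Finset.sum_le_sum fun M hM => ?_
        split_ifs with ha hb
        · exact le_rfl
        · exact absurd ⟨M, hM, not_not.1 hb, ha⟩ hex
        · exact hW0 _ _
        · exact le_rfl
      have h3 := Finset.sum_nonneg hn
      linarith
  have h1 : (F.card : ℝ) * κ ≤ 2 * ((F.card : ℝ) * worstError P p δg δc ψ) := by
    calc (F.card : ℝ) * κ = ∑ M ∈ F, κ := by simp
      _ ≤ ∑ M ∈ F, ∑ w, (if ∃ X ∈ F, X ≠ M ∧ W M w ≤ W X w then W M w else 0) :=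
          Finset.sum_le_sum hκ
      _ ≤ 2 * ∑ M ∈ F, errorProb P p ψ M := by
          rw [Finset.sum_comm]
          simp_rw [errorProb_eq]
          rw [Finset.sum_comm (s := F), Finset.mul_sum]
          exact Finset.sum_le_sum fun w _ => hpt w
      _ ≤ 2 * ∑ M ∈ F, worstError P p δg δc ψ := by
          have := Finset.sum_le_sum fun M hM => errorProb_le_worstError P p δg δc ψ (hF M hM)
          linarith
      _ = _ := by simp
  have h2 : (0 : ℝ) < F.card := by exact_mod_cast hne.card_pos
  nlinarith

end MaximumLikelihood

/-! ### Combinatorics of two balanced labellings of the users -/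

noncomputable section Alignment

open scoped Classical

variable {U S K : Type*} [Fintype U] [DecidableEq S] [DecidableEq K] {m : ℕ}

/-- Number of users with label `s` under `τ` and label `t` under `σ`. -/
def confusion (τ σ : U → S) (s t : S) : ℕ := (Finset.univ.filter fun a => τ a = s ∧ σ a = t).card

/-- After the relabelling `π` all but a fraction `η` of each group is labelled correctly. -/
def IsAligned (N : ℕ) (η : ℝ) (τ σ : U → S) (π : Equiv.Perm S) : Prop :=
  ∀ s, (1 - η) * N ≤ confusion τ σ s (π s)

theorem sum_ite_and_eq (τ σ : U → S) (s t : S) (x : ℝ) :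
    ∑ a, (if τ a = s ∧ σ a = t then x else 0) = confusion τ σ s t * x := by
  rw [← Finset.sum_filter, Finset.sum_const, nsmul_eq_mul, confusion]

theorem sum_ite_eq_card (τ : U → S) {N : ℕ}
    (hτ : ∀ s, (Finset.univ.filter fun a => τ a = s).card = N) (s : S) (x : ℝ) :
    ∑ a, (if τ a = s then x else 0) = N * x := by
  rw [← Finset.sum_filter, Finset.sum_const, nsmul_eq_mul, hτ]

theorem sum_ite_and_ne (τ σ : U → S) {N : ℕ}
    (hτ : ∀ s, (Finset.univ.filter fun a => τ a = s).card = N) (s t : S) (x : ℝ) :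
    ∑ a, (if τ a = s ∧ σ a ≠ t then x else 0) = (N - confusion τ σ s t) * x := by
  rw [sub_mul, ← sum_ite_eq_card τ hτ s x, ← sum_ite_and_eq τ σ s t x, ← Finset.sum_sub_distrib]
  refine Finset.sum_congr rfl fun a _ => ?_
  by_cases h1 : τ a = s <;> by_cases h2 : σ a = t <;> simp [h1, h2]

theorem hammingDist_triangle_real (x y z : Fin m → K) :
    (hammingDist x z : ℝ) ≤ hammingDist x y + hammingDist y z := by
  exact_mod_cast hammingDist_triangle x y z

/-- For relabellings that do not preserve `R`: a single violated pair of labels is seen by all pairs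
of correctly labelled users of these two groups, which gives a contribution quadratic in `N`. -/
theorem sum_sum_sq_ge_of_ne {τ σ : U → S} {N : ℕ} {η : ℝ} (hη : η ≤ 1) {π : Equiv.Perm S}
    (hπ : IsAligned N η τ σ π) (R : S → S → ℝ) (s t : S) :
    ((1 - η) * N) ^ 2 * (R s t - R (π s) (π t)) ^ 2 ≤
      ∑ a, ∑ b, (R (τ a) (τ b) - R (σ a) (σ b)) ^ 2 := by
  have h1 : ∑ a, ∑ b, (if τ a = s ∧ σ a = π s then
      (if τ b = t ∧ σ b = π t then (R s t - R (π s) (π t)) ^ 2 else 0) else 0) ≤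
      ∑ a, ∑ b, (R (τ a) (τ b) - R (σ a) (σ b)) ^ 2 := by
    refine Finset.sum_le_sum fun a _ => Finset.sum_le_sum fun b _ => ?_
    split_ifs with h h'
    · rw [h.1, h.2, h'.1, h'.2]
    · exact sq_nonneg _
    · exact sq_nonneg _
  have h2 : ∀ a, ∑ b, (if τ a = s ∧ σ a = π s then
      (if τ b = t ∧ σ b = π t then (R s t - R (π s) (π t)) ^ 2 else 0) else 0) =
      if τ a = s ∧ σ a = π s then
        confusion τ σ t (π t) * (R s t - R (π s) (π t)) ^ 2 else 0 := by
    intro a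
    split_ifs
    · exact sum_ite_and_eq _ _ _ _ _
    · simp
  simp_rw [h2] at h1
  rw [sum_ite_and_eq, ← mul_assoc] at h1
  refine le_trans (mul_le_mul_of_nonneg_right ?_ (sq_nonneg _)) h1
  rw [sq]
  exact mul_le_mul (hπ s) (hπ t) (mul_nonneg (by linarith) N.cast_nonneg) (Nat.cast_nonneg _)

variable [Fintype S]

/-- If every `v s` is within `d / 2` of some `v' (f s)`, separation makes `f` injective, hence a
relabelling. As it is not an alignment, more than `η N` users of some group have a label other than
the matched one, and by the triangle inequality each is at distance at least `d / 2`. Otherwise some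
`v s` is far from all `v' t`, and every user of group `s` contributes. -/
theorem hammingDist_ge_of_not_isAligned {τ σ : U → S} {N : ℕ}
    (hτ : ∀ s, (Finset.univ.filter fun a => τ a = s).card = N) {v v' : S → Fin m → K} {d η : ℝ}
    (hd : 0 ≤ d) (hη1 : η ≤ 1)
    (hv : ∀ s t, s ≠ t → d ≤ hammingDist (v s) (v t))
    (hv' : ∀ s t, s ≠ t → d ≤ hammingDist (v' s) (v' t))
    (hfar : ¬ ∃ π, IsAligned N η τ σ π) :
    η * N * (d / 2) ≤ ∑ a, (hammingDist (v (τ a)) (v' (σ a)) : ℝ) := by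
  by_cases hcl : ∀ s, ∃ t, (hammingDist (v s) (v' t) : ℝ) < d / 2
  · choose f hf using hcl
    have hinj : Function.Injective f := by
      intro s s' hss
      by_contra hne
      have h1 := hammingDist_triangle_real (v s) (v' (f s)) (v s')
      have h2 := hf s'
      rw [← hss, hammingDist_comm] at h2
      linarith [hf s, hv s s' hne]
    let π : Equiv.Perm S := Equiv.ofBijective f (Finite.injective_iff_bijective.1 hinj)
    have hπ : ¬ IsAligned N η τ σ π := fun h => hfar ⟨π, h⟩
    unfold IsAligned at hπ
    push Not at hπ
    obtain ⟨s, hs⟩ := hπ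
    have h1 : ∑ a, (if τ a = s ∧ σ a ≠ π s then d / 2 else 0) ≤
        ∑ a, (hammingDist (v (τ a)) (v' (σ a)) : ℝ) := by
      refine Finset.sum_le_sum fun a _ => ?_
      split_ifs with h
      · rw [h.1]
        have h2 := hammingDist_triangle_real (v' (σ a)) (v s) (v' (π s))
        have h3 : (hammingDist (v s) (v' (π s)) : ℝ) < d / 2 := hf s
        rw [hammingDist_comm (v' (σ a)) (v s)] at h2
        linarith [hv' _ _ h.2]
      · positivity
    rw [sum_ite_and_ne τ σ hτ] at h1
    refine le_trans ?_ h1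
    exact mul_le_mul_of_nonneg_right (by linarith) (by linarith)
  · push Not at hcl
    obtain ⟨s, hs⟩ := hcl
    have h1 : ∑ a, (if τ a = s then d / 2 else 0) ≤
        ∑ a, (hammingDist (v (τ a)) (v' (σ a)) : ℝ) := by
      refine Finset.sum_le_sum fun a _ => ?_
      split_ifs with h
      · rw [h]; exact hs _
      · positivity
    rw [sum_ite_eq_card τ hτ] at h1
    refine le_trans ?_ h1
    have : (0 : ℝ) ≤ N := N.cast_nonneg
    exact mul_le_mul_of_nonneg_right (by nlinarith) (by linarith)

/-- Separates errors of the vectors from errors of the labels. For each `s` at least `(1 - η) N`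
correctly labelled users see the distance from `v s` to `v' (π s)`. A wrongly labelled user sees the
distance of the two true vectors, up to one such vector error; at most `η N` users enter each group
wrongly. This explains the factor `1 - 2 * η`. -/
theorem hammingDist_ge_of_isAligned {τ σ : U → S} {N : ℕ}
    (hσ : ∀ s, (Finset.univ.filter fun a => σ a = s).card = N) (v v' : S → Fin m → K) {η : ℝ}
    {π : Equiv.Perm S} (hπ : IsAligned N η τ σ π) :
    (1 - 2 * η) * N * ∑ s, (hammingDist (v s) (v' (π s)) : ℝ) +
      ∑ a, (hammingDist (v (τ a)) (v (π.symm (σ a))) : ℝ) ≤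
      ∑ a, (hammingDist (v (τ a)) (v' (σ a)) : ℝ) := by
  have hpt : ∀ a, (hammingDist (v (τ a)) (v (π.symm (σ a))) : ℝ) +
      ∑ s, ((if τ a = s ∧ σ a = π s then (hammingDist (v s) (v' (π s)) : ℝ) else 0) -
        (if σ a = π s ∧ τ a ≠ s then (hammingDist (v s) (v' (π s)) : ℝ) else 0)) ≤
      hammingDist (v (τ a)) (v' (σ a)) := by
    intro a
    rw [Finset.sum_eq_single (π.symm (σ a))]
    · by_cases h : τ a = π.symm (σ a)
      · simp [← h]
        simp [h]
      · have := hammingDist_triangle_real (v (τ a)) (v' (σ a)) (v (π.symm (σ a)))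
        simp only [h, false_and, if_false, Equiv.apply_symm_apply, ne_eq, not_false_eq_true,
          and_self, if_true]
        rw [hammingDist_comm (v' (σ a))] at this
        linarith
    · intro s _ hs
      have : σ a ≠ π s := fun h => hs (by rw [h]; simp)
      simp [this]
    · simp
  refine le_trans ?_ (Finset.sum_le_sum fun a _ => hpt a)
  rw [Finset.sum_add_distrib, Finset.sum_comm, add_comm, Finset.mul_sum]
  refine add_le_add le_rfl (Finset.sum_le_sum fun s _ => ?_)
  rw [Finset.sum_sub_distrib, sum_ite_and_eq, sum_ite_and_ne σ τ hσ]
  have h1 : confusion σ τ (π s) s = confusion τ σ s (π s) := by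
    simp only [confusion, and_comm]
  rw [h1, ← sub_mul]
  exact mul_le_mul_of_nonneg_right (by linarith [hπ s]) (Nat.cast_nonneg _)

/-- Some group `s` of `τ` is split by `σ`: if each had a part of size `(1 - η) N > N / 2` inside one
group of `σ`, the assignment would be injective and an alignment. Every user of the split group is
then separated by `σ` from at least `η N` others of that group. -/
theorem sum_sum_ge_of_not_isAligned {τ σ : U → S} {N : ℕ} (hN : 0 < N)
    (hτ : ∀ s, (Finset.univ.filter fun a => τ a = s).card = N)
    (hσ : ∀ s, (Finset.univ.filter fun a => σ a = s).card = N) {η : ℝ}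
    (hη1 : η < 1 / 2) (hfar : ¬ ∃ π, IsAligned N η τ σ π) {φ : U → U → ℝ}
    (hφ0 : ∀ a b, 0 ≤ φ a b) {x : ℝ} (hx : 0 ≤ x)
    (hφ : ∀ a b, τ a = τ b → σ a ≠ σ b → x ≤ φ a b) :
    η * N ^ 2 * x ≤ ∑ a, ∑ b, φ a b := by
  have hN' : (0 : ℝ) < N := by exact_mod_cast hN
  have hex : ∃ s, ∀ t, (confusion τ σ s t : ℝ) < (1 - η) * N := by
    by_contra hcon
    push Not at hcon
    choose f hf using hcon
    have hinj : Function.Injective f := by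
      intro s s' hss
      by_contra hne
      have h1 : ∑ a, ((if τ a = s ∧ σ a = f s then (1 : ℝ) else 0) +
          (if τ a = s' ∧ σ a = f s then 1 else 0)) ≤ ∑ a, (if σ a = f s then 1 else 0) := by
        refine Finset.sum_le_sum fun a _ => ?_
        by_cases h1 : τ a = s
        · have h2 : τ a ≠ s' := fun h => hne (h1.symm.trans h)
          by_cases h3 : σ a = f s <;> simp [h1, h3, hne]
        · by_cases h2 : τ a = s'
          · by_cases h3 : σ a = f s <;> simp [h2, h3, Ne.symm hne]
          · simp only [h1, h2, false_and, if_false, add_zero]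
            split_ifs <;> norm_num
      rw [Finset.sum_add_distrib, sum_ite_and_eq, sum_ite_and_eq, sum_ite_eq_card σ hσ] at h1
      have h2 := hf s
      have h3 := hf s'
      rw [← hss] at h3
      nlinarith
    exact hfar ⟨Equiv.ofBijective f (Finite.injective_iff_bijective.1 hinj), hf⟩
  obtain ⟨s, hs⟩ := hex
  have h1 : ∀ a, (if τ a = s then η * N * x else 0) ≤ ∑ b, φ a b := by
    intro a
    split_ifs with ha
    · have h2 : ∑ b, (if τ b = s ∧ σ b ≠ σ a then x else 0) ≤ ∑ b, φ a b := by
        refine Finset.sum_le_sum fun b _ => ?_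
        split_ifs with hb
        · exact hφ a b (ha.trans hb.1.symm) hb.2.symm
        · exact hφ0 _ _
      rw [sum_ite_and_ne τ σ hτ] at h2
      exact (mul_le_mul_of_nonneg_right (by linarith [hs (σ a)]) hx).trans h2
    · exact Finset.sum_nonneg fun b _ => hφ0 _ _
  have h2 := Finset.sum_le_sum fun a (_ : a ∈ Finset.univ) => h1 a
  rw [sum_ite_eq_card τ hτ] at h2
  refine le_trans (le_of_eq ?_) h2
  ring

/-- A wrongly labelled user is tested against the correctly labelled users, of which each group has
at least `(1 - η) N`. The factor 2 comes from the two orders of a pair. -/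
theorem sum_sum_sq_ge_of_isAligned {τ σ : U → S} {N : ℕ} {η : ℝ} {π : Equiv.Perm S}
    (hπ : IsAligned N η τ σ π) {R : S → S → ℝ} (hR : ∀ s t, R s t = R t s)
    (hRπ : ∀ s t, R (π s) (π t) = R s t) :
    2 * ((1 - η) * N) * ∑ a, ∑ u, (R (τ a) u - R (π.symm (σ a)) u) ^ 2 ≤
      ∑ a, ∑ b, (R (τ a) (τ b) - R (σ a) (σ b)) ^ 2 := by
  have hRσ : ∀ a b, R (σ a) (σ b) = R (π.symm (σ a)) (π.symm (σ b)) := fun a b => by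
    rw [← hRπ (π.symm (σ a))]; simp
  simp_rw [hRσ]
  set ρ : U → S := fun a => π.symm (σ a) with hρ
  have hcard : ∀ a, ((1 - η) * N) * ∑ u, (R (τ a) u - R (ρ a) u) ^ 2 ≤
      ∑ b, (if ρ b = τ b then (R (τ a) (τ b) - R (ρ a) (ρ b)) ^ 2 else 0) := by
    intro a
    have h1 : ∀ b, (if ρ b = τ b then (R (τ a) (τ b) - R (ρ a) (ρ b)) ^ 2 else 0) =
        ∑ u, (if τ b = u ∧ σ b = π u then (R (τ a) u - R (ρ a) u) ^ 2 else 0) := by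
      intro b
      rw [Finset.sum_eq_single (τ b)]
      · have h2 : ρ b = τ b ↔ σ b = π (τ b) := by rw [hρ]; exact Equiv.symm_apply_eq π
        by_cases h3 : ρ b = τ b
        · rw [if_pos h3, if_pos ⟨rfl, h2.1 h3⟩, h3]
        · rw [if_neg h3, if_neg fun h => h3 (h2.2 h.2)]
      · intro u _ hu
        simp [Ne.symm hu]
      · simp
    simp_rw [h1]
    rw [Finset.sum_comm, Finset.mul_sum]
    refine Finset.sum_le_sum fun u _ => ?_
    rw [sum_ite_and_eq]
    exact mul_le_mul_of_nonneg_right (hπ u) (sq_nonneg _)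
  -- Nothing is counted twice: if both users are labelled correctly, the summand is zero.
  have h2 : ∑ a, ∑ b, ((if ρ b = τ b then (R (τ a) (τ b) - R (ρ a) (ρ b)) ^ 2 else 0) +
      (if ρ a = τ a then (R (τ a) (τ b) - R (ρ a) (ρ b)) ^ 2 else 0)) ≤
      ∑ a, ∑ b, (R (τ a) (τ b) - R (ρ a) (ρ b)) ^ 2 := by
    refine Finset.sum_le_sum fun a _ => Finset.sum_le_sum fun b _ => ?_
    have := sq_nonneg (R (τ a) (τ b) - R (ρ a) (ρ b))
    by_cases ha : ρ a = τ a <;> by_cases hb : ρ b = τ b <;> simp [ha, hb, this]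
  simp_rw [Finset.sum_add_distrib] at h2
  have h3 : ∑ a, ∑ b, (if ρ a = τ a then (R (τ a) (τ b) - R (ρ a) (ρ b)) ^ 2 else 0) =
      ∑ a, ∑ b, (if ρ b = τ b then (R (τ a) (τ b) - R (ρ a) (ρ b)) ^ 2 else 0) := by
    rw [Finset.sum_comm]
    refine Finset.sum_congr rfl fun b _ => Finset.sum_congr rfl fun a _ => ?_
    rw [hR (τ a), hR (ρ a)]
  rw [h3] at h2
  have h4 := Finset.sum_le_sum fun a (_ : a ∈ Finset.univ) => hcard a
  rw [← Finset.mul_sum] at h4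
  linarith

end Alignment

/-! ### Symmetries of the edge constants and graph exponents -/

section EdgeConstants

variable {q c g r : ℕ}

/-- Relabelling that exchanges the roles of two labels with respect to the edge constants. -/
theorem exists_perm_edgeConst (P : Model q c g r) (s t : Fin c × Fin g) :
    ∃ κ : Equiv.Perm (Fin c × Fin g), κ s = t ∧ κ t = s ∧ ∀ u,
      edgeConst P s (κ u) = edgeConst P t u ∧ edgeConst P t (κ u) = edgeConst P s u := by
  -- Exchanging clusters and exchanging positions inside all clusters both respect the hierarchy, so
  -- the product is an automorphism of the edge constants.
  let κ : Equiv.Perm (Fin c × Fin g) :=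
    (Equiv.swap s.1 t.1).prodCongr (Equiv.swap s.2 t.2)
  have hκs : κ s = t := by simp [κ, Prod.ext_iff]
  have hκt : κ t = s := by simp [κ, Prod.ext_iff]
  have hκ : ∀ u u', edgeConst P (κ u) (κ u') = edgeConst P u u' := by
    intro u u'
    have h1 : (κ u).1 = (κ u').1 ↔ u.1 = u'.1 := by simp [κ]
    simp only [edgeConst, EmbeddingLike.apply_eq_iff_eq, h1]
  refine ⟨κ, hκs, hκt, fun u => ⟨?_, ?_⟩⟩
  · rw [← hκ t u, hκt]
  · rw [← hκ s u, hκs]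

/-- The graph part of the exponent of a confusion of the labels `s` and `t`. -/
noncomputable def graphInfo (P : Model q c g r) (s t : Fin c × Fin g) : ℝ :=
  (∑ u, (√(edgeConst P s u) - √(edgeConst P t u)) ^ 2) / 2

theorem graphInfo_nonneg (P : Model q c g r) (s t : Fin c × Fin g) : 0 ≤ graphInfo P s t :=
  div_nonneg (Finset.sum_nonneg fun _ _ => sq_nonneg _) zero_le_two

/-- Two groups of one cluster are distinguished only by their edges to these two groups themselves;
the two equal contributions cancel the factor `1 / 2`. -/
theorem graphInfo_intra (P : Model q c g r) {s t : Fin c × Fin g} (hst : s ≠ t) (h : s.1 = t.1) :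
    graphInfo P s t = (√P.α - √P.β) ^ 2 := by
  have h1 : ∀ u, (√(edgeConst P s u) - √(edgeConst P t u)) ^ 2 =
      (if s = u then (√P.α - √P.β) ^ 2 else 0) + (if t = u then (√P.α - √P.β) ^ 2 else 0) := by
    intro u
    unfold edgeConst
    by_cases hs : s = u
    · subst hs
      simp [hst.symm, h]
    · by_cases ht : t = u
      · subst ht
        simp [hst, h]
        ring
      · simp [hs, ht, h]
  unfold graphInfo
  simp_rw [h1]
  rw [Finset.sum_add_distrib, Finset.sum_ite_eq, Finset.sum_ite_eq]
  simp

/-- In each of the two clusters one group compares `α` with `γ` and the `g - 1` others compare `β`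
with `γ`. -/
theorem graphInfo_inter (P : Model q c g r) {s t : Fin c × Fin g} (h : s.1 ≠ t.1) :
    graphInfo P s t = (√P.α - √P.γ) ^ 2 + ((g : ℝ) - 1) * (√P.β - √P.γ) ^ 2 := by
  have hst : s ≠ t := fun h' => h (by rw [h'])
  set A := (√P.α - √P.γ) ^ 2
  set B := (√P.β - √P.γ) ^ 2
  have h1 : ∀ u, (√(edgeConst P s u) - √(edgeConst P t u)) ^ 2 =
      ((if s = u then A - B else 0) + (if t = u then A - B else 0)) +
      ((if s.1 = u.1 then B else 0) + (if t.1 = u.1 then B else 0)) := by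
    intro u
    unfold edgeConst
    by_cases hs : s = u
    · subst hs
      simp [hst.symm, h.symm, A, B]
    · by_cases ht : t = u
      · subst ht
        simp [hst, h, A, B]
        ring
      · by_cases hs1 : s.1 = u.1
        · have ht1 : t.1 ≠ u.1 := fun h' => h (hs1.trans h'.symm)
          simp [hs, ht, hs1, ht1, B]
        · by_cases ht1 : t.1 = u.1
          · simp [hs, ht, hs1, ht1, B]
            ring
          · simp [hs, ht, hs1, ht1]
  have h2 : ∀ x : Fin c, ∑ u : Fin c × Fin g, (if x = u.1 then B else 0) = g * B := by
    intro x
    rw [Fintype.sum_prod_type, Finset.sum_comm]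
    simp
  unfold graphInfo
  simp_rw [h1]
  rw [Finset.sum_add_distrib, Finset.sum_add_distrib, Finset.sum_add_distrib, h2, h2]
  simp
  ring

end EdgeConstants

/-! ### Weighted counting of competitors -/

noncomputable section Counting

open scoped Classical

/-- Sums of product weights over families that are not everywhere exact. -/
theorem sum_prod_le_of_exact {A Θ : Type*} [Fintype A] [DecidableEq A] [Fintype Θ]
    (w : A → Θ → ℝ) (hw : ∀ a u, 0 ≤ w a u) (Ex : A → Θ → Prop) {e b : ℝ} (he : 0 ≤ e)
    (hb0 : 0 ≤ b) (hb1 : b ≤ 1)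
    (h : ∀ a, (∑ u, (if Ex a u then w a u else 0) = 1 ∧
        ∑ u, (if Ex a u then 0 else w a u) ≤ e) ∨
      (∑ u, (if Ex a u then w a u else 0) = 0 ∧ ∑ u, (if Ex a u then 0 else w a u) ≤ b)) :
    ∑ u : A → Θ, ∏ a, w a (u a) ≤ Real.exp (Fintype.card A * e) ∧
    ∑ u : A → Θ, (if ∀ a, Ex a (u a) then 0 else ∏ a, w a (u a)) ≤
      b * Real.exp (Fintype.card A * e) + (Real.exp (Fintype.card A * e) - 1) := by
  set z : A → ℝ := fun a => ∑ u, (if Ex a u then w a u else 0) with hz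
  set y : A → ℝ := fun a => ∑ u, (if Ex a u then 0 else w a u) with hy
  have hzy : ∀ a, ∑ u, w a u = z a + y a := fun a => by
    rw [hz, hy, ← Finset.sum_add_distrib]
    exact Finset.sum_congr rfl fun u _ => by split_ifs <;> simp
  have hy0 : ∀ a, 0 ≤ y a := fun a => Finset.sum_nonneg fun u _ => by
    split_ifs <;> first | exact le_rfl | exact hw _ _
  -- The first alternative gives `1 + e`, the second at most `b ≤ 1`; both are below `exp e`.
  have hfac : ∀ a, z a + y a ≤ Real.exp e := fun a => by
    have := Real.add_one_le_exp e
    rcases h a with h | h <;> linarith [h.1, h.2]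
  have hfac0 : ∀ a, 0 ≤ z a + y a := fun a => by
    rw [← hzy]; exact Finset.sum_nonneg fun u _ => hw _ _
  have htot : ∑ u : A → Θ, ∏ a, w a (u a) = ∏ a, (z a + y a) := by
    rw [sum_prod_apply]; exact Finset.prod_congr rfl fun a _ => hzy a
  have hexp : ∏ _a : A, Real.exp e = Real.exp (Fintype.card A * e) := by
    rw [Finset.prod_const, ← Real.exp_nat_mul, Finset.card_univ]
  have hle : ∏ a, (z a + y a) ≤ Real.exp (Fintype.card A * e) := by
    rw [← hexp]
    exact Finset.prod_le_prod (fun a _ => hfac0 a) fun a _ => hfac a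
  have hge1 : 1 ≤ Real.exp (Fintype.card A * e) := Real.one_le_exp (by positivity)
  refine ⟨htot ▸ hle, ?_⟩
  have hsub : ∑ u : A → Θ, (if ∀ a, Ex a (u a) then 0 else ∏ a, w a (u a)) =
      ∏ a, (z a + y a) - ∏ a, z a := by
    rw [← htot, hz, ← sum_prod_apply (fun a u => if Ex a u then w a u else 0),
      ← Finset.sum_sub_distrib]
    refine Finset.sum_congr rfl fun u _ => ?_
    split_ifs with hu
    · rw [eq_comm, sub_eq_zero]
      exact Finset.prod_congr rfl fun a _ => (if_pos (hu a)).symm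
    · push Not at hu
      obtain ⟨a, ha⟩ := hu
      rw [Finset.prod_eq_zero (f := fun a => if Ex a (u a) then w a (u a) else 0)
        (Finset.mem_univ a) (if_neg ha), sub_zero]
  rw [hsub]
  -- If every coordinate has an exact value, only `exp - 1` remains. Otherwise no family is
  -- everywhere exact, and a coordinate without an exact value yields a factor `b`.
  by_cases hall : ∀ a, z a = 1
  · rw [Finset.prod_eq_one fun a _ => hall a]
    nlinarith [mul_nonneg hb0 (Real.exp_nonneg (Fintype.card A * e))]
  · push Not at hall
    obtain ⟨a₀, ha₀⟩ := hall
    have h0 : z a₀ = 0 ∧ y a₀ ≤ b := by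
      rcases h a₀ with h | h
      · exact absurd h.1 ha₀
      · exact h
    rw [Finset.prod_eq_zero (Finset.mem_univ a₀) h0.1, sub_zero,
      ← Finset.mul_prod_erase _ _ (Finset.mem_univ a₀), h0.1, zero_add]
    have h1 : ∏ a ∈ Finset.univ.erase a₀, (z a + y a) ≤ Real.exp (Fintype.card A * e) := by
      calc _ ≤ ∏ a ∈ Finset.univ.erase a₀, Real.exp e :=
            Finset.prod_le_prod (fun a _ => hfac0 a) fun a _ => hfac a
        _ ≤ ∏ a, Real.exp e := by
            refine Finset.prod_le_prod_of_subset_of_one_le (Finset.subset_univ _)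
              (fun a _ => (Real.exp_pos _).le) fun a _ _ => Real.one_le_exp he
        _ = _ := hexp
    have h2 : y a₀ * ∏ a ∈ Finset.univ.erase a₀, (z a + y a) ≤
        b * Real.exp (Fintype.card A * e) :=
      mul_le_mul h0.2 h1 (Finset.prod_nonneg fun a _ => hfac0 a) hb0
    linarith

variable {q c g r n m : ℕ}

/-- A ground truth as a family of columns of the basis matrices and a labelling of the users. -/
def instanceEquiv (q c g r n m : ℕ) :
    Instance q c g r n m ≃ (Fin c × Fin m → Fin r → ZMod q) × (Fin n → Fin c × Fin g) where
  toFun X := (fun xj i => X.basis xj.1 i xj.2, X.part)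
  invFun u := ⟨fun x => Matrix.of fun i j => u.1 (x, j) i, u.2⟩
  left_inv _ := rfl
  right_inv _ := rfl

theorem vec_apply (P : Model q c g r) (X : Instance q c g r n m) (s : Fin c × Fin g) (j : Fin m) :
    X.vec P s.1 s.2 j = (P.code s.1 *ᵥ ((instanceEquiv q c g r n m X).1 (s.1, j))) s.2 := rfl

/-- Distances of rating vectors, column by column. -/
theorem sum_hammingDist_vec_eq (P : Model q c g r) (v : Fin c × Fin g → Fin m → ZMod q)
    (X : Instance q c g r n m) (π : Equiv.Perm (Fin c × Fin g)) :
    ∑ s, (hammingDist (v s) (X.vec P (π s).1 (π s).2) : ℝ) =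
      ∑ xj : Fin c × Fin m, (hammingDist (fun i => v (π.symm (xj.1, i)) xj.2)
        (P.code xj.1 *ᵥ ((instanceEquiv q c g r n m X).1 xj)) : ℝ) := by
  have hd : ∀ {k : ℕ} (a b : Fin k → ZMod q),
      (hammingDist a b : ℝ) = ∑ j, if a j ≠ b j then 1 else 0 := fun a b => by
    rw [hammingDist, Finset.card_filter]; push_cast; rfl
  rw [← Equiv.sum_comp π.symm]
  simp_rw [Equiv.apply_symm_apply, hd, vec_apply]
  rw [Fintype.sum_prod_type, Fintype.sum_prod_type]
  exact Finset.sum_congr rfl fun x _ => Finset.sum_comm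

variable [Fact q.Prime]

theorem IsMDS.mulVec_injective {Φ : Matrix (Fin g) (Fin r) (ZMod q)} (hΦ : IsMDS Φ) :
    Function.Injective (Φ *ᵥ ·) := by
  intro b b' h
  by_contra hne
  have h1 := hΦ.2 (b - b') (sub_ne_zero.2 hne)
  have h2 : Φ *ᵥ (b - b') = 0 := by rw [Matrix.mulVec_sub]; exact sub_eq_zero.2 h
  rw [h2, hammingNorm_zero] at h1
  have := hΦ.1
  omega

theorem IsMDS.le_hammingDist {Φ : Matrix (Fin g) (Fin r) (ZMod q)} (hΦ : IsMDS Φ)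
    {b b' : Fin r → ZMod q} (h : b ≠ b') :
    (g : ℝ) - r + 1 ≤ hammingDist (Φ *ᵥ b) (Φ *ᵥ b') := by
  have h1 := hΦ.2 (-b + b') fun h0 => h (neg_add_eq_zero.1 h0)
  rw [Matrix.mulVec_add, Matrix.mulVec_neg, ← hammingDist_eq_hammingNorm] at h1
  have : ((g + 1 : ℕ) : ℝ) ≤ (r + hammingDist (Φ *ᵥ b) (Φ *ᵥ b') : ℕ) := by exact_mod_cast h1
  push_cast at this
  linarith

/-- The total weight of the columns of a basis matrix, as competitors of a given column of
ratings. -/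
theorem sum_exp_hammingDist_mulVec {Φ : Matrix (Fin g) (Fin r) (ZMod q)} (hΦ : IsMDS Φ)
    (v : Fin g → ZMod q) {y : ℝ} (hy : 0 ≤ y) :
    (∑ b, (if Φ *ᵥ b = v then Real.exp (-(y * hammingDist v (Φ *ᵥ b))) else 0) = 1 ∧
      ∑ b, (if Φ *ᵥ b = v then 0 else Real.exp (-(y * hammingDist v (Φ *ᵥ b)))) ≤
        (q : ℝ) ^ r * Real.exp (-(y * ((g : ℝ) - r + 1)))) ∨
    (∑ b, (if Φ *ᵥ b = v then Real.exp (-(y * hammingDist v (Φ *ᵥ b))) else 0) = 0 ∧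
      ∑ b, (if Φ *ᵥ b = v then 0 else Real.exp (-(y * hammingDist v (Φ *ᵥ b)))) ≤
        (q : ℝ) ^ r * Real.exp (-y)) := by
  have hcard : ∀ x : ℝ, ∑ _b : Fin r → ZMod q, x = (q : ℝ) ^ r * x := fun x => by
    simp [ZMod.card]
  -- A relabelling of the groups need not respect the codes, so `v` may fail to be a codeword. Then
  -- only distance at least 1 is available instead of the MDS distance, but there is no competitor
  -- of weight one either.
  by_cases h : ∃ b₀, Φ *ᵥ b₀ = v
  · obtain ⟨b₀, rfl⟩ := h
    left
    constructor
    · rw [Finset.sum_eq_single b₀]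
      · simp
      · intro b _ hb
        rw [if_neg]
        exact fun h => hb (hΦ.mulVec_injective h)
      · simp
    · rw [← hcard]
      refine Finset.sum_le_sum fun b _ => ?_
      split_ifs with hb
      · positivity
      · refine Real.exp_le_exp.2 (neg_le_neg (mul_le_mul_of_nonneg_left ?_ hy))
        exact hΦ.le_hammingDist fun h => hb (by rw [h])
  · push Not at h
    right
    constructor
    · exact Finset.sum_eq_zero fun b _ => if_neg (h b)
    · rw [← hcard]
      refine Finset.sum_le_sum fun b _ => ?_
      rw [if_neg (h b)]
      refine Real.exp_le_exp.2 (neg_le_neg (le_mul_of_one_le_right hy ?_))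
      have := hammingDist_pos.2 (h b).symm
      exact_mod_cast this

theorem card_instance :
    (Fintype.card (Instance q c g r n m) : ℝ) = ((q : ℝ) ^ r) ^ (c * m) * ((c * g : ℕ) : ℝ) ^ n := by
  rw [Fintype.card_congr (instanceEquiv q c g r n m)]
  simp [ZMod.card]

end Counting

/-! ### The exponent of a competitor and the sum over all competitors -/

noncomputable section UnionBound

open scoped Classical

variable {q c g r n m : ℕ}

theorem sum_sum_eq_two_mul_Ioi (φ : Fin n → Fin n → ℝ) (h : ∀ a b, φ a b = φ b a)
    (h0 : ∀ a, φ a a = 0) : ∑ a, ∑ b, φ a b = 2 * ∑ a, ∑ b ∈ Finset.Ioi a, φ a b := by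
  have h1 : ∀ a, ∑ b ∈ Finset.Ioi a, φ a b = ∑ b, if a < b then φ a b else 0 := fun a => by
    rw [← Finset.sum_filter]
    exact Finset.sum_congr (by ext; simp) fun _ _ => rfl
  simp_rw [h1]
  have h2 : ∑ a, ∑ b, (if b < a then φ a b else 0) = ∑ a, ∑ b, (if a < b then φ a b else 0) := by
    rw [Finset.sum_comm]
    exact Finset.sum_congr rfl fun a _ => Finset.sum_congr rfl fun b _ => by rw [h a b]
  rw [two_mul]
  nth_rewrite 1 [← h2]
  simp_rw [← Finset.sum_add_distrib]
  refine Finset.sum_congr rfl fun a _ => Finset.sum_congr rfl fun b _ => ?_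
  rcases lt_trichotomy a b with hab | hab | hab
  · simp [hab, hab.not_gt]
  · subst hab; simp [h0]
  · simp [hab, hab.not_gt]

/-- The exponent of the union bound. -/
def exponent (P : Model q c g r) (p : ℝ) (M X : Instance q c g r n m) : ℝ :=
  p * entryInfo q P.θ * ∑ a, (hammingDist (M.mat P a) (X.mat P a) : ℝ) +
    Real.log n / n / 4 * ∑ a, ∑ b, (√(edgeConst P (M.part a) (M.part b)) -
      √(edgeConst P (X.part a) (X.part b))) ^ 2

/-- The rating vector of a (cluster, group) pair. -/
def Instance.row (P : Model q c g r) (M : Instance q c g r n m) (s : Fin c × Fin g) :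
    Fin m → ZMod q := M.vec P s.1 s.2

/-- If `π` preserves the edge constants, each user whose label is not the relabelled true one costs
`ρ`, in ratings and edges together, and wrong vectors cost extra. If not, the graph alone
contributes `R`. The minimum covers both cases. -/
theorem exponent_ge_of_isAligned (P : Model q c g r) {p : ℝ} (hp : p ∈ Set.Icc (0 : ℝ) 1)
    {M X : Instance q c g r n m} {N : ℕ}
    (hX : ∀ s, (Finset.univ.filter fun a => X.part a = s).card = N) {η : ℝ} (hη1 : η ≤ 1)
    {π : Equiv.Perm (Fin c × Fin g)} (hπ : IsAligned N η M.part X.part π) {ρ R : ℝ}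
    (huser : ∀ s t, s ≠ t → ρ ≤ p * entryInfo q P.θ * hammingDist (M.row P s) (M.row P t) +
      (1 - η) * N * (Real.log n / n) * graphInfo P s t)
    (hcross : P.β ≠ P.γ → R ≤ Real.log n / n / 4 * (((1 - η) * N) ^ 2 * (√P.β - √P.γ) ^ 2)) :
    min (∑ a, (if X.part a = π (M.part a) then 0 else ρ)) R +
      p * entryInfo q P.θ * (1 - 2 * η) * N *
        ∑ s, (hammingDist (M.row P s) (X.row P (π s)) : ℝ) ≤ exponent P p M X := by
  have hL0 : 0 ≤ Real.log n / n := div_nonneg (Real.log_natCast_nonneg n) n.cast_nonneg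
  have hx0 : 0 ≤ p * entryInfo q P.θ := mul_nonneg hp.1 (sq_nonneg _)
  have h1 := mul_le_mul_of_nonneg_left
    (hammingDist_ge_of_isAligned hX (M.row P) (X.row P) hπ) hx0
  have hD : (∑ a, (hammingDist (M.mat P a) (X.mat P a) : ℝ)) =
    ∑ a, (hammingDist (M.row P (M.part a)) (X.row P (X.part a)) : ℝ) := rfl
  unfold exponent
  rw [hD]
  set G := ∑ a, ∑ b, (√(edgeConst P (M.part a) (M.part b)) -
      √(edgeConst P (X.part a) (X.part b))) ^ 2
  by_cases hinv : ∀ s t, √(edgeConst P (π s) (π t)) = √(edgeConst P s t)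
  · have h2 := sum_sum_sq_ge_of_isAligned hπ (R := fun s t => √(edgeConst P s t))
      (fun s t => by rw [edgeConst_comm]) hinv
    have h3 := mul_le_mul_of_nonneg_left h2 (div_nonneg hL0 zero_le_four)
    have h4 : ∑ a, (if X.part a = π (M.part a) then 0 else ρ) ≤
        ∑ a, (p * entryInfo q P.θ *
          hammingDist (M.row P (M.part a)) (M.row P (π.symm (X.part a))) +
          (1 - η) * N * (Real.log n / n) * graphInfo P (M.part a) (π.symm (X.part a))) := by
      refine Finset.sum_le_sum fun a _ => ?_
      split_ifs with h
      · have : 0 ≤ 1 - η := by linarith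
        have := graphInfo_nonneg P (M.part a) (π.symm (X.part a))
        positivity
      · exact huser _ _ fun h' => h (by rw [h']; simp)
    have h5 : ∑ a, (p * entryInfo q P.θ *
          hammingDist (M.row P (M.part a)) (M.row P (π.symm (X.part a))) +
          (1 - η) * N * (Real.log n / n) * graphInfo P (M.part a) (π.symm (X.part a))) =
        p * entryInfo q P.θ *
          ∑ a, (hammingDist (M.row P (M.part a)) (M.row P (π.symm (X.part a))) : ℝ) +
        Real.log n / n / 4 * (2 * ((1 - η) * N) * ∑ a, ∑ u, (√(edgeConst P (M.part a) u) -
          √(edgeConst P (π.symm (X.part a)) u)) ^ 2) := by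
      rw [Finset.sum_add_distrib, ← Finset.mul_sum, ← Finset.mul_sum]
      unfold graphInfo
      rw [← Finset.sum_div]
      ring
    have h6 := min_le_left (∑ a, (if X.part a = π (M.part a) then 0 else ρ)) R
    linarith
  · push Not at hinv
    obtain ⟨s, t, hst⟩ := hinv
    have h2 := sum_sum_sq_ge_of_ne hη1 hπ (fun s t => √(edgeConst P s t)) s t
    -- A permutation keeps equal labels equal and distinct ones distinct, so a violation can only
    -- exchange `β` and `γ`.
    have h3 : P.β ≠ P.γ ∧ (√(edgeConst P s t) - √(edgeConst P (π s) (π t))) ^ 2 =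
        (√P.β - √P.γ) ^ 2 := by
      by_cases hs : s = t
      · subst hs; simp [edgeConst] at hst
      · simp only [edgeConst, hs, EmbeddingLike.apply_eq_iff_eq, if_false] at hst ⊢
        split_ifs at hst ⊢
        · exact absurd rfl hst
        · exact ⟨fun h => hst (by rw [h]), by ring⟩
        · exact ⟨fun h => hst (by rw [h]), by ring⟩
        · exact absurd rfl hst
    have h4 := hcross h3.1
    rw [h3.2] at h2
    have h5 := mul_le_mul_of_nonneg_left h2 (div_nonneg hL0 zero_le_four)
    have h6 := min_le_right (∑ a, (if X.part a = π (M.part a) then 0 else ρ)) R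
    have h7 : 0 ≤ p * entryInfo q P.θ *
        ∑ a, (hammingDist (M.row P (M.part a)) (M.row P (π.symm (X.part a))) : ℝ) :=
      mul_nonneg hx0 (Finset.sum_nonneg fun a _ => Nat.cast_nonneg _)
    linarith

variable [Fact q.Prime]

/-- The coefficients are multiplied with `1 - x ≤ exp (-x)`. Ordered pairs count each pair of users
twice, hence `1 / 4` in `exponent` instead of `1 / 2`. -/
theorem prod_sum_sqrt_law_le (P : Model q c g r) (hγ : 0 ≤ P.γ) (hγβ : P.γ ≤ P.β)
    (hβα : P.β ≤ P.α) {p : ℝ} (hp : p ∈ Set.Icc (0 : ℝ) 1) (hθ : P.θ ∈ Set.Icc (0 : ℝ) 1)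
    (hL : P.α * (Real.log n / n) ≤ 1) (M X : Instance q c g r n m) :
    ∏ i, ∑ k, √(law P p M i k * law P p X i k) ≤ Real.exp (-exponent P p M X) := by
  have hL0 : 0 ≤ Real.log n / n := div_nonneg (Real.log_natCast_nonneg n) n.cast_nonneg
  have hpm := fun X : Instance q c g r n m => pairProb_mem P (by linarith) (by linarith) hγ X.part
  have hQ0 : ∀ s t, 0 ≤ edgeConst P s t := fun s t => by
    unfold edgeConst; split_ifs <;> linarith
  set φ : Fin n → Fin n → ℝ := fun a b => (√(edgeConst P (M.part a) (M.part b)) -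
      √(edgeConst P (X.part a) (X.part b))) ^ 2 with hφ
  rw [Fintype.prod_sum_type]
  have h1 : ∏ i : Fin n × Fin m, ∑ k, √(law P p M (.inl i) k * law P p X (.inl i) k) ≤
      Real.exp (-(p * entryInfo q P.θ *
        ∑ a, (hammingDist (M.mat P a) (X.mat P a) : ℝ))) := by
    have h2 : (∑ a, (hammingDist (M.mat P a) (X.mat P a) : ℝ)) =
        ∑ i : Fin n × Fin m, if M.mat P i.1 i.2 ≠ X.mat P i.1 i.2 then (1 : ℝ) else 0 := by
      rw [Fintype.sum_prod_type]
      refine Finset.sum_congr rfl fun a _ => ?_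
      rw [hammingDist, Finset.card_filter]; push_cast; rfl
    rw [h2, Finset.mul_sum, ← Finset.sum_neg_distrib, Real.exp_sum]
    refine Finset.prod_le_prod (fun i _ => Finset.sum_nonneg fun k _ => Real.sqrt_nonneg _)
      fun i _ => ?_
    simp only [law]
    by_cases h : M.mat P i.1 i.2 = X.mat P i.1 i.2
    · rw [h, sum_sqrt_entryProb_self hp hθ]
      simp
    · rw [sum_sqrt_entryProb hp hθ h]
      simp only [ne_eq, h, not_false_eq_true, if_true, mul_one]
      linarith [Real.add_one_le_exp (-(p * entryInfo q P.θ))]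
  have h3 : ∏ e : Sym2 (Fin n), ∑ k, √(law P p M (.inr e) k * law P p X (.inr e) k) ≤
      Real.exp (-(Real.log n / n / 4 * ∑ a, ∑ b, φ a b)) := by
    let f : Sym2 (Fin n) → ℝ := fun e =>
      Real.exp (-((√(pairProb P M.part e) - √(pairProb P X.part e)) ^ 2 / 2))
    calc _ ≤ ∏ e : Sym2 (Fin n), (if e.IsDiag then 1 else f e) := by
          refine Finset.prod_le_prod (fun i _ => Finset.sum_nonneg fun k _ => Real.sqrt_nonneg _)
            fun e _ => ?_
          simp only [law]
          refine (sum_sqrt_edgeLaw_le (hpm M e) (hpm X e)).trans ?_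
          split_ifs
          · linarith [sq_nonneg (√(pairProb P M.part e) - √(pairProb P X.part e))]
          · linarith [Real.add_one_le_exp
              (-((√(pairProb P M.part e) - √(pairProb P X.part e)) ^ 2 / 2))]
      _ = _ := by
          rw [prod_sym2_eq, sum_sum_eq_two_mul_Ioi φ
            (fun a b => by simp only [hφ, edgeConst_comm P (M.part a), edgeConst_comm P (X.part a)])
            (fun a => by simp [hφ, edgeConst])]
          rw [← mul_assoc, Finset.mul_sum, ← Finset.sum_neg_distrib, Real.exp_sum]
          refine Finset.prod_congr rfl fun a _ => ?_
          rw [Finset.mul_sum, ← Finset.sum_neg_distrib, Real.exp_sum]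
          refine Finset.prod_congr rfl fun b _ => ?_
          refine congrArg Real.exp ?_
          simp only [pairProb, Sym2.lift_mk, edgeProb_eq_of_le P hγβ hβα hL, hφ]
          rw [Real.sqrt_mul (hQ0 _ _), Real.sqrt_mul (hQ0 _ _), ← sub_mul, mul_pow,
            Real.sq_sqrt hL0]
          ring
  refine (mul_le_mul h1 h3 (Finset.prod_nonneg fun i _ => Finset.sum_nonneg fun k _ =>
    Real.sqrt_nonneg _) (Real.exp_nonneg _)).trans (le_of_eq ?_)
  rw [← Real.exp_add, exponent, neg_add]

/-- The total weight of the competitors close to a fixed relabelling of the ground truth. -/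
theorem sum_aligned_le (P : Model q c g r) (hcode : ∀ x, IsMDS (P.code x))
    (M : Instance q c g r n m) (π : Equiv.Perm (Fin c × Fin g)) {y ρ R b e₂ : ℝ} (hy : 0 ≤ y)
    (hb1 : b ≤ 1) (hb : (q : ℝ) ^ r * Real.exp (-y) ≤ b)
    (he₂ : (q : ℝ) ^ r * Real.exp (-(y * ((g : ℝ) - r + 1))) ≤ e₂) :
    ∑ X : Instance q c g r n m, (if X.mat P ≠ M.mat P then
      Real.exp (-(min (∑ a, (if X.part a = π (M.part a) then 0 else ρ)) R +
        y * ∑ s, (hammingDist (M.row P s) (X.row P (π s)) : ℝ))) else 0) ≤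
    (Real.exp (n * ((c * g : ℕ) * Real.exp (-ρ))) - 1) * Real.exp ((c * m : ℕ) * e₂) +
    Real.exp (n * ((c * g : ℕ) * Real.exp (-ρ))) *
      (b * Real.exp ((c * m : ℕ) * e₂) + (Real.exp ((c * m : ℕ) * e₂) - 1)) +
    ((c * g : ℕ) : ℝ) ^ n * Real.exp (-R) * Real.exp ((c * m : ℕ) * e₂) := by
  set w : Fin c × Fin m → (Fin r → ZMod q) → ℝ := fun xj b =>
    Real.exp (-(y * hammingDist (fun i => M.row P (π.symm (xj.1, i)) xj.2)
      (P.code xj.1 *ᵥ b))) with hw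
  set Ex : Fin c × Fin m → (Fin r → ZMod q) → Prop := fun xj b =>
    P.code xj.1 *ᵥ b = fun i => M.row P (π.symm (xj.1, i)) xj.2 with hEx
  set w' : Fin n → Fin c × Fin g → ℝ := fun a t => if t = π (M.part a) then 1 else Real.exp (-ρ)
    with hw'
  have hw0 : ∀ xj b, 0 ≤ w xj b := fun _ _ => Real.exp_nonneg _
  have hw0' : ∀ a t, 0 ≤ w' a t := fun a t => by
    simp only [hw']; split_ifs <;> positivity
  have hb0 : 0 ≤ b := le_trans (by positivity) hb
  have he0 : 0 ≤ e₂ := le_trans (by positivity) he₂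
  obtain ⟨hB1, hB2⟩ := sum_prod_le_of_exact w hw0 Ex he0 hb0 hb1 fun xj => by
    rcases sum_exp_hammingDist_mulVec (hcode xj.1)
      (fun i => M.row P (π.symm (xj.1, i)) xj.2) hy with h | h
    · exact Or.inl ⟨by convert h.1, (le_of_eq (Finset.sum_congr rfl fun b _ => by
        simp only [hEx]; congr)).trans (h.2.trans he₂)⟩
    · exact Or.inr ⟨by convert h.1, (le_of_eq (Finset.sum_congr rfl fun b _ => by
        simp only [hEx]; congr)).trans (h.2.trans hb)⟩
  obtain ⟨hA1, hA2⟩ := sum_prod_le_of_exact w' hw0' (fun a t => t = π (M.part a))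
    (e := (c * g : ℕ) * Real.exp (-ρ)) (by positivity) le_rfl zero_le_one fun a => by
      left
      constructor
      · rw [Finset.sum_eq_single (π (M.part a))]
        · simp [hw']
        · intro t _ ht; rw [if_neg ht]
        · simp
      · have : ((c * g : ℕ) : ℝ) * Real.exp (-ρ) = ∑ _t : Fin c × Fin g, Real.exp (-ρ) := by
          simp
        rw [this]
        refine Finset.sum_le_sum fun t _ => ?_
        simp only [hw']
        split_ifs <;> first | exact le_rfl | positivity
  simp only [Fintype.card_prod, Fintype.card_fin] at hB1 hB2 hA1 hA2
  set E₁ := Real.exp (n * ((c * g : ℕ) * Real.exp (-ρ)))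
  set E₂ := Real.exp ((c * m : ℕ) * e₂)
  rw [zero_mul, zero_add] at hA2
  set B : (Fin c × Fin m → Fin r → ZMod q) → ℝ := fun u => ∏ xj, w xj (u xj) with hBdef
  set B' : (Fin c × Fin m → Fin r → ZMod q) → ℝ :=
    fun u => if ∀ xj, Ex xj (u xj) then 0 else ∏ xj, w xj (u xj) with hBdef'
  set A : (Fin n → Fin c × Fin g) → ℝ := fun σ => ∏ a, w' a (σ a) with hAdef
  set A' : (Fin n → Fin c × Fin g) → ℝ :=
    fun σ => if ∀ a, σ a = π (M.part a) then 0 else ∏ a, w' a (σ a) with hAdef'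
  have hBn : ∀ u, 0 ≤ B u := fun u => Finset.prod_nonneg fun _ _ => hw0 _ _
  have hBn' : ∀ u, 0 ≤ B' u := fun u => by
    simp only [hBdef']; split_ifs
    · exact le_rfl
    · exact hBn u
  have hAn : ∀ u, 0 ≤ A u := fun u => Finset.prod_nonneg fun _ _ => hw0' _ _
  have hAn' : ∀ u, 0 ≤ A' u := fun u => by
    simp only [hAdef']; split_ifs
    · exact le_rfl
    · exact hAn u
  -- Exact labels together with exact columns would reproduce the matrix of `M`. So either the
  -- labelling is not exact (`A'`) or some column is not (`B'`); the last term covers the case that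
  -- the minimum is `R`.
  have hpt : ∀ X : Instance q c g r n m, (if X.mat P ≠ M.mat P then
      Real.exp (-(min (∑ a, (if X.part a = π (M.part a) then 0 else ρ)) R +
        y * ∑ s, (hammingDist (M.row P s) (X.row P (π s)) : ℝ))) else 0) ≤
      A' X.part * B (instanceEquiv q c g r n m X).1 + A X.part * B' (instanceEquiv q c g r n m X).1
        + Real.exp (-R) * B (instanceEquiv q c g r n m X).1 := by
    intro X
    set u := (instanceEquiv q c g r n m X).1 with hu
    have n1 := mul_nonneg (hAn' X.part) (hBn u)
    have n2 := mul_nonneg (hAn X.part) (hBn' u)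
    have n3 := mul_nonneg (Real.exp_nonneg (-R)) (hBn u)
    split_ifs with hmat
    · have hBu : B u = Real.exp
          (-(y * ∑ s, (hammingDist (M.row P s) (X.row P (π s)) : ℝ))) := by
        have := sum_hammingDist_vec_eq P (M.row P) X π
        unfold Instance.row at this ⊢
        rw [this, Finset.mul_sum, ← Finset.sum_neg_distrib, Real.exp_sum]
        rfl
      have hAu : A X.part = Real.exp (-∑ a, (if X.part a = π (M.part a) then 0 else ρ)) := by
        rw [← Finset.sum_neg_distrib, Real.exp_sum]
        refine Finset.prod_congr rfl fun a _ => ?_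
        simp only [hw']
        split_ifs <;> simp
      rw [neg_add, Real.exp_add, ← hBu]
      rcases min_choice (∑ a, (if X.part a = π (M.part a) then 0 else ρ)) R with h | h
      · rw [h, ← hAu]
        by_cases hσ : ∀ a, X.part a = π (M.part a)
        · have hnu : ¬ ∀ xj, Ex xj (u xj) := by
            intro hall
            refine hmat ?_
            funext a j
            have h1 := congrFun (hall ((X.part a).1, j)) (X.part a).2
            simp only [hσ a, Prod.mk.eta, Equiv.symm_apply_apply] at h1
            have h2 : X.mat P a j = X.vec P (X.part a).1 (X.part a).2 j := rfl
            rw [h2, vec_apply, hσ a, ← hu, h1]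
            rfl
          have : B' u = B u := if_neg hnu
          rw [this]
          rw [this] at n2
          linarith
        · have : A' X.part = A X.part := if_neg hσ
          rw [this]
          linarith
      · rw [h]
        linarith
    · linarith
  refine (Finset.sum_le_sum fun X _ => hpt X).trans ?_
  refine (le_of_eq (Equiv.sum_comp (instanceEquiv q c g r n m) (fun v => A' v.2 * B v.1 +
    A v.2 * B' v.1 + Real.exp (-R) * B v.1))).trans ?_
  rw [Finset.sum_add_distrib, Finset.sum_add_distrib]
  have hfac : ∀ (F : (Fin n → Fin c × Fin g) → ℝ) (G : (Fin c × Fin m → Fin r → ZMod q) → ℝ),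
      ∑ v : (Fin c × Fin m → Fin r → ZMod q) × (Fin n → Fin c × Fin g), F v.2 * G v.1 =
        (∑ σ, F σ) * ∑ u, G u := by
    intro F G
    rw [Fintype.sum_prod_type, Finset.sum_mul_sum, Finset.sum_comm]
  have h3 := hfac (fun _ => Real.exp (-R)) B
  simp only [Finset.sum_const, Finset.card_univ, Fintype.card_pi, Fintype.card_prod,
    Fintype.card_fin, Finset.prod_const, nsmul_eq_mul] at h3
  rw [hfac A' B, hfac A B', h3]
  have sB0 : 0 ≤ ∑ u, B u := Finset.sum_nonneg fun u _ => hBn u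
  have sB0' : 0 ≤ ∑ u, B' u := Finset.sum_nonneg fun u _ => hBn' u
  have sA0 : 0 ≤ ∑ u, A u := Finset.sum_nonneg fun u _ => hAn u
  have sA0' : 0 ≤ ∑ u, A' u := Finset.sum_nonneg fun u _ => hAn' u
  have hA2' : ∑ σ, A' σ ≤ E₁ - 1 := (le_of_eq (Finset.sum_congr rfl fun σ _ => by
    simp only [hAdef']; congr)).trans hA2
  have hB2' : ∑ u, B' u ≤ b * E₂ + (E₂ - 1) := (le_of_eq (Finset.sum_congr rfl fun u _ => by
    simp only [hBdef']; congr)).trans hB2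
  refine add_le_add (add_le_add (mul_le_mul hA2' hB1 sB0 (sA0'.trans hA2'))
    (mul_le_mul hA1 hB2' sB0' (sA0.trans hA1))) ?_
  push_cast
  exact mul_le_mul_of_nonneg_left hB1 (by positivity)

/-- The error probability of maximum likelihood, in terms of lower bounds for the exponents. -/
theorem errorProb_le_of_exponents (P : Model q c g r) (hcode : ∀ x, IsMDS (P.code x))
    (hγ : 0 ≤ P.γ) (hγβ : P.γ ≤ P.β)
    (hβα : P.β ≤ P.α) {p : ℝ} (hp : p ∈ Set.Icc (0 : ℝ) 1) (hθ : P.θ ∈ Set.Icc (0 : ℝ) 1)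
    (hL : P.α * (Real.log n / n) ≤ 1) {δg δc : ℝ} {ψ : Estimator q n m}
    (hψ : IsMaxLikelihood P p δg δc ψ) {M : Instance q c g r n m} (hM : M ∈ matSet P n m δg δc)
    {N : ℕ} (hN : ∀ X ∈ matSet P n m δg δc, ∀ s,
      (Finset.univ.filter fun a => X.part a = s).card = N)
    {η ρ R R₂ b e₂ : ℝ} (hη1 : η ≤ 1 / 2)
    (hfar : ∀ X ∈ matSet P n m δg δc, (¬ ∃ π, IsAligned N η M.part X.part π) →
      R ≤ exponent P p M X)
    (huser : ∀ s t, s ≠ t → ρ ≤ p * entryInfo q P.θ * hammingDist (M.row P s) (M.row P t) +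
      (1 - η) * N * (Real.log n / n) * graphInfo P s t)
    (hcross : P.β ≠ P.γ → R₂ ≤ Real.log n / n / 4 * (((1 - η) * N) ^ 2 * (√P.β - √P.γ) ^ 2))
    (hb1 : b ≤ 1)
    (hb : (q : ℝ) ^ r * Real.exp (-(p * entryInfo q P.θ * (1 - 2 * η) * N)) ≤ b)
    (he₂ : (q : ℝ) ^ r *
      Real.exp (-(p * entryInfo q P.θ * (1 - 2 * η) * N * ((g : ℝ) - r + 1))) ≤ e₂) :
    errorProb P p ψ M ≤
      ((q : ℝ) ^ r) ^ (c * m) * ((c * g : ℕ) : ℝ) ^ n * Real.exp (-R) +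
      (Fintype.card (Equiv.Perm (Fin c × Fin g)) : ℝ) *
      ((Real.exp (n * ((c * g : ℕ) * Real.exp (-ρ))) - 1) * Real.exp ((c * m : ℕ) * e₂) +
      Real.exp (n * ((c * g : ℕ) * Real.exp (-ρ))) *
        (b * Real.exp ((c * m : ℕ) * e₂) + (Real.exp ((c * m : ℕ) * e₂) - 1)) +
      ((c * g : ℕ) : ℝ) ^ n * Real.exp (-R₂) * Real.exp ((c * m : ℕ) * e₂)) := by
  refine (errorProb_le_sum P (by linarith) (by linarith) hγ hp hθ hψ hM).trans ?_
  set y := p * entryInfo q P.θ * (1 - 2 * η) * N with hydef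
  have hy : 0 ≤ y := mul_nonneg (mul_nonneg (mul_nonneg hp.1 (sq_nonneg _)) (by linarith))
    N.cast_nonneg
  let T : Equiv.Perm (Fin c × Fin g) → Instance q c g r n m → ℝ := fun π X =>
    if X.mat P ≠ M.mat P then
      Real.exp (-(min (∑ a, (if X.part a = π (M.part a) then 0 else ρ)) R₂ +
        y * ∑ s, (hammingDist (M.row P s) (X.row P (π s)) : ℝ))) else 0
  have hT0 : ∀ π X, 0 ≤ T π X := fun π X => by
    simp only [T]; split_ifs <;> positivity
  -- A far competitor is charged to `exp (-R)`, an aligned one to any one of its relabellings.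
  calc _ ≤ ∑ X : Instance q c g r n m, (Real.exp (-R) + ∑ π, T π X) := by
        refine Finset.sum_le_sum fun X _ => ?_
        have hs : 0 ≤ ∑ π, T π X := Finset.sum_nonneg fun π _ => hT0 π X
        by_cases h : X ∈ matSet P n m δg δc ∧ X.mat P ≠ M.mat P
        · rw [if_pos h]
          refine (prod_sum_sqrt_law_le P hγ hγβ hβα hp hθ hL M X).trans ?_
          by_cases hal : ∃ π, IsAligned N η M.part X.part π
          · obtain ⟨π, hπ⟩ := hal
            have h1 := exponent_ge_of_isAligned P hp (hN X h.1) (by linarith) hπ huser hcross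
            have h2 : Real.exp (-exponent P p M X) ≤ T π X := by
              simp only [T]
              rw [if_pos h.2]
              exact Real.exp_le_exp.2 (neg_le_neg h1)
            have h3 := Finset.single_le_sum (fun π _ => hT0 π X) (Finset.mem_univ π)
            linarith [Real.exp_pos (-R)]
          · have h1 := Real.exp_le_exp.2 (neg_le_neg (hfar X h.1 hal))
            linarith
        · rw [if_neg h]
          positivity
    _ = (Fintype.card (Instance q c g r n m) : ℝ) * Real.exp (-R) +
          ∑ π, ∑ X : Instance q c g r n m, T π X := by
        rw [Finset.sum_add_distrib, Finset.sum_comm (γ := Instance q c g r n m)]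
        simp
    _ ≤ _ := by
        rw [card_instance]
        refine add_le_add le_rfl ?_
        refine (Finset.sum_le_sum fun π _ =>
          sum_aligned_le P hcode M π (ρ := ρ) (R := R₂) hy hb1 hb he₂).trans ?_
        rw [Finset.sum_const, nsmul_eq_mul, Finset.card_univ]

end UnionBound

/-! ### Explicit error bounds above the threshold -/

noncomputable section Achievability

open scoped Classical

variable {q c g r n m : ℕ}

theorem hammingDist_row_ge_intra {P : Model q c g r} {M : Instance q c g r n m} {δ : ℝ}
    (hδ : δ ∈ lowerBounds (M.intraDistances P)) (hm : 0 < m) {s t : Fin c × Fin g} (hst : s ≠ t)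
    (h : s.1 = t.1) : δ * m ≤ hammingDist (M.row P s) (M.row P t) := by
  have hm' : (0 : ℝ) < m := by exact_mod_cast hm
  have h1 := hδ ⟨s.1, s.2, t.2, fun h' => hst (Prod.ext h h'), rfl⟩
  rw [le_div_iff₀ hm'] at h1
  unfold Instance.row
  rwa [← h]

theorem hammingDist_row_ge_inter {P : Model q c g r} {M : Instance q c g r n m} {δ : ℝ}
    (hδ : δ ∈ lowerBounds (M.interDistances P)) (hm : 0 < m) {s t : Fin c × Fin g}
    (h : s.1 ≠ t.1) : δ * m ≤ hammingDist (M.row P s) (M.row P t) := by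
  have hm' : (0 : ℝ) < m := by exact_mod_cast hm
  have h1 := hδ ⟨s.1, t.1, s.2, t.2, h, rfl⟩
  rwa [le_div_iff₀ hm'] at h1

theorem card_group_eq {M : Instance q c g r n m} (hM : M.WellFormed) (hcg : 0 < c * g)
    (s : Fin c × Fin g) :
    (Finset.univ.filter fun a => M.part a = s).card = n / (c * g) := by
  have h := hM.2 s.1 s.2
  rw [Prod.mk.eta] at h
  exact (Nat.div_eq_of_eq_mul_right hcg (h.symm.trans (by congr!))).symm

theorem mul_div_card_eq {M : Instance q c g r n m} (hM : M.WellFormed) (hcg : 0 < c * g) :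
    ((c * g : ℕ) : ℝ) * (n / (c * g) : ℕ) = n := by
  have h0 : 0 < c := Nat.pos_of_mul_pos_right hcg
  have h1 : 0 < g := Nat.pos_of_mul_pos_left hcg
  have h := hM.2 ⟨0, h0⟩ ⟨0, h1⟩
  have h2 : c * g ∣ n := ⟨_, h.symm⟩
  exact_mod_cast Nat.mul_div_cancel' h2

/-- The three conditions on the observation probability, with margin `s`. -/
theorem threshold_le_iff [Fact q.Prime] (P : Model q c g r) (hθ0 : 0 ≤ P.θ)
    (hθ1 : P.θ < ((q : ℝ) - 1) / q) {δg δc s p : ℝ} :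
    threshold P n m δg δc s ≤ p ↔
      (g : ℝ) * c * s / ((g : ℝ) - r + 1) * (Real.log m / n) ≤ p * entryInfo q P.θ ∧
      Real.log n / (δg * m) * (s - (√P.α - √P.β) ^ 2 / ((g : ℝ) * c)) ≤ p * entryInfo q P.θ ∧
      Real.log n / (δc * m) *
          (s - ((√P.α - √P.γ) ^ 2 + ((g : ℝ) - 1) * (√P.β - √P.γ) ^ 2) / ((g : ℝ) * c)) ≤
        p * entryInfo q P.θ := by
  have hI := entryInfo_pos hθ0 hθ1
  rw [threshold, ← entryInfo, one_div, inv_mul_le_iff₀ hI, max_le_iff, max_le_iff,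
    mul_comm (entryInfo q P.θ)]

/-- `p` is above the threshold with margin `s`, in multiplied-out form. -/
structure AboveThreshold (P : Model q c g r) (n m : ℕ) (δg δc s p : ℝ) : Prop where
  column : ((c * g : ℕ) : ℝ) * s * Real.log m ≤ p * entryInfo q P.θ * n * ((g : ℝ) - r + 1)
  intra : s * Real.log n ≤ p * entryInfo q P.θ * (δg * m) +
    (√P.α - √P.β) ^ 2 * Real.log n / (c * g : ℕ)
  inter : s * Real.log n ≤ p * entryInfo q P.θ * (δc * m) +
    ((√P.α - √P.γ) ^ 2 + ((g : ℝ) - 1) * (√P.β - √P.γ) ^ 2) * Real.log n / (c * g : ℕ)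

theorem aboveThreshold_of_threshold_le [Fact q.Prime] (P : Model q c g r) (hθ0 : 0 ≤ P.θ)
    (hθ1 : P.θ < ((q : ℝ) - 1) / q) (hrg : r ≤ g) (hn : 0 < n) (hm : 0 < m) {δg δc s p : ℝ}
    (hδg : 0 < δg) (hδc : 0 < δc) (h : threshold P n m δg δc s ≤ p) :
    AboveThreshold P n m δg δc s p := by
  obtain ⟨h1, h2, h3⟩ := (threshold_le_iff P hθ0 hθ1).1 h
  have hn' : (0 : ℝ) < n := by exact_mod_cast hn
  have hm' : (0 : ℝ) < m := by exact_mod_cast hm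
  have hgr : (0 : ℝ) < (g : ℝ) - r + 1 := by
    have : (r : ℝ) ≤ g := by exact_mod_cast hrg
    linarith
  have key : ∀ δ J : ℝ, 0 < δ → Real.log n / (δ * m) * (s - J / ((g : ℝ) * c)) ≤
      p * entryInfo q P.θ → s * Real.log n ≤ p * entryInfo q P.θ * (δ * m) +
      J * Real.log n / (c * g : ℕ) := by
    intro δ J hδ h
    rw [div_mul_eq_mul_div, div_le_iff₀ (by positivity)] at h
    have : J * Real.log n / (c * g : ℕ) = Real.log n * (J / ((g : ℝ) * c)) := by
      push_cast
      rw [mul_comm (c : ℝ)]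
      ring
    rw [this]
    linarith
  refine ⟨?_, key _ _ hδg h2, key _ _ hδc h3⟩
  rw [div_mul_div_comm, div_le_iff₀ (by positivity)] at h1
  push_cast
  linarith

theorem le_hammingDist_row {P : Model q c g r} {M : Instance q c g r n m} {δ₀ δg δc : ℝ}
    (hM : M ∈ matSet P n m δg δc) (hm : 0 < m) (hδg : δ₀ ≤ δg) (hδc : δ₀ ≤ δc)
    {s t : Fin c × Fin g} (hst : s ≠ t) : δ₀ * m ≤ hammingDist (M.row P s) (M.row P t) := by
  have hm' : (0 : ℝ) < m := by exact_mod_cast hm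
  by_cases h : s.1 = t.1
  · exact (mul_le_mul_of_nonneg_right hδg hm'.le).trans
      (hammingDist_row_ge_intra hM.2.1 hm hst h)
  · exact (mul_le_mul_of_nonneg_right hδc hm'.le).trans
      (hammingDist_row_ge_inter hM.2.2 hm h)

/-- Competitors far from every relabelling of the ground truth have large exponents. -/
theorem exponent_ge_of_not_isAligned (P : Model q c g r) (hrg : r ≤ g)
    (hγβ : P.γ ≤ P.β) (hβα : P.β ≤ P.α)
    {p : ℝ} (hp : p ∈ Set.Icc (0 : ℝ) 1)
    (hcg : 0 < c * g) (hn : 0 < n) (hm : 0 < m) {δ₀ δg δc ε : ℝ} (hδ₀ : 0 < δ₀) (hδg : δ₀ ≤ δg)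
    (hδg1 : δg ≤ 1)
    (hδc : δ₀ ≤ δc) (hε : 0 < ε) (hab : AboveThreshold P n m δg δc (1 + ε) p)
    {M X : Instance q c g r n m}
    (hM : M ∈ matSet P n m δg δc) (hX : X ∈ matSet P n m δg δc) {η κ : ℝ}
    (hη0 : 0 < η) (hη4 : η ≤ 1 / 4)
    (hfar : ¬ ∃ π, IsAligned (n / (c * g)) η M.part X.part π)
    (hl1 : κ + 1 ≤ η * δ₀ / (4 * (c * g : ℕ)) * ε * Real.log n)
    (hl2 : κ ≤ η * δ₀ / (4 * (c * g : ℕ)) * (Real.log m / (g + 1)))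
    (hl3 : κ + 1 ≤ η / (8 * (c * g : ℕ)) * Real.log n)
    (hl4 : κ * ((g + 1) * ε) ≤ η / (8 * (c * g : ℕ)) * Real.log m) :
    (n + m) * κ + n ≤ exponent P p M X := by
  set K : ℝ := ((c * g : ℕ) : ℝ) with hK
  set x := p * entryInfo q P.θ with hx
  set ln := Real.log n with hln
  set lm := Real.log m with hlm
  set N : ℕ := n / (c * g) with hN
  have hKpos : 0 < K := by rw [hK]; exact_mod_cast hcg
  have hn' : (0 : ℝ) < n := by exact_mod_cast hn
  have hm' : (0 : ℝ) < m := by exact_mod_cast hm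
  have hln0 : 0 ≤ ln := Real.log_natCast_nonneg n
  have hlm0 : 0 ≤ lm := Real.log_natCast_nonneg m
  have hKN : K * N = n := mul_div_card_eq hM.1 hcg
  have hNK : (N : ℝ) = n / K := by rw [← hKN]; field_simp
  have hN0 : 0 < N := by
    have : (0 : ℝ) < N := by rw [hNK]; positivity
    exact_mod_cast this
  have hx0 : 0 ≤ x := mul_nonneg hp.1 (sq_nonneg _)
  have hK1 : 1 ≤ K := by rw [hK]; exact_mod_cast hcg
  have hr0 : (0 : ℝ) ≤ r := r.cast_nonneg
  have hrg' : (r : ℝ) ≤ g := by exact_mod_cast hrg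
  have hg1 : (g : ℝ) - r + 1 ≤ g + 1 := by linarith
  have hsep : ∀ X ∈ matSet P n m δg δc, ∀ s t, s ≠ t →
      δ₀ * m ≤ hammingDist (X.row P s) (X.row P t) :=
    fun X hX s t hst => le_hammingDist_row hX hm hδg hδc hst
  have hxn : K * lm ≤ x * n * (g + 1) := by
    have h1 : K * lm ≤ K * (1 + ε) * lm := by
      have : 0 ≤ ε * (K * lm) := by positivity
      linarith
    have h2 : x * n * ((g : ℝ) - r + 1) ≤ x * n * (g + 1) :=
      mul_le_mul_of_nonneg_left hg1 (by positivity)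
    linarith [hab.column]
  have hD := hammingDist_ge_of_not_isAligned (fun s => card_group_eq hM.1 hcg s)
    (v := M.row P) (v' := X.row P) (by positivity : 0 ≤ δ₀ * m) (by linarith)
    (hsep M hM) (hsep X hX) hfar
  have hG := sum_sum_ge_of_not_isAligned hN0 (fun s => card_group_eq hM.1 hcg s)
    (fun s => card_group_eq hX.1 hcg s) (by linarith) hfar
    (φ := fun a b => (√(edgeConst P (M.part a) (M.part b)) -
      √(edgeConst P (X.part a) (X.part b))) ^ 2) (fun a b => sq_nonneg _)
    (x := (√P.α - √P.β) ^ 2) (sq_nonneg _) (by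
      intro a b hab' hne
      have h1 : edgeConst P (M.part a) (M.part b) = P.α := by simp [edgeConst, hab']
      have h2 : edgeConst P (X.part a) (X.part b) ≤ P.β := by
        simp only [edgeConst, hne, if_false]
        split_ifs <;> linarith
      rw [h1]
      have h3 := Real.sqrt_le_sqrt h2
      have h4 := Real.sqrt_le_sqrt hβα
      exact pow_le_pow_left₀ (by linarith) (by linarith) 2)
  have hD' := mul_le_mul_of_nonneg_left hD hx0
  have hG' := mul_le_mul_of_nonneg_left hG
    (by positivity : 0 ≤ ln / n / 4)
  have hexp1 : 0 ≤ ln / n / 4 * ∑ a, ∑ b, (√(edgeConst P (M.part a) (M.part b)) -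
      √(edgeConst P (X.part a) (X.part b))) ^ 2 :=
    mul_nonneg (by positivity)
      (Finset.sum_nonneg fun a _ => Finset.sum_nonneg fun b _ => sq_nonneg _)
  have hexp2 : 0 ≤ x * ∑ a, (hammingDist (M.mat P a) (X.mat P a) : ℝ) :=
    mul_nonneg hx0 (Finset.sum_nonneg fun a _ => Nat.cast_nonneg _)
  have hDD : ∑ a, (hammingDist (M.row P (M.part a)) (X.row P (X.part a)) : ℝ) =
    ∑ a, (hammingDist (M.mat P a) (X.mat P a) : ℝ) := rfl
  rw [hDD] at hD'
  unfold exponent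
  rw [← hx, ← hln]
  have hxnm : m * (lm / (g + 1)) ≤ x * n * m := by
    have h1 : lm ≤ x * n * (g + 1) := by
      have h0 : lm ≤ K * lm := le_mul_of_one_le_left hlm0 hK1
      linarith
    have h2 : lm / (g + 1) ≤ x * n := by rwa [div_le_iff₀ (by positivity)]
    rw [mul_comm]
    exact mul_le_mul_of_nonneg_right h2 hm'.le
  -- In this case the ratings suffice: their contribution of order `x n m` dominates `n log n` by
  -- the case assumption and `m log m` by the column condition.
  by_cases hcase : ε * ln ≤ x * m
  · have h1 : x * (η * N * (δ₀ * m / 2)) = 2 * (η * δ₀ / (4 * K)) * (x * n * m) := by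
      rw [hNK]; field_simp; ring
    have h2 : n * (ε * ln) ≤ x * n * m := by
      have := mul_le_mul_of_nonneg_left hcase hn'.le
      linarith
    have h3 : 0 ≤ η * δ₀ / (4 * K) := by positivity
    have h4 := mul_le_mul_of_nonneg_left h2 h3
    have h5 := mul_le_mul_of_nonneg_left hxnm h3
    have h6 := mul_le_mul_of_nonneg_left hl1 hn'.le
    have h7 := mul_le_mul_of_nonneg_left hl2 hm'.le
    rw [h1] at hD'
    linarith
  · push Not at hcase
    have hlnpos : 0 < ln := by
      by_contra h0
      have : ln = 0 := le_antisymm (not_lt.1 h0) hln0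
      rw [this, mul_zero] at hcase
      exact absurd hcase (not_lt.2 (by positivity))
    have h1 : x * (δg * m) ≤ x * m :=
      mul_le_mul_of_nonneg_left (mul_le_of_le_one_left hm'.le hδg1) hx0
    -- With few ratings, the condition inside clusters can only hold if the graph alone separates
    -- the groups. Its contribution is of order `n log n`, and here `m log m` is of at most this
    -- order as well.
    have h2 : ln ≤ (√P.α - √P.β) ^ 2 * ln / K := by linarith [hab.intra]
    have h3 : K ≤ (√P.α - √P.β) ^ 2 := by
      rw [le_div_iff₀ hKpos] at h2
      exact le_of_mul_le_mul_right (by linarith) hlnpos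
    have h4 : ln / n / 4 * (η * N ^ 2 * (√P.α - √P.β) ^ 2) ≥ 2 * (η / (8 * K)) * (n * ln) := by
      have h5 : ln / n / 4 * (η * N ^ 2 * K) = 2 * (η / (8 * K)) * (n * ln) := by
        rw [hNK]; field_simp; ring
      rw [ge_iff_le, ← h5]
      gcongr
    have h6 := mul_le_mul_of_nonneg_left hl3 hn'.le
    have h7 : m * κ ≤ η / (8 * K) * (n * ln) := by
      have h8 : m * lm ≤ (g + 1) * ε * (n * ln) := by
        have h9 : x * n * m ≤ n * (ε * ln) := by
          have := mul_le_mul_of_nonneg_left hcase.le hn'.le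
          linarith
        have h10 := hxnm.trans h9
        rw [← mul_div_assoc, div_le_iff₀ (by positivity)] at h10
        linarith
      have h9 := mul_le_mul_of_nonneg_left h8 (by positivity : 0 ≤ η / (8 * K))
      have h10 := mul_le_mul_of_nonneg_left hl4 hm'.le
      have h11 : (g + 1) * ε * (m * κ) ≤ (g + 1) * ε * (η / (8 * K) * (n * ln)) := by linarith
      exact le_of_mul_le_mul_left h11 (by positivity)
    linarith

variable [Fact q.Prime]

/-- Explicit bound for the error probability of maximum likelihood. -/
theorem errorProb_le_explicit (P : Model q c g r) (hcode : ∀ x, IsMDS (P.code x)) (hrg : r ≤ g)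
    (hθ : P.θ ∈ Set.Icc (0 : ℝ) 1) (hγ : 0 ≤ P.γ) (hγβ : P.γ ≤ P.β) (hβα : P.β ≤ P.α)
    {p : ℝ} (hp : p ∈ Set.Icc (0 : ℝ) 1) (hL : P.α * (Real.log n / n) ≤ 1)
    (hcg : 0 < c * g) (hn : 0 < n) (hm : 0 < m) {δ₀ δg δc ε : ℝ} (hδ₀ : 0 < δ₀) (hδg : δ₀ ≤ δg)
    (hδg1 : δg ≤ 1)
    (hδc : δ₀ ≤ δc) (hε : 0 < ε) (hab : AboveThreshold P n m δg δc (1 + ε) p)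
    {ψ : Estimator q n m} (hψ : IsMaxLikelihood P p δg δc ψ) {M : Instance q c g r n m}
    (hM : M ∈ matSet P n m δg δc) {η κ cβ : ℝ} (hη : η = ε / (4 * (1 + ε)))
    (hκ : κ = Real.log (c * g : ℕ) + r * c * Real.log q)
    (hcβ : P.β ≠ P.γ → cβ ≤ ((1 - η) ^ 2 * (√P.β - √P.γ) ^ 2) / (4 * (c * g : ℕ) ^ 2))
    (hl1 : κ + 1 ≤ η * δ₀ / (4 * (c * g : ℕ)) * ε * Real.log n)
    (hl2 : κ ≤ η * δ₀ / (4 * (c * g : ℕ)) * (Real.log m / (g + 1)))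
    (hl3 : κ + 1 ≤ η / (8 * (c * g : ℕ)) * Real.log n)
    (hl4 : κ * ((g + 1) * ε) ≤ η / (8 * (c * g : ℕ)) * Real.log m)
    (hl5 : Real.log (c * g : ℕ) + 1 ≤ cβ * Real.log n)
    (hl6 : (q : ℝ) ^ r * Real.exp (-(Real.log m / (g + 1))) ≤ 1) :
    errorProb P p ψ M ≤ Real.exp (-n) + (Fintype.card (Equiv.Perm (Fin c × Fin g)) : ℝ) *
      ((Real.exp ((c * g : ℕ) * Real.exp (-(ε / 2 * Real.log n))) - 1) *
          Real.exp (c * (q : ℝ) ^ r * Real.exp (-(ε / 2 * Real.log m))) +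
        Real.exp ((c * g : ℕ) * Real.exp (-(ε / 2 * Real.log n))) *
          ((q : ℝ) ^ r * Real.exp (-(Real.log m / (g + 1))) *
            Real.exp (c * (q : ℝ) ^ r * Real.exp (-(ε / 2 * Real.log m))) +
            (Real.exp (c * (q : ℝ) ^ r * Real.exp (-(ε / 2 * Real.log m))) - 1)) +
        Real.exp (-n) * Real.exp (c * (q : ℝ) ^ r * Real.exp (-(ε / 2 * Real.log m)))) := by
  set K : ℝ := ((c * g : ℕ) : ℝ) with hK
  set x := p * entryInfo q P.θ with hx
  set ln := Real.log n with hln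
  set lm := Real.log m with hlm
  set N : ℕ := n / (c * g) with hN
  have hKpos : 0 < K := by rw [hK]; exact_mod_cast hcg
  have hn' : (0 : ℝ) < n := by exact_mod_cast hn
  have hm' : (0 : ℝ) < m := by exact_mod_cast hm
  have hq2 := two_le_cast_prime (q := q)
  have hln0 : 0 ≤ ln := Real.log_natCast_nonneg n
  have hlm0 : 0 ≤ lm := Real.log_natCast_nonneg m
  have hKN : K * N = n := mul_div_card_eq hM.1 hcg
  have hNK : (N : ℝ) = n / K := by rw [← hKN]; field_simp
  have hN0 : 0 < N := by
    have : (0 : ℝ) < N := by rw [hNK]; positivity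
    exact_mod_cast this
  have hx0 : 0 ≤ x := mul_nonneg hp.1 (sq_nonneg _)
  have hε1 : 0 < 1 + ε := by linarith
  have hη0 : 0 < η := by rw [hη]; positivity
  have hηε : η * (4 * (1 + ε)) = ε := by rw [hη]; field_simp
  have hη4 : η ≤ 1 / 4 := by rw [hη, div_le_iff₀ (by positivity)]; linarith
  -- The choice of `η`: the loss `1 - 2 * η` from misaligned users consumes half of the margin `ε`.
  have hηε2 : 1 + ε / 2 = (1 - 2 * η) * (1 + ε) := by linarith
  have hK1 : 1 ≤ K := by rw [hK]; exact_mod_cast hcg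
  have hlogK : 0 ≤ Real.log K := Real.log_nonneg hK1
  have hκ0 : 0 ≤ κ := by
    rw [hκ]
    have : 0 ≤ Real.log q := Real.log_natCast_nonneg q
    positivity
  have hrg' : (r : ℝ) ≤ g := by exact_mod_cast hrg
  have hr0 : (0 : ℝ) ≤ r := r.cast_nonneg
  have hg1 : (g : ℝ) - r + 1 ≤ g + 1 := by linarith
  have hgr : (0 : ℝ) < (g : ℝ) - r + 1 := by linarith
  have hmain := errorProb_le_of_exponents P hcode hγ hγβ hβα hp hθ hL hψ hM (N := N)
    (fun X hX => card_group_eq hX.1 hcg) (η := η) (ρ := (1 + ε / 2) * ln)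
    (R := (n + m) * κ + n) (R₂ := cβ * ln * n)
    (b := (q : ℝ) ^ r * Real.exp (-(lm / (g + 1))))
    (e₂ := (q : ℝ) ^ r * Real.exp (-((1 + ε / 2) * lm))) (by linarith)
    (fun X hX hfar => exponent_ge_of_not_isAligned P hrg hγβ hβα hp hcg hn hm hδ₀ hδg hδg1 hδc hε
      hab hM hX hη0 hη4 hfar hl1 hl2 hl3 hl4)
    (by
      intro s t hst
      have hJ := graphInfo_nonneg P s t
      have h1 : (1 - η) * N * (ln / n) * graphInfo P s t =
          (1 - η) * (graphInfo P s t * ln / K) := by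
        rw [hNK]; field_simp
      rw [h1]
      have h2 : (1 + ε) * ln ≤ x * hammingDist (M.row P s) (M.row P t) +
          graphInfo P s t * ln / K := by
        by_cases h : s.1 = t.1
        · have h3 := mul_le_mul_of_nonneg_left (hammingDist_row_ge_intra hM.2.1 hm hst h) hx0
          rw [graphInfo_intra P hst h]
          linarith [hab.intra]
        · have h3 := mul_le_mul_of_nonneg_left (hammingDist_row_ge_inter hM.2.2 hm h) hx0
          rw [graphInfo_inter P h]
          linarith [hab.inter]
      have h4 : 0 ≤ x * (hammingDist (M.row P s) (M.row P t) : ℝ) := by positivity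
      have h5 := mul_le_mul_of_nonneg_left h2 (by linarith : 0 ≤ 1 - η)
      have h6 : (1 + ε / 2) * ln ≤ (1 - η) * ((1 + ε) * ln) := by
        rw [hηε2]
        have : 0 ≤ η * ((1 + ε) * ln) := by positivity
        linarith
      have h7 := mul_nonneg hη0.le h4
      linarith)
    (by
      intro h
      have h1 := mul_le_mul_of_nonneg_right (hcβ h) (by positivity : 0 ≤ ln * n)
      refine le_trans (le_of_eq (by ring)) (h1.trans (le_of_eq ?_))
      rw [hNK]
      field_simp
      rw [hln])
    hl6
    (by
      refine mul_le_mul_of_nonneg_left (Real.exp_le_exp.2 (neg_le_neg ?_)) (by positivity)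
      have h2 : (1 + ε) * K * lm ≤ x * n * (g + 1) := by
        have h3 : x * n * ((g : ℝ) - r + 1) ≤ x * n * (g + 1) :=
          mul_le_mul_of_nonneg_left hg1 (by positivity)
        linarith [hab.column]
      rw [div_le_iff₀ (by positivity), hNK]
      have h4 : x * (1 - 2 * η) * (n / K) * (g + 1) = (1 - 2 * η) * (x * n * (g + 1)) / K := by
        ring
      rw [h4, le_div_iff₀ hKpos]
      have h5 := mul_le_mul_of_nonneg_left h2 (by linarith : 0 ≤ 1 - 2 * η)
      have h6 : (1 - 2 * η) * ((1 + ε) * K * lm) = (1 + ε / 2) * (K * lm) := by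
        rw [hηε2]; ring
      have h7 : K * lm ≤ (1 + ε / 2) * (K * lm) :=
        le_mul_of_one_le_left (by positivity) (by linarith)
      linarith)
    (by
      refine mul_le_mul_of_nonneg_left (Real.exp_le_exp.2 (neg_le_neg ?_)) (by positivity)
      rw [hNK]
      have h4 : x * (1 - 2 * η) * (n / K) * ((g : ℝ) - r + 1) =
          (1 - 2 * η) * (x * n * ((g : ℝ) - r + 1)) / K := by ring
      rw [h4, le_div_iff₀ hKpos, hηε2]
      have h5 := mul_le_mul_of_nonneg_left hab.column (by linarith : 0 ≤ 1 - 2 * η)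
      linarith)
  -- Each of `n` users has wrong labels of total weight `K n^(-(1 + ε/2))`; the margin leaves
  -- `n^(-ε/2)`. The columns behave in the same way with `m`.
  have e1 : (n : ℝ) * (K * Real.exp (-((1 + ε / 2) * ln))) = K * Real.exp (-(ε / 2 * ln)) := by
    have : Real.exp (-((1 + ε / 2) * ln)) = Real.exp (-ln) * Real.exp (-(ε / 2 * ln)) := by
      rw [← Real.exp_add]; ring_nf
    rw [this, Real.exp_neg ln, hln, Real.exp_log hn']
    field_simp
  have e2 : ((c * m : ℕ) : ℝ) * ((q : ℝ) ^ r * Real.exp (-((1 + ε / 2) * lm))) =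
      c * (q : ℝ) ^ r * Real.exp (-(ε / 2 * lm)) := by
    have : Real.exp (-((1 + ε / 2) * lm)) = Real.exp (-lm) * Real.exp (-(ε / 2 * lm)) := by
      rw [← Real.exp_add]; ring_nf
    rw [this, Real.exp_neg lm, hlm, Real.exp_log hm']
    push_cast
    field_simp
  rw [e1, e2] at hmain
  have hqpos : (0 : ℝ) < q := by linarith
  -- `κ` is chosen so that `exp ((n + m) κ)` exceeds the number of all ground truths.
  have e3 : ((q : ℝ) ^ r) ^ (c * m) * K ^ n * Real.exp (-((n + m) * κ + n)) ≤ Real.exp (-n) := by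
    have h1 : ((q : ℝ) ^ r) ^ (c * m) = Real.exp (r * c * m * Real.log q) := by
      rw [← pow_mul, ← Real.exp_log (pow_pos hqpos _), Real.log_pow]
      push_cast; ring_nf
    have h2 : K ^ n = Real.exp (n * Real.log K) := by
      rw [← Real.exp_log (pow_pos hKpos _), Real.log_pow]
    rw [h1, h2, ← Real.exp_add, ← Real.exp_add, Real.exp_le_exp, hκ]
    have : 0 ≤ Real.log q := Real.log_natCast_nonneg q
    have h3 : 0 ≤ (n : ℝ) * (r * c * Real.log q) := by positivity
    have h4 : 0 ≤ (m : ℝ) * Real.log K := by positivity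
    linarith
  have e4 : K ^ n * Real.exp (-(cβ * ln * n)) ≤ Real.exp (-n) := by
    have h2 : K ^ n = Real.exp (n * Real.log K) := by
      rw [← Real.exp_log (pow_pos hKpos _), Real.log_pow]
    rw [h2, ← Real.exp_add, Real.exp_le_exp]
    have := mul_le_mul_of_nonneg_left hl5 hn'.le
    linarith
  refine hmain.trans ?_
  gcongr

end Achievability

/-! ### The limit above the threshold -/

noncomputable section AchievabilityLimit

open scoped Classical

section Basic

variable {q c g r n m : ℕ} [Fact q.Prime]

theorem errorProb_nonneg (P : Model q c g r) (hγ : 0 ≤ P.γ) (hγβ : P.γ ≤ P.β) (hβα : P.β ≤ P.α)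
    {p : ℝ} (hp : p ∈ Set.Icc (0 : ℝ) 1) (hθ : P.θ ∈ Set.Icc (0 : ℝ) 1) (ψ : Estimator q n m)
    (M : Instance q c g r n m) : 0 ≤ errorProb P p ψ M := by
  rw [errorProb_eq]
  refine Finset.sum_nonneg fun w _ => ?_
  split_ifs
  · exact Finset.prod_nonneg fun i _ => law_nonneg P (by linarith) (by linarith) hγ hp hθ M _ _
  · exact le_rfl

theorem worstError_nonneg (P : Model q c g r) (hγ : 0 ≤ P.γ) (hγβ : P.γ ≤ P.β) (hβα : P.β ≤ P.α)
    {p : ℝ} (hp : p ∈ Set.Icc (0 : ℝ) 1) (hθ : P.θ ∈ Set.Icc (0 : ℝ) 1) (δg δc : ℝ)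
    (ψ : Estimator q n m) : 0 ≤ worstError P p δg δc ψ :=
  Real.iSup_nonneg fun M => errorProb_nonneg P hγ hγβ hβα hp hθ ψ M.1

end Basic

section Distances

variable {q c g r n m : ℕ}

/-- The minimum is attained, so there are two groups realizing it. With `m = 0` the distance would
be `0 / 0 = 0`. -/
theorem pos_of_isLeast_intraDistances {P : Model q c g r} {M : Instance q c g r n m} {δ : ℝ}
    (h : IsLeast (M.intraDistances P) δ) (hδ : 0 < δ) : 0 < c * g ∧ 0 < m ∧ δ ≤ 1 := by
  obtain ⟨x, i, j, _, hd⟩ := h.1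
  have hm : 0 < m := by
    rcases Nat.eq_zero_or_pos m with h0 | h0
    · subst h0
      rw [hd] at hδ
      simp at hδ
    · exact h0
  refine ⟨Nat.mul_pos (Fin.pos x) (Fin.pos i), hm, ?_⟩
  have hm' : (0 : ℝ) < m := by exact_mod_cast hm
  rw [hd, div_le_one hm']
  have := hammingDist_le_card_fintype (x := M.vec P x i) (y := M.vec P x j)
  rw [Fintype.card_fin] at this
  exact_mod_cast this

theorem mem_matSet_of_isLeast {P : Model q c g r} {M : Instance q c g r n m} {δg δc : ℝ}
    (hM : M.WellFormed) (hg : IsLeast (M.intraDistances P) δg)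
    (hc : IsLeast (M.interDistances P) δc) : M ∈ matSet P n m δg δc :=
  ⟨hM, hg.2, hc.2⟩

end Distances

section Asymptotics

variable {n m : ℕ → ℕ}

theorem tendsto_log_of_tendsto (hn : Tendsto n atTop atTop) :
    Tendsto (fun k => Real.log (n k)) atTop atTop :=
  Real.tendsto_log_atTop.comp (tendsto_natCast_atTop_atTop.comp hn)

theorem tendsto_atTop_of_log_isLittleO (hn : Tendsto n atTop atTop)
    (hm : (fun k => Real.log (n k)) =o[atTop] (fun k => (m k : ℝ))) : Tendsto m atTop atTop := by
  rw [← tendsto_natCast_atTop_iff (R := ℝ)]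
  refine tendsto_atTop_mono' _ ?_ (tendsto_log_of_tendsto hn)
  filter_upwards [hm.def one_pos] with k hk
  rw [one_mul, Real.norm_eq_abs, Real.norm_eq_abs, Nat.abs_cast] at hk
  exact (le_abs_self _).trans hk

theorem tendsto_log_div (hn : Tendsto n atTop atTop) :
    Tendsto (fun k => Real.log (n k) / n k) atTop (𝓝 0) := by
  have h := Real.isLittleO_log_id_atTop.tendsto_div_nhds_zero
  exact h.comp (tendsto_natCast_atTop_atTop.comp hn)

theorem eventually_le_mul_of_tendsto {f : ℕ → ℝ} (hf : Tendsto f atTop atTop) {a : ℝ} (ha : 0 < a)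
    (b : ℝ) : ∀ᶠ k in atTop, b ≤ a * f k :=
  (hf.const_mul_atTop ha).eventually_ge_atTop b

theorem tendsto_exp_neg_mul {f : ℕ → ℝ} (hf : Tendsto f atTop atTop) {a : ℝ} (ha : 0 < a) :
    Tendsto (fun k => Real.exp (-(a * f k))) atTop (𝓝 0) :=
  Real.tendsto_exp_neg_atTop_nhds_zero.comp (hf.const_mul_atTop ha)

end Asymptotics

/-- The bound of `errorProb_le_explicit` does not depend on the ground truth and tends to zero, and
its finitely many size conditions hold eventually. -/
theorem tendsto_worstError_of_isMaxLikelihood {q c g r : ℕ} [Fact q.Prime] (P : Model q c g r)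
    (hrg : r ≤ g) (hcode : ∀ x, IsMDS (P.code x))
    (hθ0 : 0 ≤ P.θ) (hθ1 : P.θ < ((q : ℝ) - 1) / q)
    (hγ : 0 < P.γ) (hγβ : P.γ ≤ P.β) (hβα : P.β ≤ P.α)
    (n m : ℕ → ℕ) (hn : Tendsto n atTop atTop)
    (hm : (fun k => Real.log (n k)) =o[atTop] (fun k => (m k : ℝ)))
    (δg δc : ℕ → ℝ) (δ₀ : ℝ) (hδ₀ : 0 < δ₀) (hδg : ∀ k, δ₀ ≤ δg k) (hδc : ∀ k, δ₀ ≤ δc k)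
    (hδ : ∀ k, ∃ M₀ : Instance q c g r (n k) (m k), M₀.WellFormed ∧
      IsLeast (M₀.intraDistances P) (δg k) ∧ IsLeast (M₀.interDistances P) (δc k))
    (p : ℕ → ℝ) (hp : ∀ k, p k ∈ Set.Icc (0 : ℝ) 1) (ε : ℝ) (hε : 0 < ε)
    (hthr : ∀ᶠ k in atTop, threshold P (n k) (m k) (δg k) (δc k) (1 + ε) ≤ p k)
    (ψ : ∀ k, Estimator q (n k) (m k))
    (hψ : ∀ k, IsMaxLikelihood P (p k) (δg k) (δc k) (ψ k)) :
    Tendsto (fun k => worstError P (p k) (δg k) (δc k) (ψ k)) atTop (𝓝 0) := by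
  have hθ : P.θ ∈ Set.Icc (0 : ℝ) 1 := ⟨hθ0, (theta_lt_one hθ1).le⟩
  have hfact : ∀ k, 0 < c * g ∧ 0 < m k ∧ δg k ≤ 1 := fun k => by
    obtain ⟨M₀, _, h1, _⟩ := hδ k
    exact pos_of_isLeast_intraDistances h1 (hδ₀.trans_le (hδg k))
  have hcg := (hfact 0).1
  set K : ℝ := ((c * g : ℕ) : ℝ) with hK
  have hKpos : 0 < K := by rw [hK]; exact_mod_cast hcg
  obtain ⟨η, hη⟩ : ∃ η, η = ε / (4 * (1 + ε)) := ⟨_, rfl⟩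
  obtain ⟨κ, hκ⟩ : ∃ κ, κ = Real.log K + r * c * Real.log q := ⟨_, rfl⟩
  have hη0 : 0 < η := by rw [hη]; positivity
  have hη1 : η < 1 := by rw [hη, div_lt_one (by positivity)]; linarith
  obtain ⟨cβ, hcβ0, hcβ⟩ : ∃ cβ : ℝ, 0 < cβ ∧ (P.β ≠ P.γ →
      cβ ≤ ((1 - η) ^ 2 * (√P.β - √P.γ) ^ 2) / (4 * K ^ 2)) := by
    -- For `β = γ` every relabelling preserves the edge constants, and any positive constant will
    -- do.
    by_cases h : P.β = P.γ
    · exact ⟨1, one_pos, fun h' => absurd h h'⟩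
    · refine ⟨_, ?_, fun _ => le_rfl⟩
      have h1 : √P.β - √P.γ ≠ 0 := fun h' => h
        ((Real.sqrt_inj (hγ.le.trans hγβ) hγ.le).1 (sub_eq_zero.1 h'))
      have h2 : 0 < 1 - η := by linarith
      positivity
  have hmt := tendsto_atTop_of_log_isLittleO hn hm
  have hln := tendsto_log_of_tendsto hn
  have hlm := tendsto_log_of_tendsto hmt
  have hnr : Tendsto (fun k => (n k : ℝ)) atTop atTop := tendsto_natCast_atTop_atTop.comp hn
  have hg1 : (0 : ℝ) < 1 / ((g : ℝ) + 1) := by positivity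
  have T1 : Tendsto (fun k => Real.exp (-(n k : ℝ))) atTop (𝓝 0) :=
    Real.tendsto_exp_neg_atTop_nhds_zero.comp hnr
  have T2 : Tendsto (fun k => Real.exp (K * Real.exp (-(ε / 2 * Real.log (n k))))) atTop (𝓝 1) := by
    have := (Real.continuous_exp.tendsto _).comp
      ((tendsto_exp_neg_mul hln (half_pos hε)).const_mul K)
    rw [mul_zero, Real.exp_zero] at this
    exact this
  have T3 : Tendsto (fun k => Real.exp (c * (q : ℝ) ^ r *
      Real.exp (-(ε / 2 * Real.log (m k))))) atTop (𝓝 1) := by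
    have := (Real.continuous_exp.tendsto _).comp
      ((tendsto_exp_neg_mul hlm (half_pos hε)).const_mul (c * (q : ℝ) ^ r))
    rw [mul_zero, Real.exp_zero] at this
    exact this
  have T4 : Tendsto (fun k => (q : ℝ) ^ r * Real.exp (-(Real.log (m k) / (g + 1)))) atTop
      (𝓝 0) := by
    have := (tendsto_exp_neg_mul hlm hg1).const_mul ((q : ℝ) ^ r)
    rw [mul_zero] at this
    refine this.congr fun k => ?_
    rw [one_div_mul_eq_div]
  have hbound := T1.add (((((T2.sub_const 1).mul T3).add
    (T2.mul ((T4.mul T3).add (T3.sub_const 1)))).add (T1.mul T3)).const_mul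
      (Fintype.card (Equiv.Perm (Fin c × Fin g)) : ℝ))
  simp only [sub_self, zero_mul, mul_zero, add_zero] at hbound
  refine tendsto_of_tendsto_of_tendsto_of_le_of_le' tendsto_const_nhds hbound
    (Eventually.of_forall fun k => worstError_nonneg P hγ.le hγβ hβα (hp k) hθ _ _ _) ?_
  have hLt : Tendsto (fun k => P.α * (Real.log (n k) / n k)) atTop (𝓝 0) := by
    simpa using (tendsto_log_div hn).const_mul P.α
  filter_upwards [hthr, hLt.eventually_le_const one_pos, hn.eventually_ge_atTop 1,
    eventually_le_mul_of_tendsto hln (a := η * δ₀ / (4 * K) * ε) (by positivity) (κ + 1),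
    eventually_le_mul_of_tendsto hlm (a := η * δ₀ / (4 * K) * (1 / (g + 1))) (by positivity) κ,
    eventually_le_mul_of_tendsto hln (a := η / (8 * K)) (by positivity) (κ + 1),
    eventually_le_mul_of_tendsto hlm (a := η / (8 * K)) (by positivity) (κ * ((g + 1) * ε)),
    eventually_le_mul_of_tendsto hln hcβ0 (Real.log K + 1),
    T4.eventually_le_const one_pos] with k hk hL hnk h1 h2 h3 h4 h5 h6
  obtain ⟨M₀, hM₀, hi, ho⟩ := hδ k
  refine worstError_le ⟨M₀, mem_matSet_of_isLeast hM₀ hi ho⟩ fun M hM => ?_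
  exact errorProb_le_explicit P hcode hrg hθ hγ.le hγβ hβα (hp k) hL hcg hnk (hfact k).2.1 hδ₀
    (hδg k) (hfact k).2.2 (hδc k) hε
    (aboveThreshold_of_threshold_le P hθ0 hθ1 hrg hnk (hfact k).2.1 (hδ₀.trans_le (hδg k))
      (hδ₀.trans_le (hδc k)) hk) (hψ k) hM hη hκ hcβ h1
    (by rw [mul_assoc, one_div_mul_eq_div] at h2; exact h2) h3 h4 h5 h6

end AchievabilityLimit

/-! ### Independent blocks of coordinates -/

noncomputable section Blocks

open scoped Classical

variable {ι κ : Type*} [Fintype ι] [DecidableEq ι] [Fintype κ]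

/-- Marginalization of a product weight to the coordinates in the range of an injection. -/
theorem sum_comp_mul_prod {J : Type*} [Fintype J] [DecidableEq J] (f : ι → κ → ℝ) (emb : J → ι)
    (hemb : Function.Injective emb) (φ : (J → κ) → ℝ) :
    ∑ w : ι → κ, φ (w ∘ emb) * ∏ i, f i (w i) =
      (∑ u : J → κ, φ u * ∏ j, f (emb j) (u j)) *
        ∏ i ∈ Finset.univ.filter (· ∉ Set.range emb), ∑ k, f i k := by
  let e : J ⊕ {i // i ∉ Set.range emb} ≃ ι :=
    ((Equiv.ofInjective emb hemb).sumCongr (Equiv.refl _)).trans (Equiv.Set.sumCompl _)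
  have he1 : ∀ j, e (.inl j) = emb j := fun j => rfl
  have he2 : ∀ i, e (.inr i) = i.1 := fun i => rfl
  have h1 : ∑ w : ι → κ, φ (w ∘ emb) * ∏ i, f i (w i) =
      ∑ v : (J → κ) × ({i // i ∉ Set.range emb} → κ),
        φ v.1 * ((∏ j, f (emb j) (v.1 j)) * ∏ i, f i.1 (v.2 i)) := by
    refine Fintype.sum_equiv ((e.symm.arrowCongr (Equiv.refl κ)).trans
      (Equiv.sumArrowEquivProdArrow _ _ _)) _ _ fun w => ?_
    rw [← Equiv.prod_comp e, Fintype.prod_sum_type]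
    rfl
  rw [h1, Fintype.sum_prod_type, Finset.sum_mul]
  refine Finset.sum_congr rfl fun u _ => ?_
  dsimp only
  rw [← Finset.mul_sum, ← Finset.mul_sum,
    sum_prod_apply (fun (i : {i // i ∉ Set.range emb}) k => f i.1 k), ← mul_assoc]
  congr 1
  exact (Finset.prod_subtype (Finset.univ.filter (· ∉ Set.range emb)) (fun i => by simp)
    fun i => ∑ k, f i k).symm

/-- Functions of the coordinates in the range of an injection are independent of events that
concern other coordinates. -/
theorem sum_comp_mul_ite {J : Type*} [Fintype J] [DecidableEq J] (f : ι → κ → ℝ)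
    (hf : ∀ i, ∑ k, f i k = 1) (emb : J → ι) (hemb : Function.Injective emb)
    (φ : (J → κ) → ℝ) (R : Finset ι) (hR : ∀ j, emb j ∉ R) (V : κ → Prop) :
    ∑ w : ι → κ, φ (w ∘ emb) * (if ∀ i ∈ R, V (w i) then ∏ i, f i (w i) else 0) =
      (∑ u : J → κ, φ u * ∏ j, f (emb j) (u j)) * ∏ i ∈ R, ∑ k, if V k then f i k else 0 := by
  -- The event is built into the weights by giving weight zero to forbidden values, which reduces
  -- the claim to a marginalization.
  set f' : ι → κ → ℝ := fun i k => if i ∈ R ∧ ¬ V k then 0 else f i k with hf'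
  have h1 : ∀ w : ι → κ, (if ∀ i ∈ R, V (w i) then ∏ i, f i (w i) else 0) =
      ∏ i, f' i (w i) := by
    intro w
    split_ifs with h
    · exact Finset.prod_congr rfl fun i _ => by
        simp only [hf']
        rw [if_neg]
        exact fun h' => h'.2 (h i h'.1)
    · push Not at h
      obtain ⟨i, hi, hV⟩ := h
      exact (Finset.prod_eq_zero (Finset.mem_univ i) (by simp [hf', hi, hV])).symm
  simp_rw [h1]
  rw [sum_comp_mul_prod f' emb hemb]
  congr 1
  · refine Finset.sum_congr rfl fun u _ => ?_
    congr 1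
    exact Finset.prod_congr rfl fun j _ => by simp [hf', hR j]
  · have h2 : ∀ i, ∑ k, f' i k = if i ∈ R then ∑ k, (if V k then f i k else 0) else 1 := by
      intro i
      split_ifs with hi
      · exact Finset.sum_congr rfl fun k _ => by
          by_cases hV : V k <;> simp [hf', hi, hV]
      · rw [← hf i]
        exact Finset.sum_congr rfl fun k _ => by simp [hf', hi]
    simp_rw [h2]
    rw [Finset.prod_ite_mem]
    refine Finset.prod_congr ?_ fun _ _ => rfl
    ext i
    simp only [Finset.mem_inter, Finset.mem_filter, Finset.mem_univ, true_and]
    refine ⟨fun h => h.2, fun h => ⟨?_, h⟩⟩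
    rintro ⟨j, rfl⟩
    exact hR j h

/-- For independent blocks of coordinates: the probability that none of the events of
probability at least `t` occurs. -/
theorem sum_blocks_ite_forall_not_le {A J : Type*} [Fintype A] [DecidableEq A] [Fintype J]
    [DecidableEq J] (f : A → J → κ → ℝ) (hf0 : ∀ a j k, 0 ≤ f a j k)
    (hf : ∀ a j, ∑ k, f a j k = 1) (S : A → (J → κ) → Prop) (A₁ : Finset A) {t : ℝ}
    (ht : ∀ a ∈ A₁, t ≤ ∑ u : J → κ, if S a u then ∏ j, f a j (u j) else 0) :
    ∑ u : A × J → κ, (if ∀ a ∈ A₁, ¬ S a (fun j => u (a, j)) then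
      ∏ x : A × J, f x.1 x.2 (u x) else 0) ≤ Real.exp (-(t * A₁.card)) := by
  have h := sum_ite_forall_not_le (fun a (u : J → κ) => ∏ j, f a j (u j))
    (fun a u => Finset.prod_nonneg fun j _ => hf0 _ _ _)
    (fun a => by rw [sum_prod_apply (f a)]; exact Finset.prod_eq_one fun j _ => hf a j) S A₁ ht
  refine le_trans (le_of_eq ?_) h
  refine Fintype.sum_equiv (Equiv.curry A J κ) _ _ fun u => ?_
  rw [Fintype.prod_prod_type]
  rfl

/-- From `log (1 - y) ≥ 1 - 1 / (1 - y)` and `1 / (1 - y) ≤ 1 + ξ`. This turns lower bounds for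
Bhattacharyya coefficients into exponentials, at the cost of a factor `1 + ξ` in the exponent. -/
theorem exp_neg_le_one_sub {y ξ : ℝ} (hy : 0 ≤ y) (hξ : 0 ≤ ξ) (h : y * (1 + ξ) ≤ ξ) :
    Real.exp (-((1 + ξ) * y)) ≤ 1 - y := by
  have hy1 : 0 < 1 - y := by nlinarith
  rw [← Real.le_log_iff_exp_le hy1]
  have h1 := Real.one_sub_inv_le_log_of_pos hy1
  refine le_trans ?_ h1
  have h2 : (1 - y)⁻¹ * (1 - y) = 1 := inv_mul_cancel₀ hy1.ne'
  have h3 : (1 - y)⁻¹ ≤ 1 + (1 + ξ) * y := by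
    rw [inv_le_iff_one_le_mul₀ hy1]
    nlinarith
  linarith

end Blocks

/-! ### Second moments of the log-likelihood ratios -/

noncomputable section Variances

variable {q : ℕ} [Fact q.Prime]

/-- Constant of the second moment of the log-likelihood ratio of an observed entry. -/
def entryVar (q : ℕ) (θ : ℝ) : ℝ :=
  2 * √((1 - θ) * (θ / ((q : ℝ) - 1))) * (Real.log (1 - θ) - Real.log (θ / ((q : ℝ) - 1))) ^ 2

theorem entryVar_nonneg (q : ℕ) (θ : ℝ) : 0 ≤ entryVar q θ := by
  unfold entryVar; positivity

theorem sum_sqrt_entryProb_mul_sq {p θ : ℝ} (hp : p ∈ Set.Icc (0 : ℝ) 1)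
    (hθ0 : 0 ≤ θ) (hθ1 : θ < 1) {u v : ZMod q} (huv : u ≠ v) :
    ∑ k, √(entryProb p θ u k * entryProb p θ v k) *
      (Real.log (entryProb p θ u k) - Real.log (entryProb p θ v k)) ^ 2 = p * entryVar q θ := by
  have h3 := sub_one_pos (q := q)
  have h2 : 0 ≤ θ / ((q : ℝ) - 1) := div_nonneg hθ0 h3.le
  -- The common factor `p` cancels in the log-ratio only if it is nonzero.
  rcases hp.1.eq_or_lt with hp0 | hp0
  · rw [← hp0, zero_mul, Fintype.sum_option]
    have : ∀ k : ZMod q, √(entryProb 0 θ u (some k) * entryProb 0 θ v (some k)) *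
      (Real.log (entryProb 0 θ u (some k)) - Real.log (entryProb 0 θ v (some k))) ^ 2 = 0 := by
      intro k; simp [entryProb]
    simp_rw [this]
    simp [entryProb]
  have h1 : 0 < 1 - θ := by linarith
  have hs : ∀ a b : ℝ, √(p * a * (p * b)) = p * √(a * b) := fun a b => by
    rw [show p * a * (p * b) = p ^ 2 * (a * b) by ring, Real.sqrt_mul (sq_nonneg p),
      Real.sqrt_sq hp.1]
  have hA : √(p * (1 - θ) * (p * (θ / ((q : ℝ) - 1)))) *
      (Real.log (p * (1 - θ)) - Real.log (p * (θ / ((q : ℝ) - 1)))) ^ 2 =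
      p * (entryVar q θ / 2) := by
    rw [hs]
    -- For `θ = 0` the geometric mean vanishes, so the value of `Real.log 0` is irrelevant.
    rcases h2.eq_or_lt with h0 | h0
    · rw [← h0]; simp [entryVar, ← h0]
    · rw [Real.log_mul hp0.ne' h1.ne', Real.log_mul hp0.ne' h0.ne']
      unfold entryVar
      ring
  have hB : √(p * (θ / ((q : ℝ) - 1)) * (p * (1 - θ))) *
      (Real.log (p * (θ / ((q : ℝ) - 1))) - Real.log (p * (1 - θ))) ^ 2 =
      p * (entryVar q θ / 2) := by
    rw [← hA, mul_comm (p * (θ / ((q : ℝ) - 1))), ← neg_sub (Real.log (p * (1 - θ))), neg_sq]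
  rw [Fintype.sum_option]
  have h4 : ∀ k : ZMod q, √(entryProb p θ u (some k) * entryProb p θ v (some k)) *
      (Real.log (entryProb p θ u (some k)) - Real.log (entryProb p θ v (some k))) ^ 2 =
      if k = u then p * (entryVar q θ / 2) else if k = v then p * (entryVar q θ / 2) else 0 := by
    intro k
    simp only [entryProb]
    by_cases hu : k = u
    · have hv : k ≠ v := fun h => huv (hu.symm.trans h)
      simp only [hu, if_true, huv, if_false]
      exact hA
    · by_cases hv : k = v
      · simp only [hv, if_true, huv.symm, if_false]
        exact hB
      · simp [hu, hv]
  simp_rw [h4]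
  rw [sum_zmod_ite_ite huv]
  simp [entryProb]
  ring

theorem log_one_sub_sq_le {e : ℝ} (he0 : 0 ≤ e) (he : e ≤ 1 / 2) :
    -(2 * e) ≤ Real.log (1 - e) ∧ Real.log (1 - e) ≤ 0 := by
  have h1 : 0 < 1 - e := by linarith
  constructor
  · have h2 := Real.one_sub_inv_le_log_of_pos h1
    have h3 : (1 - e)⁻¹ ≤ 1 + 2 * e := by
      rw [inv_le_iff_one_le_mul₀ h1]
      nlinarith
    linarith
  · exact Real.log_nonpos h1.le (by linarith)

/-- On an edge the common factor `L` cancels in the ratio, which leaves a constant weighted by at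
most `A * L`; without an edge both logarithms are of order `A * L`. The total over `n` pairs is of
order `log n`, so `T` may be of order `√(log n)`. -/
theorem sum_sqrt_edgeLaw_mul_sq_le {a b L A Λ : ℝ} (hL : 0 < L) (ha : 0 < a) (hb : 0 < b)
    (haA : a ≤ A) (hbA : b ≤ A) (hA : A * L ≤ 1 / 2)
    (hΛ : (Real.log a - Real.log b) ^ 2 ≤ Λ) :
    ∑ k, √(edgeLaw q (a * L) k * edgeLaw q (b * L) k) *
      (Real.log (edgeLaw q (a * L) k) - Real.log (edgeLaw q (b * L) k)) ^ 2 ≤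
      4 * (A * L) ^ 2 + A * L * Λ := by
  have hq := two_le_cast_prime (q := q)
  have hq0 : (q : ℝ) ≠ 0 := by linarith
  have haL : a * L ≤ A * L := mul_le_mul_of_nonneg_right haA hL.le
  have hbL : b * L ≤ A * L := mul_le_mul_of_nonneg_right hbA hL.le
  have haL0 : 0 < a * L := mul_pos ha hL
  have hbL0 : 0 < b * L := mul_pos hb hL
  have hAL0 : 0 < A * L := haL0.trans_le haL
  rw [Fintype.sum_option]
  refine add_le_add ?_ ?_
  · simp only [edgeLaw]
    obtain ⟨h1, h2⟩ := log_one_sub_sq_le haL0.le (haL.trans hA)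
    obtain ⟨h3, h4⟩ := log_one_sub_sq_le hbL0.le (hbL.trans hA)
    have h5 : √((1 - a * L) * (1 - b * L)) ≤ 1 := by
      rw [Real.sqrt_le_left zero_le_one]
      nlinarith
    have h6 : (Real.log (1 - a * L) - Real.log (1 - b * L)) ^ 2 ≤ (2 * (A * L)) ^ 2 :=
      sq_le_sq' (by linarith) (by linarith)
    calc _ ≤ 1 * (2 * (A * L)) ^ 2 := mul_le_mul h5 h6 (sq_nonneg _) zero_le_one
      _ = _ := by ring
  · simp only [edgeLaw]
    have h1 : √(a * L / q * (b * L / q)) ≤ A * L / q := by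
      rw [Real.sqrt_le_left (by positivity), sq]
      gcongr
    have h2 : Real.log (a * L / q) - Real.log (b * L / q) = Real.log a - Real.log b := by
      rw [Real.log_div haL0.ne' hq0, Real.log_div hbL0.ne' hq0, Real.log_mul ha.ne' hL.ne',
        Real.log_mul hb.ne' hL.ne']
      ring
    rw [h2]
    simp only [Finset.sum_const, Finset.card_univ, ZMod.card, nsmul_eq_mul]
    calc (q : ℝ) * (√(a * L / q * (b * L / q)) * (Real.log a - Real.log b) ^ 2)
        ≤ q * (A * L / q * Λ) := by gcongr
      _ = A * L * Λ := by field_simp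

end Variances

/-! ### The lower bound for one exchange in exponential form -/

section ProductWeights

open scoped Classical

variable {ι κ : Type*} [Fintype ι] [DecidableEq ι] [Fintype κ]

/-- Lower bound for the probability that the second of two exchangeable product weights is at
least as large as the first. -/
theorem exp_div_two_le_sum_ite (f g : ι → κ → ℝ) (hf : ∀ i k, 0 ≤ f i k)
    (hg : ∀ i k, 0 ≤ g i k) (e : Equiv.Perm ι) (σ : ι → Equiv.Perm κ)
    (hfg : ∀ i k, f i (σ i k) = g (e i) k) (hgf : ∀ i k, g i (σ i k) = f (e i) k)
    {y : ι → ℝ} {ξ Y W T : ℝ} (hξ0 : 0 ≤ ξ) (hξ1 : ξ ≤ 1) (hy0 : ∀ i, 0 ≤ y i)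
    (hyξ : ∀ i, y i * (1 + ξ) ≤ ξ) (hb : ∀ i, 1 - y i ≤ bhatt f g i) (hY : ∑ i, y i ≤ Y)
    (hW : ∑ i, ∑ k, √(f i k * g i k) * llr f g i k ^ 2 ≤ W) (hT : 0 < T) (hWT : 2 * W ≤ T ^ 2) :
    Real.exp (-((1 + ξ) * Y) - T / 2) / 2 ≤
      ∑ w : ι → κ, (if ∏ i, f i (w i) ≤ ∏ i, g i (w i) then ∏ i, f i (w i) else 0) := by
  have hy2 : ∀ i, y i ≤ 1 / 2 := fun i => by
    have h1 := hyξ i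
    have h2 := hy0 i
    by_contra hcon
    push Not at hcon
    have h3 : 1 / 2 * (1 + ξ) < y i * (1 + ξ) := by
      apply mul_lt_mul_of_pos_right hcon; linarith
    linarith
  have hb2 : ∀ i, 1 / 2 ≤ bhatt f g i := fun i => by linarith [hb i, hy2 i]
  have hV : ∑ i, (∑ k, √(f i k * g i k) * llr f g i k ^ 2) / bhatt f g i ≤ T ^ 2 := by
    refine le_trans (Finset.sum_le_sum fun i _ => ?_)
      ((Finset.mul_sum _ _ _).symm.le.trans ((mul_le_mul_of_nonneg_left hW zero_le_two).trans hWT))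
    have h0 : 0 ≤ ∑ k, √(f i k * g i k) * llr f g i k ^ 2 :=
      Finset.sum_nonneg fun k _ => by positivity
    rw [div_le_iff₀ (by linarith [hb2 i])]
    have h1 := mul_le_mul_of_nonneg_left (hb2 i) h0
    linarith
  refine le_trans ?_ (half_bhatt_le_sum_ite f g hf hg (fun i => by linarith [hb2 i]) e σ hfg hgf
    hT hV)
  have h1 : Real.exp (-((1 + ξ) * Y)) ≤ ∏ i, bhatt f g i := by
    calc Real.exp (-((1 + ξ) * Y)) ≤ Real.exp (∑ i, -((1 + ξ) * y i)) := by
          rw [Finset.sum_neg_distrib, ← Finset.mul_sum]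
          apply Real.exp_le_exp.2
          have := mul_le_mul_of_nonneg_left hY (by linarith : 0 ≤ 1 + ξ)
          linarith
      _ = ∏ i, Real.exp (-((1 + ξ) * y i)) := Real.exp_sum _ _
      _ ≤ ∏ i, bhatt f g i := Finset.prod_le_prod (fun i _ => (Real.exp_pos _).le) fun i _ =>
          (exp_neg_le_one_sub (hy0 i) hξ0 (hyξ i)).trans (hb i)
  rw [sub_eq_add_neg, Real.exp_add, neg_div]
  gcongr

theorem prod_eq_prod_comp_mul {J : Type*} [Fintype J] {e : J → ι} (he : Function.Injective e)
    (F : ι → ℝ) :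
    ∏ i, F i = (∏ j, F (e j)) * ∏ i ∈ Finset.univ.filter (· ∉ Set.range e), F i := by
  rw [← Finset.prod_filter_mul_prod_filter_not Finset.univ (· ∈ Set.range e)]
  congr 1
  rw [← Finset.prod_image (s := Finset.univ) (g := e) (f := F) fun _ _ _ _ h => he h]
  refine Finset.prod_congr ?_ fun _ _ => rfl
  ext i
  simp

end ProductWeights

/-! ### Exchanging two users -/

noncomputable section UserBlocks

open scoped Classical

variable {q c g r n m : ℕ}

/-- The ground truth in which two users have exchanged their groups. -/
def Instance.swapUsers (M : Instance q c g r n m) (a b : Fin n) : Instance q c g r n m :=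
  ⟨M.basis, M.part ∘ Equiv.swap a b⟩

/-- The ratings of a user, and its pairs with the users outside of `U`. -/
def blockCoord (m : ℕ) (U : Finset (Fin n)) (a : Fin n) : Fin m ⊕ {b // b ∉ U} → Coord n m
  | .inl j => .inl (a, j)
  | .inr b => .inr s(a, b.1)

/-- The law of the coordinates of a user of group `u`. -/
def blockLaw (P : Model q c g r) (p : ℝ) (M : Instance q c g r n m) (U : Finset (Fin n))
    (u : Fin c × Fin g) : Fin m ⊕ {b // b ∉ U} → Option (ZMod q) → ℝ
  | .inl j => entryProb p P.θ (M.row P u j)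
  | .inr b => edgeLaw q (edgeProb P n u (M.part b.1))

theorem law_blockCoord (P : Model q c g r) (p : ℝ) (M : Instance q c g r n m)
    (U : Finset (Fin n)) (a : Fin n) (j : Fin m ⊕ {b // b ∉ U}) :
    law P p M (blockCoord m U a j) = blockLaw P p M U (M.part a) j := by
  rcases j with j | b <;> rfl

theorem law_swapUsers_blockCoord (P : Model q c g r) (p : ℝ) (M : Instance q c g r n m)
    {U : Finset (Fin n)} {a b x : Fin n} (ha : a ∈ U) (hb : b ∈ U)
    (j : Fin m ⊕ {b // b ∉ U}) :
    law P p (M.swapUsers a b) (blockCoord m U x j) =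
      blockLaw P p M U (M.part (Equiv.swap a b x)) j := by
  rcases j with j | ⟨y, hy⟩
  · rfl
  · have h1 : Equiv.swap a b y = y :=
      Equiv.swap_apply_of_ne_of_ne (fun h => hy (h ▸ ha)) (fun h => hy (h ▸ hb))
    simp [law, blockCoord, blockLaw, pairProb, Instance.swapUsers, h1]

/-- A pair in a block has exactly one member in `U`, so the blocks of different users of `U` are
disjoint and hence independent. -/
theorem blockCoord_injective (m : ℕ) (U : Finset (Fin n)) :
    Function.Injective fun x : {a // a ∈ U} × (Fin m ⊕ {b // b ∉ U}) =>
      blockCoord m U x.1.1 x.2 := by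
  rintro ⟨⟨a, ha⟩, j | ⟨b, hb⟩⟩ ⟨⟨a', ha'⟩, j' | ⟨b', hb'⟩⟩ h
  · simpa [blockCoord] using h
  · simp [blockCoord] at h
  · simp [blockCoord] at h
  · simp only [blockCoord, Sum.inr.injEq, Sym2.eq_iff] at h
    rcases h with ⟨rfl, rfl⟩ | ⟨rfl, rfl⟩
    · rfl
    · exact absurd ha hb'

/-- Two users may be exchanged if each of them looks like a member of the group of the other one,
as far as its own ratings and its pairs with the users outside of `U` are concerned, and if both
have no neighbours in `U`. -/
theorem prod_law_le_swapUsers (P : Model q c g r) {p : ℝ} {M : Instance q c g r n m}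
    (h0 : ∀ i k, 0 ≤ law P p M i k)
    {U : Finset (Fin n)} {a b : Fin n} (ha : a ∈ U) (hb : b ∈ U) (hab : a ≠ b)
    {w : Coord n m → Option (ZMod q)} (hwa : ∀ y ∈ U, w (.inr s(a, y)) = none)
    (hwb : ∀ y ∈ U, w (.inr s(b, y)) = none)
    (hSa : ∏ j, blockLaw P p M U (M.part a) j (w (blockCoord m U a j)) ≤
      ∏ j, blockLaw P p M U (M.part b) j (w (blockCoord m U a j)))
    (hSb : ∏ j, blockLaw P p M U (M.part b) j (w (blockCoord m U b j)) ≤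
      ∏ j, blockLaw P p M U (M.part a) j (w (blockCoord m U b j))) :
    ∏ i, law P p M i (w i) ≤ ∏ i, law P p (M.swapUsers a b) i (w i) := by
  set J := Fin m ⊕ {b // b ∉ U} with hJ
  set e : J ⊕ J → Coord n m := Sum.elim (blockCoord m U a) (blockCoord m U b) with he
  have hinj := blockCoord_injective m U
  have hbc : ∀ {x y : Fin n} (_ : x ∈ U) (_ : y ∈ U) {j j' : J},
      blockCoord m U x j = blockCoord m U y j' → x = y ∧ j = j' := by
    intro x y hx hy j j' h
    have := @hinj (⟨x, hx⟩, j) (⟨y, hy⟩, j') h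
    simpa using this
  have hei : Function.Injective e := by
    rintro (j | j) (j' | j') h
    · exact congrArg _ (hbc ha ha h).2
    · exact absurd (hbc ha hb h).1 hab
    · exact absurd (hbc hb ha h).1 hab.symm
    · exact congrArg _ (hbc hb hb h).2
  set σ := Equiv.swap a b with hσ
  have hσU : ∀ y, y ∉ U → σ y = y := fun y hy =>
    Equiv.swap_apply_of_ne_of_ne (fun h => hy (h ▸ ha)) (fun h => hy (h ▸ hb))
  have hσσ : Function.Involutive (Sym2.map σ) := fun x => by
    induction x using Sym2.ind with
    | _ x y => simp [hσ]
  -- Moving pairs of users along the transposition carries the laws of the pairs under `M` to those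
  -- under the swapped ground truth. Outside the two blocks the outcome is invariant as well, so the
  -- remaining factors agree.
  let ε : Coord n m ≃ Coord n m := (Equiv.refl _).sumCongr (Function.Involutive.toPerm _ hσσ)
  have hεl : ∀ x, ε (.inl x) = .inl x := fun x => rfl
  have hεr : ∀ x y, ε (.inr s(x, y)) = .inr s(σ x, σ y) := fun x y => rfl
  have hεε : ∀ i, ε (ε i) = i := by
    rintro (x | x)
    · rfl
    · induction x using Sym2.ind with
      | _ x y => rw [hεr, hεr, hσ, Equiv.swap_apply_self, Equiv.swap_apply_self]
  have hεe : ∀ i, i ∈ Set.range e → ε i ∈ Set.range e := by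
    rintro _ ⟨(j | ⟨y, hy⟩) | (j | ⟨y, hy⟩), rfl⟩
    · exact ⟨.inl (.inl j), rfl⟩
    · refine ⟨.inr (.inr ⟨y, hy⟩), ?_⟩
      simp only [he, Sum.elim_inl, Sum.elim_inr, blockCoord, hεr, hσU y hy]
      rw [hσ, Equiv.swap_apply_left]
    · exact ⟨.inr (.inl j), rfl⟩
    · refine ⟨.inl (.inr ⟨y, hy⟩), ?_⟩
      simp only [he, Sum.elim_inl, Sum.elim_inr, blockCoord, hεr, hσU y hy]
      rw [hσ, Equiv.swap_apply_right]
  have hsum : ∀ F : Coord n m → ℝ, ∏ x, F (e x) =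
      (∏ j, F (blockCoord m U a j)) * ∏ j, F (blockCoord m U b j) := fun F =>
    Fintype.prod_sum_type _
  rw [prod_eq_prod_comp_mul hei, prod_eq_prod_comp_mul hei,
    hsum fun i => law P p M i (w i), hsum fun i => law P p (M.swapUsers a b) i (w i)]
  have hrest : ∏ i ∈ Finset.univ.filter (· ∉ Set.range e), law P p M i (w i) =
      ∏ i ∈ Finset.univ.filter (· ∉ Set.range e), law P p (M.swapUsers a b) i (w i) := by
    refine Finset.prod_equiv ε ?_ ?_
    · intro i
      simp only [Finset.mem_filter, Finset.mem_univ, true_and, not_iff_not]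
      exact ⟨hεe i, fun h => by have := hεe _ h; rwa [hεε] at this⟩
    · intro i hi
      simp only [Finset.mem_filter, Finset.mem_univ, true_and] at hi
      rcases i with ⟨x, j⟩ | x
      · have hx : σ x = x := by
          refine Equiv.swap_apply_of_ne_of_ne ?_ ?_
          · rintro rfl; exact hi ⟨.inl (.inl j), rfl⟩
          · rintro rfl; exact hi ⟨.inr (.inl j), rfl⟩
        rw [hεl]
        simp only [law, Instance.mat, Instance.swapUsers, Function.comp, ← hσ, hx]
        rfl
      · induction x using Sym2.ind with
        | _ x y =>
          rw [hεr]
          have hl : law P p (M.swapUsers a b) (.inr s(σ x, σ y)) = law P p M (.inr s(x, y)) := by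
            simp [law, pairProb, Instance.swapUsers, hσ]
          -- A remaining pair that meets `{a, b}` lies inside `U`, and so does its image. Both carry
          -- `none` by isolation.
          have hU : ∀ {x y : Fin n}, (.inr s(x, y) : Coord n m) ∉ Set.range e → x = a ∨ x = b →
              w (.inr s(x, y)) = none ∧ w (.inr s(σ x, σ y)) = none := by
            intro x y hi hx
            have hy : y ∈ U := by
              by_contra hy
              rcases hx with rfl | rfl
              · exact hi ⟨.inl (.inr ⟨y, hy⟩), rfl⟩
              · exact hi ⟨.inr (.inr ⟨y, hy⟩), rfl⟩
            have hσy : σ y ∈ U := by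
              rw [hσ, Equiv.swap_apply_def]
              split_ifs <;> assumption
            rcases hx with rfl | rfl
            · refine ⟨hwa y hy, ?_⟩
              rw [hσ, Equiv.swap_apply_left]
              exact hwb _ hσy
            · refine ⟨hwb y hy, ?_⟩
              rw [hσ, Equiv.swap_apply_right]
              exact hwa _ hσy
          have hw : w (.inr s(x, y)) = w (.inr s(σ x, σ y)) := by
            by_cases hx : x = a ∨ x = b
            · rw [(hU hi hx).1, (hU hi hx).2]
            · by_cases hy : y = a ∨ y = b
              · rw [Sym2.eq_swap, Sym2.eq_swap (a := σ x)]
                rw [Sym2.eq_swap] at hi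
                rw [(hU hi hy).1, (hU hi hy).2]
              · push Not at hx hy
                rw [hσ, Equiv.swap_apply_of_ne_of_ne hx.1 hx.2,
                  Equiv.swap_apply_of_ne_of_ne hy.1 hy.2]
          rw [hl, hw]
  rw [hrest]
  refine mul_le_mul_of_nonneg_right ?_ (hrest ▸ Finset.prod_nonneg fun i _ => h0 _ _)
  simp only [law_blockCoord,
    law_swapUsers_blockCoord P p M ha hb, Equiv.swap_apply_left, Equiv.swap_apply_right]
  refine mul_le_mul hSa hSb (Finset.prod_nonneg fun j _ => ?_)
    (le_trans (Finset.prod_nonneg fun j _ => ?_) hSa)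
  · rw [← law_blockCoord]; exact h0 _ _
  · rw [← law_blockCoord]; exact h0 _ _

end UserBlocks

/-! ### Finding two users that can be exchanged -/

noncomputable section Selection

open scoped Classical

variable {q c g r n m : ℕ} [Fact q.Prime]

/-- The pairs of `a` and of `b` with the members of `U`. -/
def isolationCoords (m : ℕ) (U : Finset (Fin n)) (a b : Fin n) : Finset (Coord n m) :=
  U.image (fun y => .inr s(a, y)) ∪ U.image (fun y => .inr s(b, y))

theorem blockCoord_notMem_isolationCoords {U : Finset (Fin n)} {a b : Fin n} (ha : a ∈ U)
    (hb : b ∈ U) (x : Fin n) (j : Fin m ⊕ {b // b ∉ U}) :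
    blockCoord m U x j ∉ isolationCoords m U a b := by
  rcases j with j | ⟨z, hz⟩
  · simp [blockCoord, isolationCoords]
  · simp only [blockCoord, isolationCoords, Finset.mem_union, Finset.mem_image, Sum.inr.injEq,
      Sym2.eq_iff, not_or, not_exists, not_and]
    constructor
    · exact fun y hy => ⟨fun _ h => hz (h ▸ hy), fun h _ => hz (h ▸ ha)⟩
    · exact fun y hy => ⟨fun _ h => hz (h ▸ hy), fun h _ => hz (h ▸ hb)⟩

theorem card_isolationCoords_le (U : Finset (Fin n)) (a b : Fin n) :
    (isolationCoords m U a b).card ≤ 2 * U.card := by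
  refine (Finset.card_union_le _ _).trans ?_
  have h1 := Finset.card_image_le (s := U) (f := fun y => (.inr s(a, y) : Coord n m))
  have h2 := Finset.card_image_le (s := U) (f := fun y => (.inr s(b, y) : Coord n m))
  omega

/-- The probability that a set of pairs has no edge. -/
theorem one_sub_le_prod_law_none (P : Model q c g r) {p : ℝ} (M : Instance q c g r n m) {ℓ : ℝ}
    (hℓ1 : ℓ ≤ 1) (hℓ : ∀ e, pairProb P M.part e ≤ ℓ) {U : Finset (Fin n)} (a b : Fin n)
    (hℓ0 : 0 ≤ ℓ) :
    1 - 2 * U.card * ℓ ≤ ∏ i ∈ isolationCoords m U a b,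
      ∑ k, if k = none then law P p M i k else 0 := by
  have h1 : ∀ i ∈ isolationCoords m U a b, 1 - ℓ ≤ ∑ k, if k = none then law P p M i k else 0 := by
    intro i hi
    rw [Finset.sum_ite_eq' Finset.univ none, if_pos (Finset.mem_univ _)]
    simp only [isolationCoords, Finset.mem_union, Finset.mem_image] at hi
    rcases hi with ⟨y, _, rfl⟩ | ⟨y, _, rfl⟩ <;>
    · simp only [law, edgeLaw]
      linarith [hℓ s(a, y), hℓ s(b, y)]
  have hcard : ((isolationCoords m U a b).card : ℝ) ≤ 2 * U.card := by
    exact_mod_cast card_isolationCoords_le U a b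
  calc 1 - 2 * U.card * ℓ ≤ 1 + (isolationCoords m U a b).card * (-ℓ) := by
        have := mul_le_mul_of_nonneg_right hcard hℓ0
        linarith
    _ ≤ (1 + -ℓ) ^ (isolationCoords m U a b).card := one_add_mul_le_pow (by linarith) _
    _ = ∏ i ∈ isolationCoords m U a b, (1 - ℓ) := by rw [Finset.prod_const]; ring
    _ ≤ _ := Finset.prod_le_prod (fun i _ => by linarith) h1

/-- If a user of group `s` looks like a member of group `t` with probability at least `π`, and
vice versa, then it is likely that two of them can be exchanged. -/
theorem mul_le_sum_ite_swapUsers (P : Model q c g r) {p : ℝ} {M : Instance q c g r n m}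
    (h0 : ∀ i k, 0 ≤ law P p M i k)
    {s t : Fin c × Fin g} (hst : s ≠ t) {Us Ut : Finset (Fin n)} (hUs : ∀ a ∈ Us, M.part a = s)
    (hUt : ∀ a ∈ Ut, M.part a = t) {ℓ π : ℝ} (hℓ0 : 0 ≤ ℓ) (hℓ1 : ℓ ≤ 1)
    (hℓ : ∀ e, pairProb P M.part e ≤ ℓ) (hℓU : 2 * (Us ∪ Ut).card * ℓ ≤ 1)
    (hπs : π ≤ ∑ u : _ → Option (ZMod q), if ∏ j, blockLaw P p M (Us ∪ Ut) s j (u j) ≤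
      ∏ j, blockLaw P p M (Us ∪ Ut) t j (u j) then ∏ j, blockLaw P p M (Us ∪ Ut) s j (u j) else 0)
    (hπt : π ≤ ∑ u : _ → Option (ZMod q), if ∏ j, blockLaw P p M (Us ∪ Ut) t j (u j) ≤
      ∏ j, blockLaw P p M (Us ∪ Ut) s j (u j) then ∏ j, blockLaw P p M (Us ∪ Ut) t j (u j) else 0) :
    (1 - Real.exp (-(π * Us.card)) - Real.exp (-(π * Ut.card))) *
        (1 - 2 * (Us ∪ Ut).card * ℓ) ≤
      ∑ w : Coord n m → Option (ZMod q), if ∃ a b, M.part a = s ∧ M.part b = t ∧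
        ∏ i, law P p M i (w i) ≤ ∏ i, law P p (M.swapUsers a b) i (w i) then
          ∏ i, law P p M i (w i) else 0 := by
  set U := Us ∪ Ut with hU
  set A := {a // a ∈ U} with hA
  set J := Fin m ⊕ {b // b ∉ U} with hJ
  set emb : A × J → Coord n m := fun x => blockCoord m U x.1.1 x.2 with hemb
  have hinj : Function.Injective emb := blockCoord_injective m U
  set f : A → J → Option (ZMod q) → ℝ := fun a j => law P p M (emb (a, j)) with hf
  set Sab : Fin c × Fin g → Fin c × Fin g → (J → Option (ZMod q)) → Prop := fun s t u =>
    ∏ j, blockLaw P p M U s j (u j) ≤ ∏ j, blockLaw P p M U t j (u j) with hSab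
  have hfb : ∀ (a : A) j, f a j = blockLaw P p M U (M.part a) j := fun a j =>
    law_blockCoord P p M U a.1 j
  -- the bound for a single group
  have hnone : ∀ (V : Finset (Fin n)) (_ : V ⊆ U) (s t : Fin c × Fin g)
      (_ : ∀ a ∈ V, M.part a = s) (_ : π ≤ ∑ u, if Sab s t u then
        ∏ j, blockLaw P p M U s j (u j) else 0),
      ∑ u : A × J → Option (ZMod q), (if ∀ a : A, a.1 ∈ V → ¬ Sab s t (fun j => u (a, j)) then
        ∏ x, law P p M (emb x) (u x) else 0) ≤ Real.exp (-(π * V.card)) := by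
    intro V hVU s t hV hπ
    have h := sum_blocks_ite_forall_not_le f (fun a j k => h0 _ _) (fun a j => sum_law P p M _)
      (fun _ => Sab s t) (V.subtype (· ∈ U)) (t := π) (fun a ha => by
        rw [Finset.mem_subtype] at ha
        refine hπ.trans (le_of_eq (Finset.sum_congr rfl fun u _ => ?_))
        simp_rw [hfb, hV a.1 ha]
        congr)
    rw [Finset.card_subtype, Finset.filter_true_of_mem fun x hx => hVU hx] at h
    refine le_trans (le_of_eq (Finset.sum_congr rfl fun u _ => ?_)) h
    simp only [hf]
    congr! 1
    exact ⟨fun h a ha => h a (Finset.mem_subtype.1 ha), fun h a ha => h a (Finset.mem_subtype.2 ha)⟩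
  set Good : (A × J → Option (ZMod q)) → A × A → Prop := fun u ab =>
    M.part ab.1 = s ∧ M.part ab.2 = t ∧ Sab s t (fun j => u (ab.1, j)) ∧
      Sab t s (fun j => u (ab.2, j)) with hGood
  -- Choosing one good pair makes the events for different pairs disjoint. The choice depends only
  -- on the block coordinates, so it is independent of the isolation of the chosen users, and no
  -- union bound over pairs is needed.
  set sel : (A × J → Option (ZMod q)) → Option (A × A) := fun u =>
    if h : ∃ ab, Good u ab then some h.choose else none with hsel
  have hsel1 : ∀ u ab, sel u = some ab → Good u ab := by
    intro u ab h
    simp only [hsel] at h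
    split_ifs at h with h'
    rw [← Option.some.inj h]
    exact h'.choose_spec
  have hsel2 : ∀ u, sel u = none → ¬ ∃ ab, Good u ab := by
    intro u h
    simp only [hsel] at h
    split_ifs at h with h'
    exact h'
  -- pointwise comparison
  have hpt : ∀ w : Coord n m → Option (ZMod q),
      ∑ ab : A × A, (if sel (w ∘ emb) = some ab then (1 : ℝ) else 0) *
        (if ∀ i ∈ isolationCoords m U ab.1.1 ab.2.1, w i = none then
          ∏ i, law P p M i (w i) else 0) ≤
      if ∃ a b, M.part a = s ∧ M.part b = t ∧
        ∏ i, law P p M i (w i) ≤ ∏ i, law P p (M.swapUsers a b) i (w i) then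
          ∏ i, law P p M i (w i) else 0 := by
    intro w
    have hw0 : 0 ≤ ∏ i, law P p M i (w i) := Finset.prod_nonneg fun i _ => h0 _ _
    rcases hs : sel (w ∘ emb) with _ | ⟨a, b⟩
    · simp only [reduceCtorEq, if_false, zero_mul, Finset.sum_const_zero]
      split_ifs <;> first | exact hw0 | exact le_rfl
    · rw [Finset.sum_eq_single (a, b)]
      · rw [if_pos rfl, one_mul]
        by_cases hiso : ∀ i ∈ isolationCoords m U a.1 b.1, w i = none
        · rw [if_pos hiso, if_pos]
          obtain ⟨ha, hb, hSa, hSb⟩ := hsel1 _ _ hs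
          refine ⟨a.1, b.1, ha, hb, prod_law_le_swapUsers P h0 a.2 b.2
            (fun h => hst (by rw [← ha, ← hb]; exact congrArg _ h)) ?_ ?_ ?_ ?_⟩
          · exact fun y hy => hiso _ (Finset.mem_union_left _
              (Finset.mem_image.2 ⟨y, hy, rfl⟩))
          · exact fun y hy => hiso _ (Finset.mem_union_right _
              (Finset.mem_image.2 ⟨y, hy, rfl⟩))
          · rw [ha, hb]; exact hSa
          · rw [ha, hb]; exact hSb
        · rw [if_neg hiso]
          split_ifs <;> first | exact hw0 | exact le_rfl
      · intro ab _ hab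
        rw [if_neg fun h => hab (Option.some.inj h).symm, zero_mul]
      · simp
  refine le_trans ?_ (Finset.sum_le_sum fun w _ => hpt w)
  rw [Finset.sum_comm]
  have hY0 : 0 ≤ 1 - 2 * (U.card : ℝ) * ℓ := by linarith
  have hμ0 : ∀ u : A × J → Option (ZMod q), 0 ≤ ∏ x, law P p M (emb x) (u x) := fun u =>
    Finset.prod_nonneg fun x _ => h0 _ _
  have hpair : ∀ ab : A × A,
      (∑ u : A × J → Option (ZMod q), (if sel u = some ab then (1 : ℝ) else 0) *
        ∏ x, law P p M (emb x) (u x)) * (1 - 2 * (U.card : ℝ) * ℓ) ≤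
      ∑ w : Coord n m → Option (ZMod q), (if sel (w ∘ emb) = some ab then (1 : ℝ) else 0) *
        (if ∀ i ∈ isolationCoords m U ab.1.1 ab.2.1, w i = none then
          ∏ i, law P p M i (w i) else 0) := by
    intro ab
    have h := sum_comp_mul_ite (law P p M) (sum_law P p M) emb hinj
      (fun u => if sel u = some ab then (1 : ℝ) else 0) (isolationCoords m U ab.1.1 ab.2.1)
      (fun x => blockCoord_notMem_isolationCoords ab.1.2 ab.2.2 _ _) (· = none)
    refine le_trans ?_ (h.symm.le.trans (le_of_eq (Finset.sum_congr rfl fun w _ => by congr!)))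
    refine mul_le_mul_of_nonneg_left
      ((one_sub_le_prod_law_none P M hℓ1 hℓ _ _ hℓ0).trans (le_of_eq (by congr!)))
      (Finset.sum_nonneg fun u _ => mul_nonneg ?_ (hμ0 u))
    split_ifs <;> norm_num
  refine le_trans ?_ (Finset.sum_le_sum fun ab _ => hpair ab)
  rw [← Finset.sum_mul]
  refine mul_le_mul_of_nonneg_right ?_ hY0
  rw [Finset.sum_comm]
  have htot : ∑ u : A × J → Option (ZMod q), ∏ x, law P p M (emb x) (u x) = 1 := by
    rw [sum_prod_apply fun x => law P p M (emb x)]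
    exact Finset.prod_eq_one fun x _ => sum_law P p M _
  have h1 := hnone Us Finset.subset_union_left s t hUs hπs
  have h2 := hnone Ut Finset.subset_union_right t s hUt hπt
  refine le_trans (sub_le_sub (sub_le_sub htot.symm.le h1) h2) ?_
  rw [← Finset.sum_sub_distrib, ← Finset.sum_sub_distrib]
  refine Finset.sum_le_sum fun u _ => ?_
  rcases hs : sel u with _ | ab
  · simp only [reduceCtorEq, if_false, zero_mul, Finset.sum_const_zero]
    have hno := hsel2 u hs
    by_cases hA1 : ∀ a : A, a.1 ∈ Us → ¬ Sab s t (fun j => u (a, j))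
    · rw [if_pos hA1]
      split_ifs <;> linarith [hμ0 u]
    · rw [if_neg hA1, if_pos, sub_zero, sub_self]
      intro b hb hSb
      push Not at hA1
      obtain ⟨a, ha, hSa⟩ := hA1
      exact hno ⟨(a, b), hUs _ ha, hUt _ hb, hSa, hSb⟩
  · rw [Finset.sum_eq_single ab]
    · rw [if_pos rfl, one_mul]
      split_ifs <;> linarith [hμ0 u]
    · intro x _ hx
      rw [if_neg fun h => hx (Option.some.inj h).symm, zero_mul]
    · simp

end Selection

/-! ### The probability that a user looks like a member of another group -/

noncomputable section BlockProbability

open scoped Classical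

variable {q c g r n m : ℕ}

theorem edgeConst_mem (P : Model q c g r) (hγβ : P.γ ≤ P.β) (hβα : P.β ≤ P.α)
    (s t : Fin c × Fin g) : edgeConst P s t ∈ Set.Icc P.γ P.α := by
  unfold edgeConst
  split_ifs <;> constructor <;> linarith

theorem graphInfo_comm (P : Model q c g r) (s t : Fin c × Fin g) :
    graphInfo P s t = graphInfo P t s := by
  unfold graphInfo
  congr 1
  exact Finset.sum_congr rfl fun u _ => by rw [← neg_sub, neg_sq]

/-- The users outside of `U` can be permuted in a way that realizes a relabelling. -/
theorem exists_perm_part_eq {S : Type*} {τ : Fin n → S} {N : ℕ}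
    (hτ : ∀ u, (Finset.univ.filter fun a => τ a = u).card = N) {s t : S} (hst : s ≠ t)
    {Us Ut : Finset (Fin n)} (hUs : ∀ a ∈ Us, τ a = s) (hUt : ∀ a ∈ Ut, τ a = t)
    (hcard : Us.card = Ut.card) {κ : Equiv.Perm S} (hκs : κ s = t) (hκt : κ t = s) :
    ∃ ρ : Equiv.Perm {b // b ∉ Us ∪ Ut}, ∀ b, τ (ρ b).1 = κ (τ b.1) := by
  set U := Us ∪ Ut with hU
  have h1 : ∀ u, Fintype.card {b : {b // b ∉ U} // τ b.1 = u} + (U.filter fun a => τ a = u).card =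
      N := by
    intro u
    rw [← hτ u, Fintype.card_subtype, ← Finset.card_map (Function.Embedding.subtype (· ∉ U)),
      ← Finset.card_union_of_disjoint]
    · congr 1
      ext a
      simp only [Finset.mem_union, Finset.mem_map, Finset.mem_filter, Finset.mem_univ, true_and,
        Function.Embedding.subtype_apply, Subtype.exists, exists_and_right, exists_eq_right]
      constructor
      · rintro (⟨_, h⟩ | ⟨_, h⟩) <;> exact h
      · intro h
        by_cases ha : a ∈ U
        · exact .inr ⟨ha, h⟩
        · exact .inl ⟨ha, h⟩
    · rw [Finset.disjoint_left]
      simp only [Finset.mem_map, Finset.mem_filter, Finset.mem_univ, true_and,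
        Function.Embedding.subtype_apply, Subtype.exists, exists_and_right, exists_eq_right]
      rintro a ⟨ha, _⟩ ⟨ha', _⟩
      exact ha ha'
  have hfs : (U.filter fun a => τ a = s) = Us := by
    ext a
    simp only [hU, Finset.mem_filter, Finset.mem_union]
    refine ⟨?_, fun h => ⟨.inl h, hUs a h⟩⟩
    rintro ⟨h | h, h'⟩
    · exact h
    · exact absurd (h'.symm.trans (hUt a h)) hst
  have hft : (U.filter fun a => τ a = t) = Ut := by
    ext a
    simp only [hU, Finset.mem_filter, Finset.mem_union]
    refine ⟨?_, fun h => ⟨.inr h, hUt a h⟩⟩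
    rintro ⟨h | h, h'⟩
    · exact absurd ((hUs a h).symm.trans h') hst
    · exact h
  have hfo : ∀ u, u ≠ s → u ≠ t → (U.filter fun a => τ a = u) = ∅ := by
    intro u hs ht
    refine Finset.filter_eq_empty_iff.2 fun {a} ha h => ?_
    rcases Finset.mem_union.1 ha with ha | ha
    · exact hs (h.symm.trans (hUs a ha))
    · exact ht (h.symm.trans (hUt a ha))
  -- Only the classes of `s` and `t` meet `U`, equally often, and `κ` exchanges them. The classes
  -- outside `U` thus keep matching sizes under `κ`.
  have h2 : ∀ u, (U.filter fun a => τ a = u).card = (U.filter fun a => τ a = κ u).card := by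
    intro u
    by_cases hs : u = s
    · rw [hs, hκs, hfs, hft, hcard]
    · by_cases ht : u = t
      · rw [ht, hκt, hfs, hft, hcard]
      · rw [hfo u hs ht, hfo (κ u) (fun h => ht (κ.injective (h.trans hκt.symm)))
          (fun h => hs (κ.injective (h.trans hκs.symm)))]
  have h3 : ∀ u, Nonempty ({b : {b // b ∉ U} // κ (τ b.1) = u} ≃ {b : {b // b ∉ U} // τ b.1 = u}) := by
    intro u
    obtain ⟨v, rfl⟩ := κ.surjective u
    refine ⟨Fintype.equivOfCardEq ?_⟩
    have h4 : Fintype.card {b : {b // b ∉ U} // κ (τ b.1) = κ v} =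
        Fintype.card {b : {b // b ∉ U} // τ b.1 = v} :=
      Fintype.card_congr (Equiv.subtypeEquivRight fun b => by simp)
    rw [h4]
    have := h1 v
    have := h1 (κ v)
    have := h2 v
    omega
  let e := fun u => (h3 u).some
  exact ⟨Equiv.ofFiberEquiv e, fun b => Equiv.ofFiberEquiv_map e b⟩

/-- The noise is symmetric in the wrong symbols, so a transposition of the alphabet exchanges the
two laws; this is the alphabet permutation required by `exp_div_two_le_sum_ite`. -/
theorem entryProb_swap (p θ : ℝ) (u v : ZMod q) (k : Option (ZMod q)) :
    entryProb p θ u (Equiv.swap (some u) (some v) k) = entryProb p θ v k := by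
  rcases k with _ | y
  · rw [Equiv.swap_apply_of_ne_of_ne (by simp) (by simp)]
    rfl
  · by_cases hu : y = u
    · rw [hu, Equiv.swap_apply_left]
      simp only [entryProb, eq_comm]
    · by_cases hv : y = v
      · rw [hv, Equiv.swap_apply_right]
        simp [entryProb]
      · rw [Equiv.swap_apply_of_ne_of_ne (by simpa using hu) (by simpa using hv)]
        simp [entryProb, hu, hv]

theorem cast_hammingDist_eq_sum {ι K : Type*} [Fintype ι] [DecidableEq K] (a b : ι → K) :
    (hammingDist a b : ℝ) = ∑ j, if a j = b j then 0 else 1 := by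
  rw [hammingDist, Finset.card_filter]
  push_cast
  exact Finset.sum_congr rfl fun j _ => by by_cases h : a j = b j <;> simp [h]

variable [Fact q.Prime]

/-- A lower bound for the probability that a user of group `s` looks like one of group `t`. -/
theorem exp_le_sum_ite_blockLaw (P : Model q c g r) (hγ : 0 < P.γ) (hγβ : P.γ ≤ P.β)
    (hβα : P.β ≤ P.α) (hθ0 : 0 ≤ P.θ) (hθ1 : P.θ < 1) {p : ℝ} (hp : p ∈ Set.Icc (0 : ℝ) 1)
    {M : Instance q c g r n m} {N : ℕ}
    (hτ : ∀ u, (Finset.univ.filter fun a => M.part a = u).card = N) {s t : Fin c × Fin g}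
    {U : Finset (Fin n)} {κ : Equiv.Perm (Fin c × Fin g)}
    (hκ : ∀ u, edgeConst P s (κ u) = edgeConst P t u ∧ edgeConst P t (κ u) = edgeConst P s u)
    (ρ : Equiv.Perm {b // b ∉ U}) (hρ : ∀ b, M.part (ρ b).1 = κ (M.part b.1)) {L ξ Y W T : ℝ}
    (hL : L = Real.log n / n) (hL0 : 0 < L) (hαL : P.α * L ≤ 1 / 2) (hξ0 : 0 ≤ ξ) (hξ1 : ξ ≤ 1)
    (hxξ : p * entryInfo q P.θ * (1 + ξ) ≤ ξ) (hLξ : 2 * (P.α * L) * (1 + ξ) ≤ ξ)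
    (hY : p * entryInfo q P.θ * hammingDist (M.row P s) (M.row P t) + N * L * graphInfo P s t +
      n * (2 * (P.α * L) ^ 2) ≤ Y)
    (hW : p * entryVar q P.θ * hammingDist (M.row P s) (M.row P t) +
      n * (4 * (P.α * L) ^ 2 + P.α * L * (Real.log P.α - Real.log P.γ) ^ 2) ≤ W)
    (hT : 0 < T) (hWT : 2 * W ≤ T ^ 2) :
    Real.exp (-((1 + ξ) * Y) - T / 2) / 2 ≤
      ∑ u : _ → Option (ZMod q), if ∏ j, blockLaw P p M U s j (u j) ≤ ∏ j, blockLaw P p M U t j (u j)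
        then ∏ j, blockLaw P p M U s j (u j) else 0 := by
  have hα : 0 < P.α := by linarith
  have hθ : P.θ ∈ Set.Icc (0 : ℝ) 1 := ⟨hθ0, hθ1.le⟩
  have hep : ∀ u v, edgeProb P n u v = edgeConst P u v * L := fun u v => by
    rw [hL]
    exact edgeProb_eq_of_le P hγβ hβα (by rw [← hL]; linarith) u v
  have hec := edgeConst_mem P hγβ hβα
  have hec0 : ∀ u v, 0 < edgeConst P u v := fun u v => hγ.trans_le (hec u v).1
  have hecL : ∀ u v, edgeConst P u v * L ∈ Set.Icc (0 : ℝ) (P.α * L) := fun u v =>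
    ⟨(mul_pos (hec0 u v) hL0).le, mul_le_mul_of_nonneg_right (hec u v).2 hL0.le⟩
  have hαL0 : 0 < P.α * L := mul_pos hα hL0
  have hecL1 : ∀ u v, edgeConst P u v * L ∈ Set.Icc (0 : ℝ) 1 := fun u v =>
    ⟨(hecL u v).1, by linarith [(hecL u v).2]⟩
  have hnn : ∀ u j k, 0 ≤ blockLaw P p M U u j k := by
    rintro u (j | b) k
    · exact entryProb_nonneg hp hθ _ _
    · exact edgeLaw_nonneg (by rw [hep]; exact hecL1 _ _) _
  set x := p * entryInfo q P.θ with hx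
  have hx0 : 0 ≤ x := mul_nonneg hp.1 (by unfold entryInfo; positivity)
  set D : Fin c × Fin g → ℝ := fun u => (√(edgeConst P s u) - √(edgeConst P t u)) ^ 2 / 2 with hD
  have hD0 : ∀ u, 0 ≤ D u := fun u => by simp only [hD]; positivity
  have hDα : ∀ u, D u ≤ P.α := by
    intro u
    have h1 := Real.sqrt_nonneg (edgeConst P s u)
    have h2 := Real.sqrt_nonneg (edgeConst P t u)
    have h3 := Real.sq_sqrt (hec0 s u).le
    have h4 := Real.sq_sqrt (hec0 t u).le
    have h5 := mul_nonneg h1 h2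
    simp only [hD]
    linarith [(hec s u).2, (hec t u).2, sub_sq (√(edgeConst P s u)) (√(edgeConst P t u))]
  have hfib : ∀ (h : Fin c × Fin g → ℝ), (∀ u, 0 ≤ h u) →
      ∑ b : {b // b ∉ U}, h (M.part b.1) ≤ N * ∑ u, h u := by
    intro h hh
    calc ∑ b : {b // b ∉ U}, h (M.part b.1)
        ≤ ∑ b, h (M.part b) := by
          rw [← Finset.sum_subtype (Finset.univ.filter (· ∉ U)) (fun x => by simp)
            fun b => h (M.part b)]
          exact Finset.sum_le_sum_of_subset_of_nonneg (Finset.subset_univ _) fun b _ _ => hh _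
      _ = ∑ b, ∑ u, (if M.part b = u then h u else 0) :=
          Finset.sum_congr rfl fun b _ => by simp
      _ = N * ∑ u, h u := by
          rw [Finset.sum_comm, Finset.mul_sum]
          exact Finset.sum_congr rfl fun u _ => sum_ite_eq_card M.part (by simpa using hτ) u _
  have hconst : ∀ y : ℝ, 0 ≤ y → ∑ b : {b // b ∉ U}, y ≤ n * y := by
    intro y hy
    rw [Finset.sum_const, nsmul_eq_mul]
    refine mul_le_mul_of_nonneg_right ?_ hy
    have := Fintype.card_subtype_le (fun b => b ∉ U)
    rw [Fintype.card_fin] at this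
    exact_mod_cast this
  -- The symmetry transposes the two candidate values in each entry and moves the pairs along `ρ`,
  -- which realizes the exchange of `s` and `t` in the edge constants.
  refine exp_div_two_le_sum_ite (blockLaw P p M U s) (blockLaw P p M U t) (hnn s) (hnn t)
    ((Equiv.refl _).sumCongr ρ)
    (Sum.elim (fun j => Equiv.swap (some (M.row P s j)) (some (M.row P t j))) fun _ => Equiv.refl _)
    ?_ ?_
    (y := Sum.elim (fun j => if M.row P s j = M.row P t j then 0 else x)
      fun b => D (M.part b.1) * L + 2 * (P.α * L) ^ 2) hξ0 hξ1 ?_ ?_ ?_ (le_trans ?_ hY)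
      (le_trans ?_ hW) hT hWT
  · rintro (j | b) k
    · exact entryProb_swap _ _ _ _ _
    · simp only [blockLaw, Sum.elim_inr, Equiv.sumCongr_apply, Sum.map_inr, Equiv.refl_apply, hep, hρ,
        (hκ _).2]
  · rintro (j | b) k
    · simp only [blockLaw, Sum.elim_inl, Equiv.sumCongr_apply, Sum.map_inl, Equiv.refl_apply]
      rw [Equiv.swap_comm, entryProb_swap]
    · simp only [blockLaw, Sum.elim_inr, Equiv.sumCongr_apply, Sum.map_inr, Equiv.refl_apply, hep, hρ,
        (hκ _).1]
  · rintro (j | b)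
    · simp only [Sum.elim_inl]
      split_ifs
      · exact le_rfl
      · exact hx0
    · exact add_nonneg (mul_nonneg (hD0 _) hL0.le) (by positivity)
  · rintro (j | b)
    · simp only [Sum.elim_inl]
      split_ifs
      · rw [zero_mul]; exact hξ0
      · exact hxξ
    · refine le_trans (mul_le_mul_of_nonneg_right ?_ (by linarith)) hLξ
      have h1 := mul_le_mul_of_nonneg_right (hDα (M.part b.1)) hL0.le
      have h2 : (P.α * L) ^ 2 ≤ P.α * L * (1 / 2) := by
        rw [sq]; exact mul_le_mul_of_nonneg_left hαL hαL0.le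
      simp only [Sum.elim_inr]
      linarith
  · rintro (j | b)
    · simp only [Sum.elim_inl, bhatt, blockLaw]
      split_ifs with h
      · rw [h, sum_sqrt_entryProb_self hp hθ, sub_zero]
      · rw [sum_sqrt_entryProb hp hθ h]
    · simp only [Sum.elim_inr, bhatt, blockLaw, hep]
      refine le_trans ?_ (sum_sqrt_edgeLaw_ge (hecL1 _ _) (hecL1 _ _))
      have h1 := pow_le_pow_left₀ (hecL s (M.part b.1)).1 (hecL s (M.part b.1)).2 2
      have h2 := pow_le_pow_left₀ (hecL t (M.part b.1)).1 (hecL t (M.part b.1)).2 2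
      have h3 : (√(edgeConst P s (M.part b.1) * L) - √(edgeConst P t (M.part b.1) * L)) ^ 2 / 2 =
          D (M.part b.1) * L := by
        rw [Real.sqrt_mul (hec0 _ _).le, Real.sqrt_mul (hec0 _ _).le, ← sub_mul, mul_pow,
          Real.sq_sqrt hL0.le]
        simp only [hD]
        ring
      linarith
  · rw [Fintype.sum_sum_type]
    simp only [Sum.elim_inl, Sum.elim_inr]
    have h1 : ∑ j, (if M.row P s j = M.row P t j then 0 else x) =
        x * hammingDist (M.row P s) (M.row P t) := by
      rw [cast_hammingDist_eq_sum, Finset.mul_sum]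
      exact Finset.sum_congr rfl fun j _ => by split_ifs <;> simp
    have h2 := mul_le_mul_of_nonneg_right (hfib D hD0) hL0.le
    have h3 : ∑ u, D u = graphInfo P s t := by
      simp only [hD, graphInfo]
      rw [Finset.sum_div]
    rw [h3] at h2
    have h4 := hconst (2 * (P.α * L) ^ 2) (by positivity)
    rw [h1, Finset.sum_add_distrib, ← Finset.sum_mul]
    linarith
  · rw [Fintype.sum_sum_type]
    have h1 : ∀ j : Fin m, ∑ k, √(blockLaw P p M U s (.inl j) k * blockLaw P p M U t (.inl j) k) *
        llr (blockLaw P p M U s) (blockLaw P p M U t) (.inl j) k ^ 2 =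
        p * entryVar q P.θ * if M.row P s j = M.row P t j then 0 else 1 := by
      intro j
      simp only [llr, blockLaw]
      split_ifs with h
      · simp [h]
      · rw [sum_sqrt_entryProb_mul_sq hp hθ0 hθ1 h, mul_one]
    have h2 : ∀ b : {b // b ∉ U},
        ∑ k, √(blockLaw P p M U s (.inr b) k * blockLaw P p M U t (.inr b) k) *
        llr (blockLaw P p M U s) (blockLaw P p M U t) (.inr b) k ^ 2 ≤
        4 * (P.α * L) ^ 2 + P.α * L * (Real.log P.α - Real.log P.γ) ^ 2 := by
      intro b
      simp only [llr, blockLaw, hep]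
      refine sum_sqrt_edgeLaw_mul_sq_le hL0 (hec0 _ _) (hec0 _ _) (hec _ _).2 (hec _ _).2 hαL ?_
      have hl : ∀ u v, Real.log P.γ ≤ Real.log (edgeConst P u v) ∧
          Real.log (edgeConst P u v) ≤ Real.log P.α := fun u v =>
        ⟨Real.log_le_log hγ (hec u v).1, Real.log_le_log (hec0 u v) (hec u v).2⟩
      refine sq_le_sq' ?_ ?_ <;>
        linarith [(hl s (M.part b.1)).1, (hl s (M.part b.1)).2, (hl t (M.part b.1)).1,
          (hl t (M.part b.1)).2]
    refine add_le_add ?_ ?_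
    · rw [cast_hammingDist_eq_sum, Finset.mul_sum]
      exact Finset.sum_le_sum fun j _ => (h1 j).le
    · exact (Finset.sum_le_sum fun b _ => h2 b).trans (hconst _ (by positivity))

end BlockProbability

/-! ### The converse from confusions of users -/

noncomputable section UserConverse

open scoped Classical

variable {q c g r n m : ℕ}

theorem mem_matSet_of_basis_eq {P : Model q c g r} {δg δc : ℝ} {M X : Instance q c g r n m}
    (hM : M ∈ matSet P n m δg δc) (hb : X.basis = M.basis)
    (hX : ∀ x i, c * g * (Finset.univ.filter fun a => X.part a = (x, i)).card = n) :
    X ∈ matSet P n m δg δc := by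
  have hv : X.vec P = M.vec P := by
    funext x i
    simp only [Instance.vec, hb]
  refine ⟨⟨by rw [hb]; exact hM.1.1, fun x i => by convert hX x i⟩, ?_, ?_⟩
  · have := hM.2.1
    simp only [Instance.intraDistances] at this ⊢
    rwa [hv]
  · have := hM.2.2
    simp only [Instance.interDistances] at this ⊢
    rwa [hv]

theorem card_swapUsers (M : Instance q c g r n m) (a b : Fin n) (u : Fin c × Fin g) :
    (Finset.univ.filter fun x => (M.swapUsers a b).part x = u).card =
      (Finset.univ.filter fun x => M.part x = u).card :=
  Finset.card_equiv (Equiv.swap a b) fun x => by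
    simp only [Finset.mem_filter, Finset.mem_univ, true_and]
    rfl

theorem exp_neg_three_le : Real.exp (-3) ≤ 1 / 8 := by
  rw [Real.exp_neg, ← one_div]
  have h1 : (2 : ℝ) ≤ Real.exp 1 := by linarith [Real.add_one_le_exp (1 : ℝ)]
  have h2 : Real.exp 3 = Real.exp 1 ^ 3 := by rw [← Real.exp_nat_mul]; norm_num
  have h3 := pow_le_pow_left₀ (by norm_num) h1 3
  rw [h2]
  exact one_div_le_one_div_of_le (by norm_num) (by linarith)

/-- With margin `ε`, a single exchange has probability at least `exp (-(1 - ε/2) ℓ)`: the factor `1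
+ ε/4`, the quadratic errors `b`, the tilt `T` and the division by 2 together use less than `ε ℓ /
2`. Having `exp ((1 - ε/4) ℓ) / 2` candidates then gives an expected number above 3. It serves users
with `ℓ = log n` and columns with `ℓ = log m`. -/
theorem three_le_exp_div_two_mul {ε ℓ C b x : ℝ} (hε : 0 < ε) (hε1 : ε ≤ 1) (hℓ0 : 0 < ℓ)
    (hb0 : 0 ≤ b) (hb : 64 * b ≤ ε) (hC : 2 * C ≤ (ε / 8) ^ 2 * ℓ)
    (h2 : Real.log 2 ≤ ε / 16 * ℓ) (h11 : 11 ≤ ε / 4 * ℓ)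
    (hx : Real.exp ((1 - ε / 4) * ℓ) / 2 ≤ x) :
    3 ≤ Real.exp (-((1 + ε / 4) * ((1 - ε) * ℓ + 2 * (b * ℓ))) - √(2 * (C * ℓ)) / 2) / 2 * x := by
  have hT : √(2 * (C * ℓ)) ≤ ε / 8 * ℓ := by
    refine Real.sqrt_le_iff.2 ⟨by positivity, ?_⟩
    have := mul_le_mul_of_nonneg_right hC hℓ0.le
    linarith
  have hY : (1 + ε / 4) * ((1 - ε) * ℓ + 2 * (b * ℓ)) ≤ (1 - 3 * ε / 4 + ε / 16) * ℓ := by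
    have h1 : (1 + ε / 4) * (1 - ε) ≤ 1 - 3 * ε / 4 := by nlinarith
    have h3 : (1 + ε / 4) * (2 * b) ≤ 2 * (2 * b) :=
      mul_le_mul_of_nonneg_right (by linarith) (by positivity)
    have h4 : (1 + ε / 4) * (1 - ε) + (1 + ε / 4) * (2 * b) ≤ 1 - 3 * ε / 4 + ε / 16 := by linarith
    have h5 := mul_le_mul_of_nonneg_right h4 hℓ0.le
    linarith
  have h3 : Real.exp (-((1 - ε / 2) * ℓ)) ≤
      Real.exp (-((1 + ε / 4) * ((1 - ε) * ℓ + 2 * (b * ℓ))) - √(2 * (C * ℓ)) / 2) / 2 := by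
    rw [le_div_iff₀ two_pos]
    nth_rewrite 2 [← Real.exp_log (two_pos : (0 : ℝ) < 2)]
    rw [← Real.exp_add]
    refine Real.exp_le_exp.2 ?_
    linarith
  calc (3 : ℝ) ≤ Real.exp (ε / 4 * ℓ) / 2 := by linarith [Real.add_one_le_exp (ε / 4 * ℓ)]
    _ = Real.exp (-((1 - ε / 2) * ℓ)) * (Real.exp ((1 - ε / 4) * ℓ) / 2) := by
        rw [← mul_div_assoc, ← Real.exp_add]; ring_nf
    _ ≤ _ := mul_le_mul h3 hx (by positivity) (by positivity)

variable [Fact q.Prime]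

/-- Lower bound for the worst-case error from the confusion of users of two groups. -/
theorem le_worstError_of_users (P : Model q c g r) (hγ : 0 < P.γ) (hγβ : P.γ ≤ P.β)
    (hβα : P.β ≤ P.α) (hθ0 : 0 ≤ P.θ) (hθ1 : P.θ < 1) {p : ℝ} (hp : p ∈ Set.Icc (0 : ℝ) 1)
    {δg δc : ℝ} {M₀ : Instance q c g r n m} (hM₀ : M₀ ∈ matSet P n m δg δc) (hcg : 0 < c * g)
    (hrow : ∀ u v, u ≠ v → M₀.row P u ≠ M₀.row P v) {s t : Fin c × Fin g} (hst : s ≠ t)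
    {L ξ Y W T : ℝ} {Tu : ℕ} (hTu : Tu ≤ n / (c * g))
    (hL : L = Real.log n / n) (hL0 : 0 < L) (hαL : P.α * L ≤ 1 / 2) (hξ0 : 0 ≤ ξ) (hξ1 : ξ ≤ 1)
    (hxξ : p * entryInfo q P.θ * (1 + ξ) ≤ ξ) (hLξ : 2 * (P.α * L) * (1 + ξ) ≤ ξ)
    (hY : p * entryInfo q P.θ * hammingDist (M₀.row P s) (M₀.row P t) +
      (n / (c * g) : ℕ) * L * graphInfo P s t + n * (2 * (P.α * L) ^ 2) ≤ Y)
    (hW : p * entryVar q P.θ * hammingDist (M₀.row P s) (M₀.row P t) +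
      n * (4 * (P.α * L) ^ 2 + P.α * L * (Real.log P.α - Real.log P.γ) ^ 2) ≤ W)
    (hT : 0 < T) (hWT : 2 * W ≤ T ^ 2) (hTuL : 4 * Tu * (P.α * L) ≤ 1 / 4)
    (hbig : 3 ≤ Real.exp (-((1 + ξ) * Y) - T / 2) / 2 * Tu) (ψ : Estimator q n m) :
    1 / 4 ≤ worstError P p δg δc ψ := by
  have hα : 0 < P.α := by linarith
  have hβ : 0 < P.β := by linarith
  have hθ : P.θ ∈ Set.Icc (0 : ℝ) 1 := ⟨hθ0, hθ1.le⟩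
  have hαL0 : 0 < P.α * L := mul_pos hα hL0
  set N := n / (c * g) with hN
  -- All balanced labellings with the given basis: the family is closed under exchanges of users,
  -- and the distances of the rating vectors are constant on it.
  set F : Finset (Instance q c g r n m) := Finset.univ.filter fun X =>
    X.basis = M₀.basis ∧ ∀ u, (Finset.univ.filter fun a => X.part a = u).card = N with hF
  have hM₀F : M₀ ∈ F := by
    simp only [hF, Finset.mem_filter, Finset.mem_univ, true_and]
    exact fun u => by convert card_group_eq hM₀.1 hcg u
  have hcgN : c * g * N = n := by
    have := mul_div_card_eq hM₀.1 hcg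
    exact_mod_cast this
  have hrowF : ∀ X ∈ F, ∀ u, X.row P u = M₀.row P u := by
    intro X hX u
    simp only [hF, Finset.mem_filter] at hX
    simp only [Instance.row, Instance.vec, hX.2.1]
  have key := half_le_worstError (δg := δg) (δc := δc) P hα.le hβ.le hγ.le hp hθ ψ F ⟨M₀, hM₀F⟩ ?_ ?_ (κ := 1 / 2) ?_
  · linarith
  · intro X hX
    simp only [hF, Finset.mem_filter] at hX
    exact mem_matSet_of_basis_eq hM₀ hX.2.1 fun x i => by rw [hX.2.2, hcgN]
  · intro X hX X' hX' h
    have hpart : X.part = X'.part := by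
      funext a
      by_contra hne
      refine hrow _ _ hne ?_
      rw [← hrowF X hX, ← hrowF X' hX']
      exact congrFun h a
    simp only [hF, Finset.mem_filter] at hX hX'
    have hb := hX.2.1.trans hX'.2.1.symm
    cases X; cases X'; simp_all
  · intro M hM
    have hMr := hrowF M hM
    have hMF := hM
    simp only [hF, Finset.mem_filter, Finset.mem_univ, true_and] at hM
    obtain ⟨Us, hUs, hUsc⟩ := Finset.exists_subset_card_eq (hTu.trans (hM.2 s).ge)
    obtain ⟨Ut, hUt, hUtc⟩ := Finset.exists_subset_card_eq (hTu.trans (hM.2 t).ge)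
    have hUs' : ∀ a ∈ Us, M.part a = s := fun a ha => (Finset.mem_filter.1 (hUs ha)).2
    have hUt' : ∀ a ∈ Ut, M.part a = t := fun a ha => (Finset.mem_filter.1 (hUt ha)).2
    obtain ⟨κ, hκs, hκt, hκ⟩ := exists_perm_edgeConst P s t
    obtain ⟨ρ, hρ⟩ := exists_perm_part_eq (N := N) (fun u => by convert hM.2 u) hst hUs' hUt' (hUsc.trans hUtc.symm) hκs hκt
    have hcardU : ((Us ∪ Ut).card : ℝ) ≤ 2 * Tu := by
      have := Finset.card_union_le Us Ut
      rw [hUsc, hUtc, ← two_mul] at this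
      exact_mod_cast this
    have hℓ : ∀ e, pairProb P M.part e ≤ P.α * L := by
      intro e
      induction e using Sym2.ind with
      | _ a b =>
        change edgeProb P n _ _ ≤ _
        rw [edgeProb_eq_of_le P hγβ hβα (by rw [← hL]; linarith), ← hL]
        exact mul_le_mul_of_nonneg_right (edgeConst_mem P hγβ hβα _ _).2 hL0.le
    have hU4 : 2 * ((Us ∪ Ut).card : ℝ) * (P.α * L) ≤ 1 / 4 := by
      refine le_trans (mul_le_mul_of_nonneg_right ?_ hαL0.le) hTuL
      linarith
    have hsel := mul_le_sum_ite_swapUsers P (law_nonneg P hα.le hβ.le hγ.le hp hθ M) hst hUs' hUt'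
      hαL0.le (by linarith) hℓ (by linarith)
      (π := Real.exp (-((1 + ξ) * Y) - T / 2) / 2)
      (exp_le_sum_ite_blockLaw P hγ hγβ hβα hθ0 hθ1 hp hM.2 hκ ρ hρ hL hL0 hαL hξ0 hξ1 hxξ hLξ
        (by rwa [hMr, hMr]) (by rwa [hMr, hMr]) hT hWT)
      (exp_le_sum_ite_blockLaw P hγ hγβ hβα hθ0 hθ1 hp hM.2 (fun u => (hκ u).symm) ρ hρ hL hL0 hαL
        hξ0 hξ1 hxξ hLξ (by rwa [hMr, hMr, hammingDist_comm, graphInfo_comm])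
        (by rwa [hMr, hMr, hammingDist_comm]) hT hWT)
    have hexp' : Real.exp (-(Real.exp (-((1 + ξ) * Y) - T / 2) / 2 * Tu)) ≤ 1 / 8 :=
      (Real.exp_le_exp.2 (by linarith)).trans exp_neg_three_le
    rw [hUsc, hUtc] at hsel
    have hhalf : (1 / 2 : ℝ) ≤ (1 - Real.exp (-(Real.exp (-((1 + ξ) * Y) - T / 2) / 2 * Tu)) -
        Real.exp (-(Real.exp (-((1 + ξ) * Y) - T / 2) / 2 * Tu))) *
        (1 - 2 * (Us ∪ Ut).card * (P.α * L)) := by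
      -- Two failure probabilities of at most `1 / 8` each for finding candidates, and at most `1 /
      -- 4` for lack of isolation.
      calc (1 / 2 : ℝ) ≤ 3 / 4 * (3 / 4) := by norm_num
        _ ≤ _ := mul_le_mul (by linarith) (by linarith) (by norm_num) (by linarith)
    refine hhalf.trans (hsel.trans (Finset.sum_le_sum fun w _ => ?_))
    have hw0 : 0 ≤ ∏ i, law P p M i (w i) :=
      Finset.prod_nonneg fun i _ => law_nonneg P hα.le hβ.le hγ.le hp hθ M _ _
    by_cases hE : ∃ a b, M.part a = s ∧ M.part b = t ∧
        ∏ i, law P p M i (w i) ≤ ∏ i, law P p (M.swapUsers a b) i (w i)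
    · rw [if_pos hE, if_pos]
      obtain ⟨a, b, ha, hb, hle⟩ := hE
      refine ⟨M.swapUsers a b, ?_, ?_, hle⟩
      · simp only [hF, Finset.mem_filter, Finset.mem_univ, true_and]
        exact ⟨hM.1, fun u => by rw [card_swapUsers]; exact hM.2 u⟩
      · intro h
        have h1 := congrFun (congrArg Instance.part h) a
        simp only [Instance.swapUsers, Function.comp, Equiv.swap_apply_left] at h1
        exact hst (by rw [← ha, ← hb, h1])
    · rw [if_neg hE]
      split_ifs <;> first | exact hw0 | exact le_rfl

/-- Below the threshold of the confusion of two groups, no estimator succeeds. -/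
theorem eventually_le_worstError_of_users (P : Model q c g r) (hγ : 0 < P.γ) (hγβ : P.γ ≤ P.β)
    (hβα : P.β ≤ P.α) (hθ0 : 0 ≤ P.θ) (hθ1 : P.θ < ((q : ℝ) - 1) / q) {n m : ℕ → ℕ}
    (hn : Tendsto n atTop atTop)
    (hm : (fun k => Real.log (n k)) =o[atTop] (fun k => (m k : ℝ)))
    {δ₀ ε : ℝ} (hδ₀ : 0 < δ₀) (hε : 0 < ε) (hε1 : ε ≤ 1) :
    ∀ᶠ k in atTop, ∀ (p δg δc : ℝ) (M₀ : Instance q c g r (n k) (m k)) (s t : Fin c × Fin g),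
      p ∈ Set.Icc (0 : ℝ) 1 → M₀ ∈ matSet P (n k) (m k) δg δc → s ≠ t →
      (∀ u v, u ≠ v → δ₀ * m k ≤ hammingDist (M₀.row P u) (M₀.row P v)) →
      p * entryInfo q P.θ * hammingDist (M₀.row P s) (M₀.row P t) +
        graphInfo P s t / (c * g : ℕ) * Real.log (n k) ≤ (1 - ε) * Real.log (n k) →
      ∀ ψ : Estimator q (n k) (m k), 1 / 4 ≤ worstError P p δg δc ψ := by
  have hα : 0 < P.α := by linarith
  have hθ1' : P.θ < 1 := theta_lt_one hθ1
  have hI := entryInfo_pos hθ0 hθ1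
  set ξ := ε / 4 with hξ
  have hξ0 : 0 < ξ := by positivity
  set K := c * g with hK
  set Λ := (Real.log P.α - Real.log P.γ) ^ 2 with hΛ
  set C := entryVar q P.θ / entryInfo q P.θ + 2 * P.α + P.α * Λ with hC
  have hC0 : 0 < C := by
    have := div_nonneg (entryVar_nonneg q P.θ) hI.le
    have : 0 ≤ P.α * Λ := mul_nonneg hα.le (sq_nonneg _)
    positivity
  have hlog := tendsto_log_of_tendsto hn
  have hLt := tendsto_log_div hn
  have hLe : ∀ a : ℝ, 0 < a → ∀ᶠ k in atTop, Real.log (n k) / n k ≤ a := fun a ha =>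
    hLt.eventually_le_const ha
  have hexp : ∀ a b : ℝ, 0 < a → 0 < b → ∀ᶠ k in atTop, Real.exp (-(b * Real.log (n k))) ≤ a :=
    fun a b ha hb => (tendsto_exp_neg_mul hlog hb).eventually_le_const ha
  have hmt := tendsto_atTop_of_log_isLittleO hn hm
  filter_upwards [hn.eventually_ge_atTop 2, hmt.eventually_ge_atTop 1,
    hLe (1 / (2 * P.α)) (by positivity), hLe (ξ / (4 * P.α)) (by positivity),
    hLe (ε / (64 * P.α ^ 2)) (by positivity),
    hm.def (show 0 < ξ * δ₀ / 2 by positivity),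
    eventually_le_mul_of_tendsto hlog (show 0 < (ε / 8) ^ 2 by positivity) (2 * C),
    eventually_le_mul_of_tendsto hlog (show 0 < ε / 16 by positivity) (Real.log 2),
    eventually_le_mul_of_tendsto hlog (show 0 < ε / 4 by positivity) 11,
    hexp (ε / (128 * P.α)) (ε / 8) (by positivity) (by positivity),
    hexp (1 / (K + 1)) (ε / 4) (by positivity) (by positivity)] with k hn2 hm1 hL1 hL2 hL3 hmk hl1 hl2
    hl3 he1 he2
  intro p δg δc M₀ s t hp hM₀ hst hdist hcond ψ
  have hcg : 0 < K := Nat.mul_pos (Fin.pos s.1) (Fin.pos s.2)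
  have hK0 : (0 : ℝ) < K := by exact_mod_cast hcg
  have hn0 : (0 : ℝ) < n k := by exact_mod_cast (by omega : 0 < n k)
  have hm0 : (0 : ℝ) < m k := by exact_mod_cast (by omega : 0 < m k)
  set ℓ := Real.log (n k) with hℓ
  have hℓ0 : 0 < ℓ := Real.log_pos (by exact_mod_cast (by omega : 1 < n k))
  set L := ℓ / n k with hL
  have hL0 : 0 < L := div_pos hℓ0 hn0
  have hnL : n k * L = ℓ := by rw [hL]; field_simp
  set x := p * entryInfo q P.θ with hx
  have hx0 : 0 ≤ x := mul_nonneg hp.1 hI.le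
  set d := (hammingDist (M₀.row P s) (M₀.row P t) : ℝ) with hd
  have hJ := graphInfo_nonneg P s t
  have hJK : 0 ≤ graphInfo P s t / K := div_nonneg hJ hK0.le
  have hxd : x * d ≤ ℓ := by
    have h1 := mul_nonneg hJK hℓ0.le
    have h2 := mul_nonneg hε.le hℓ0.le
    linarith
  have hNK : (K : ℝ) * (n k / K : ℕ) = n k := mul_div_card_eq hM₀.1 hcg
  set N := n k / K with hN
  have hNL : (N : ℝ) * L = ℓ / K := by
    rw [eq_div_iff hK0.ne', ← hnL, ← hNK]
    ring
  rw [le_div_iff₀ (by positivity)] at hL1 hL2 hL3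
  have hαL0 : 0 < P.α * L := mul_pos hα hL0
  have hαL : P.α * L ≤ 1 / 2 := by linarith
  have hL3' : 64 * (P.α ^ 2 * L) ≤ ε := by linarith
  have hquad : n k * (P.α * L) ^ 2 = P.α ^ 2 * L * ℓ := by rw [← hnL]; ring
  have hnexp : Real.exp ℓ = n k := Real.exp_log hn0
  -- About `n^(1 - ε/4)` users per group: enough to beat the probability `n^(-(1 - ε/2))` of a
  -- single success, and few enough that two selected users probably have no neighbours among them.
  set Tu := ⌊Real.exp ((1 - ε / 4) * ℓ)⌋₊ with hTu
  have hTu1 : (Tu : ℝ) ≤ Real.exp ((1 - ε / 4) * ℓ) := Nat.floor_le (Real.exp_pos _).le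
  have hTu2 : Real.exp ((1 - ε / 4) * ℓ) / 2 ≤ Tu := by
    have h1 : 1 ≤ Real.exp ((1 - ε / 4) * ℓ) :=
      Real.one_le_exp (mul_nonneg (by linarith) hℓ0.le)
    have h2 : 1 ≤ Tu := Nat.le_floor (by simpa using h1)
    have h3 : (1 : ℝ) ≤ Tu := by exact_mod_cast h2
    have h4 := Nat.lt_floor_add_one (Real.exp ((1 - ε / 4) * ℓ))
    rw [← hTu] at h4
    linarith
  have hTun : Real.exp ((1 - ε / 4) * ℓ) = n k * Real.exp (-(ε / 4 * ℓ)) := by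
    rw [← hnexp, ← Real.exp_add]; ring_nf
  refine le_worstError_of_users P hγ hγβ hβα hθ0 hθ1' hp hM₀ hcg ?_ hst
    (L := L) (ξ := ξ) (Y := (1 - ε) * ℓ + 2 * (P.α ^ 2 * L * ℓ)) (W := C * ℓ) (T := √(2 * (C * ℓ)))
    (Tu := Tu) ?_ hL hL0 hαL hξ0.le (by linarith) ?_ ?_ ?_ ?_ ?_ ?_ ?_ ?_ ψ
  · intro u v huv h
    have := hdist u v huv
    rw [h, hammingDist_self, Nat.cast_zero] at this
    exact absurd this (not_le.2 (mul_pos hδ₀ hm0))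
  · have h1 : (Tu : ℝ) ≤ N := by
      rw [hTun] at hTu1
      refine hTu1.trans ?_
      have h2 : Real.exp (-(ε / 4 * ℓ)) ≤ 1 / K :=
        he2.trans (one_div_le_one_div_of_le hK0 (by linarith))
      calc (n k : ℝ) * Real.exp (-(ε / 4 * ℓ)) ≤ n k * (1 / K) :=
            mul_le_mul_of_nonneg_left h2 hn0.le
        _ = N := by rw [← hNK]; field_simp
    exact_mod_cast h1
  -- As `log n = o(m)` and the distances are at least `δ₀ m`, being below the threshold forces `p I`
  -- to be small.
  · have h1 : ℓ ≤ ξ * δ₀ / 2 * m k := by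
      rw [Real.norm_eq_abs, Real.norm_eq_abs, Nat.abs_cast] at hmk
      exact (le_abs_self _).trans hmk
    have h2 : x * (δ₀ * m k) ≤ ξ / 2 * (δ₀ * m k) := by
      have h3 := mul_le_mul_of_nonneg_left (hdist s t hst) hx0
      linarith
    have h3 := le_of_mul_le_mul_right h2 (mul_pos hδ₀ hm0)
    have h4 : x * (1 + ξ) ≤ ξ / 2 * (1 + ξ) := mul_le_mul_of_nonneg_right h3 (by linarith)
    have h5 : ξ / 2 * (1 + ξ) ≤ ξ / 2 * 2 := mul_le_mul_of_nonneg_left (by linarith) (by linarith)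
    linarith
  · have h1 : 2 * (P.α * L) * (1 + ξ) ≤ 2 * (P.α * L) * 2 :=
      mul_le_mul_of_nonneg_left (by linarith) (by linarith)
    linarith
  · have h1 : (N : ℝ) * L * graphInfo P s t = graphInfo P s t / K * ℓ := by rw [hNL]; ring
    have h2 : n k * (2 * (P.α * L) ^ 2) = 2 * (P.α ^ 2 * L * ℓ) := by rw [← hquad]; ring
    rw [h1, h2]
    linarith
  · have h1 : p * entryVar q P.θ * d = entryVar q P.θ / entryInfo q P.θ * (x * d) := by
      rw [hx]; field_simp
    have h2 : entryVar q P.θ / entryInfo q P.θ * (x * d) ≤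
        entryVar q P.θ / entryInfo q P.θ * ℓ :=
      mul_le_mul_of_nonneg_left hxd (div_nonneg (entryVar_nonneg q P.θ) hI.le)
    have h3 : n k * (4 * (P.α * L) ^ 2 + P.α * L * Λ) =
        4 * (P.α * (P.α * L)) * ℓ + P.α * Λ * ℓ := by
      rw [mul_add, mul_left_comm, hquad, ← hnL]; ring
    have h4 : 4 * (P.α * (P.α * L)) * ℓ ≤ 2 * P.α * ℓ := by
      refine mul_le_mul_of_nonneg_right ?_ hℓ0.le
      have := mul_le_mul_of_nonneg_left hαL hα.le
      linarith
    rw [h1, h3, hC]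
    linarith
  · exact Real.sqrt_pos.2 (by positivity)
  · rw [Real.sq_sqrt (by positivity)]
  · have h1 : 4 * (Tu : ℝ) * (P.α * L) ≤ 4 * (n k * Real.exp (-(ε / 4 * ℓ))) * (P.α * L) := by
      rw [← hTun]
      exact mul_le_mul_of_nonneg_right (by linarith) hαL0.le
    -- Half of the decay absorbs the factor `log n`, the other half makes the product small.
    have h2 : 4 * (n k * Real.exp (-(ε / 4 * ℓ))) * (P.α * L) =
        4 * P.α * ((ℓ * Real.exp (-(ε / 8 * ℓ))) * Real.exp (-(ε / 8 * ℓ))) := by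
      rw [mul_assoc ℓ, ← Real.exp_add, ← hnL]; ring_nf
    have h3 : ℓ * Real.exp (-(ε / 8 * ℓ)) ≤ 8 / ε := by
      have h4 := Real.add_one_le_exp (ε / 8 * ℓ)
      rw [Real.exp_neg, ← div_eq_mul_inv, div_le_div_iff₀ (Real.exp_pos _) hε]
      linarith
    have h4 : (ℓ * Real.exp (-(ε / 8 * ℓ))) * Real.exp (-(ε / 8 * ℓ)) ≤
        8 / ε * (ε / (128 * P.α)) :=
      mul_le_mul h3 he1 (Real.exp_pos _).le (by positivity)
    have h5 : 8 / ε * (ε / (128 * P.α)) = 1 / (16 * P.α) := by field_simp; norm_num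
    rw [h5] at h4
    have h6 := mul_le_mul_of_nonneg_left h4 (by positivity : 0 ≤ 4 * P.α)
    have h7 : 4 * P.α * (1 / (16 * P.α)) = 1 / 4 := by field_simp; norm_num
    linarith
  · exact three_le_exp_div_two_mul hε hε1 hℓ0 (by positivity) hL3' hl1 hl2 hl3 hTu2

end UserConverse

/-! ### Shifting columns of a basis matrix -/

noncomputable section Columns

open scoped Classical

variable {q c g r n m : ℕ}

/-- The ground truth in which the columns in `h` of a basis matrix are shifted by `b`. -/
def Instance.shiftColumns (M : Instance q c g r n m) (x : Fin c) (b : Fin r → ZMod q)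
    (h : Finset (Fin m)) : Instance q c g r n m :=
  ⟨fun y => if y = x then M.basis y + Matrix.of fun i j => if j ∈ h then b i else 0 else M.basis y,
    M.part⟩

theorem vec_shiftColumns (P : Model q c g r) (M : Instance q c g r n m) (x : Fin c)
    (b : Fin r → ZMod q) (h : Finset (Fin m)) (y : Fin c) (i : Fin g) (j : Fin m) :
    (M.shiftColumns x b h).vec P y i j =
      M.vec P y i j + if y = x ∧ j ∈ h then (P.code x *ᵥ b) i else 0 := by
  by_cases hy : y = x
  · subst hy
    simp only [Instance.vec, Instance.shiftColumns, if_true, true_and, Matrix.mul_add,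
      Matrix.add_apply]
    congr 1
    by_cases hj : j ∈ h <;> simp [Matrix.mul_apply, Matrix.mulVec, dotProduct, hj]
  · simp [Instance.vec, Instance.shiftColumns, hy]

theorem mat_shiftColumns (P : Model q c g r) (M : Instance q c g r n m) (x : Fin c)
    (b : Fin r → ZMod q) (h : Finset (Fin m)) (a : Fin n) (j : Fin m) :
    (M.shiftColumns x b h).mat P a j =
      M.mat P a j + if (M.part a).1 = x ∧ j ∈ h then (P.code x *ᵥ b) (M.part a).2 else 0 :=
  vec_shiftColumns P M x b h _ _ j

theorem hammingDist_le_add_card {ι K : Type*} [Fintype ι] [DecidableEq ι] [DecidableEq K]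
    {v v' w w' : ι → K} {J : Finset ι} (hv : ∀ j, j ∉ J → v j = v' j)
    (hw : ∀ j, j ∉ J → w j = w' j) : hammingDist v w ≤ hammingDist v' w' + J.card := by
  unfold hammingDist
  refine (Finset.card_le_card ?_).trans (Finset.card_union_le _ _)
  intro j hj
  simp only [Finset.mem_filter, Finset.mem_univ, true_and, Finset.mem_union] at hj ⊢
  by_cases hjJ : j ∈ J
  · exact .inr hjJ
  · rw [← hv j hjJ, ← hw j hjJ]
    exact .inl hj

/-- Altering at most `η m` columns lowers a normalized distance by at most `η`; the slack of a
non-extremal `δ` is spent here. -/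
theorem mem_lowerBounds_intraDistances {P : Model q c g r} {M X : Instance q c g r n m}
    {J : Finset (Fin m)} {δ η : ℝ} (hm : 0 < m) (hJ : (J.card : ℝ) ≤ η * m)
    (hX : ∀ y i j, j ∉ J → M.vec P y i j = X.vec P y i j)
    (hM : δ + η ∈ lowerBounds (M.intraDistances P)) : δ ∈ lowerBounds (X.intraDistances P) := by
  have hm' : (0 : ℝ) < m := by exact_mod_cast hm
  rintro _ ⟨y, i, i', hii, rfl⟩
  have h1 := hM ⟨y, i, i', hii, rfl⟩
  have h2 : (hammingDist (M.vec P y i) (M.vec P y i') : ℝ) ≤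
      hammingDist (X.vec P y i) (X.vec P y i') + J.card := by
    exact_mod_cast hammingDist_le_add_card (hX y i) (hX y i')
  rw [le_div_iff₀ hm'] at h1 ⊢
  linarith

theorem mem_lowerBounds_interDistances {P : Model q c g r} {M X : Instance q c g r n m}
    {J : Finset (Fin m)} {δ η : ℝ} (hm : 0 < m) (hJ : (J.card : ℝ) ≤ η * m)
    (hX : ∀ y i j, j ∉ J → M.vec P y i j = X.vec P y i j)
    (hM : δ + η ∈ lowerBounds (M.interDistances P)) : δ ∈ lowerBounds (X.interDistances P) := by
  have hm' : (0 : ℝ) < m := by exact_mod_cast hm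
  rintro _ ⟨y, y', i, i', hyy, rfl⟩
  have h1 := hM ⟨y, y', i, i', hyy, rfl⟩
  have h2 : (hammingDist (M.vec P y i) (M.vec P y' i') : ℝ) ≤
      hammingDist (X.vec P y i) (X.vec P y' i') + J.card := by
    exact_mod_cast hammingDist_le_add_card (hX y i) (hX y' i')
  rw [le_div_iff₀ hm'] at h1 ⊢
  linarith

theorem sum_ite_part_eq {N : ℕ} {τ : Fin n → Fin c × Fin g}
    (hτ : ∀ u, (Finset.univ.filter fun a => τ a = u).card = N) (x : Fin c) (S : Fin g → Prop) :
    ∑ a, (if (τ a).1 = x ∧ S (τ a).2 then (1 : ℝ) else 0) =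
      N * (Finset.univ.filter S).card := by
  have h1 : ∀ a, (if (τ a).1 = x ∧ S (τ a).2 then (1 : ℝ) else 0) =
      ∑ i ∈ Finset.univ.filter S, if τ a = (x, i) then 1 else 0 := by
    intro a
    by_cases h : (τ a).1 = x
    · have h2 : ∀ i, τ a = (x, i) ↔ (τ a).2 = i := fun i => by
        rw [← h]; exact ⟨fun h' => by rw [h'], fun h' => by rw [← h']⟩
      simp [h, h2]
    · have h2 : ∀ i, τ a ≠ (x, i) := fun i h' => h (by rw [h'])
      simp [h, h2]
  simp_rw [h1]
  rw [Finset.sum_comm, Finset.sum_congr rfl fun i _ => sum_ite_eq_card τ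
    (fun u => by convert hτ u) (x, i) 1]
  simp
  ring

section

variable [Fact q.Prime]

/-- A code of dimension `r ≥ 1` has a nonzero codeword that vanishes at `r - 1` positions. -/
theorem exists_hammingNorm_mulVec_le (Φ : Matrix (Fin g) (Fin r) (ZMod q)) (hr : 0 < r)
    (hrg : r ≤ g) : ∃ b, b ≠ 0 ∧ hammingNorm (Φ *ᵥ b) + r ≤ g + 1 := by
  -- Vanishing at the first `r - 1` positions imposes `r - 1` linear conditions on `r` unknowns.
  let f : (Fin r → ZMod q) →ₗ[ZMod q] (Fin (r - 1) → ZMod q) :=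
    (LinearMap.funLeft (ZMod q) (ZMod q) (fun i : Fin (r - 1) => (⟨i.1, by omega⟩ : Fin g))).comp
      Φ.mulVecLin
  have hker := LinearMap.ker_ne_bot_of_finrank_lt (f := f) (by simp; omega)
  obtain ⟨b, hb, hb0⟩ := Submodule.exists_mem_ne_zero_of_ne_bot hker
  refine ⟨b, hb0, ?_⟩
  have hz : ∀ i : Fin g, i.1 < r - 1 → (Φ *ᵥ b) i = 0 := fun i hi =>
    congrFun (LinearMap.mem_ker.1 hb) ⟨i.1, hi⟩
  have h1 : hammingNorm (Φ *ᵥ b) ≤ (Finset.univ.filter fun i : Fin g => ¬ i.1 < r - 1).card := by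
    unfold hammingNorm
    refine Finset.card_le_card fun i hi => ?_
    simp only [Finset.mem_filter, Finset.mem_univ, true_and] at hi ⊢
    exact fun h => hi (hz i h)
  have h2 := Finset.card_filter_add_card_filter_not (s := (Finset.univ : Finset (Fin g))) (fun i => i.1 < r - 1)
  have h3 : (Finset.univ.filter fun i : Fin g => i.1 < r - 1).card = r - 1 := by
    rw [Fin.card_filter_val_lt]
    omega
  rw [Finset.card_univ, Fintype.card_fin, h3] at h2
  omega

theorem vecMul_injective_of_rank_eq {B : Matrix (Fin r) (Fin m) (ZMod q)} (hB : B.rank = r) :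
    Function.Injective (· ᵥ* B) := by
  rw [Matrix.vecMul_injective_iff, linearIndependent_iff_card_eq_finrank_span, Fintype.card_fin,
    Set.finrank, ← Matrix.rank_eq_finrank_span_row, hB]

theorem rank_eq_of_vecMul_ne_zero {B : Matrix (Fin r) (Fin m) (ZMod q)}
    (hB : ∀ b, b ≠ 0 → b ᵥ* B ≠ 0) : B.rank = r := by
  have h : LinearIndependent (ZMod q) B.row := by
    rw [← Matrix.vecMul_injective_iff]
    intro b b' hbb
    by_contra hne
    refine hB (b - b') (sub_ne_zero.2 hne) ?_
    rw [Matrix.sub_vecMul]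
    exact sub_eq_zero.2 hbb
  have := h.rank_matrix
  rwa [Fintype.card_fin] at this

/-- The rank of a matrix is detected by a bounded number of columns. -/
theorem exists_columns_detecting_rank {B : Matrix (Fin r) (Fin m) (ZMod q)} (hB : B.rank = r) :
    ∃ R : Finset (Fin m), R.card ≤ q ^ r ∧ ∀ B' : Matrix (Fin r) (Fin m) (ZMod q),
      (∀ i, ∀ j ∈ R, B' i j = B i j) → B'.rank = r := by
  -- One column is kept for each nonzero combination of the rows, as a witness that it does not
  -- vanish; there are fewer than `q ^ r` combinations.
  have h1 : ∀ b : {b : Fin r → ZMod q // b ≠ 0}, ∃ j, (b.1 ᵥ* B) j ≠ 0 := by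
    intro b
    by_contra hcon
    push Not at hcon
    refine b.2 (vecMul_injective_of_rank_eq hB ?_)
    funext j
    simp [hcon j]
  choose f hf using h1
  refine ⟨Finset.univ.image f, ?_, fun B' hB' => rank_eq_of_vecMul_ne_zero fun b hb h => ?_⟩
  · refine Finset.card_image_le.trans ?_
    rw [Finset.card_univ]
    refine (Fintype.card_subtype_le _).trans ?_
    simp [ZMod.card]
  · refine hf ⟨b, hb⟩ ?_
    refine Eq.trans ?_ (congrFun h (f ⟨b, hb⟩))
    simp only [Matrix.vecMul, dotProduct]
    exact Finset.sum_congr rfl fun i _ => by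
      rw [hB' i _ (Finset.mem_image_of_mem f (Finset.mem_univ _))]

/-- A lower bound for the probability that a column of ratings looks like another one. -/
theorem exp_le_sum_ite_column {p θ : ℝ} (hθ0 : 0 ≤ θ) (hθ1 : θ < 1)
    (hp : p ∈ Set.Icc (0 : ℝ) 1) (u v : Fin n → ZMod q) {ξ Y W T : ℝ} (hξ0 : 0 ≤ ξ) (hξ1 : ξ ≤ 1)
    (hxξ : p * entryInfo q θ * (1 + ξ) ≤ ξ) (hY : p * entryInfo q θ * hammingDist u v ≤ Y)
    (hW : p * entryVar q θ * hammingDist u v ≤ W) (hT : 0 < T) (hWT : 2 * W ≤ T ^ 2) :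
    Real.exp (-((1 + ξ) * Y) - T / 2) / 2 ≤
      ∑ w : Fin n → Option (ZMod q),
        if ∏ a, entryProb p θ (u a) (w a) ≤ ∏ a, entryProb p θ (v a) (w a)
        then ∏ a, entryProb p θ (u a) (w a) else 0 := by
  have hθ : θ ∈ Set.Icc (0 : ℝ) 1 := ⟨hθ0, hθ1.le⟩
  set x := p * entryInfo q θ with hx
  have hx0 : 0 ≤ x := mul_nonneg hp.1 (by unfold entryInfo; positivity)
  refine exp_div_two_le_sum_ite (fun a => entryProb p θ (u a)) (fun a => entryProb p θ (v a))
    (fun _ => entryProb_nonneg hp hθ _) (fun _ => entryProb_nonneg hp hθ _) (Equiv.refl _)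
    (fun a => Equiv.swap (some (u a)) (some (v a))) (fun a k => entryProb_swap _ _ _ _ _)
    (fun a k => by rw [Equiv.swap_comm]; exact entryProb_swap _ _ _ _ _)
    (y := fun a => if u a = v a then 0 else x) hξ0 hξ1 ?_ ?_ ?_ (le_trans (le_of_eq ?_) hY)
    (le_trans (le_of_eq ?_) hW) hT hWT
  · intro a
    split_ifs
    · exact le_rfl
    · exact hx0
  · intro a
    split_ifs
    · rw [zero_mul]; exact hξ0
    · exact hxξ
  · intro a
    simp only [bhatt]
    split_ifs with h
    · rw [h, sum_sqrt_entryProb_self hp hθ, sub_zero]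
    · rw [sum_sqrt_entryProb hp hθ h]
  · rw [cast_hammingDist_eq_sum, Finset.mul_sum]
    exact Finset.sum_congr rfl fun j _ => by split_ifs <;> simp
  · rw [cast_hammingDist_eq_sum, Finset.mul_sum]
    refine Finset.sum_congr rfl fun a _ => ?_
    simp only [llr]
    split_ifs with h
    · simp [h]
    · rw [sum_sqrt_entryProb_mul_sq hp hθ0 hθ1 h, mul_one]

end

end Columns

/-! ### The converse from confusions of columns -/

noncomputable section ColumnConverse

open scoped Classical

variable {q c g r n m : ℕ} [Fact q.Prime]

/-- Some column looks like its shift. -/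
theorem le_sum_ite_shiftColumns (P : Model q c g r) {p : ℝ} {M : Instance q c g r n m}
    (h0 : ∀ i k, 0 ≤ law P p M i k) (X : Fin m → Instance q c g r n m) (J : Finset (Fin m))
    (hpart : ∀ j, (X j).part = M.part)
    (hX : ∀ j a j', j' ≠ j → (X j).mat P a j' = M.mat P a j') {π : ℝ}
    (hπ : ∀ j ∈ J, π ≤ ∑ w : Fin n → Option (ZMod q),
      if ∏ a, entryProb p P.θ (M.mat P a j) (w a) ≤ ∏ a, entryProb p P.θ ((X j).mat P a j) (w a)
      then ∏ a, entryProb p P.θ (M.mat P a j) (w a) else 0) :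
    1 - Real.exp (-(π * J.card)) ≤ ∑ w : Coord n m → Option (ZMod q),
      if ∃ j ∈ J, ∏ i, law P p M i (w i) ≤ ∏ i, law P p (X j) i (w i) then
        ∏ i, law P p M i (w i) else 0 := by
  set emb : Fin m × Fin n → Coord n m := fun x => .inl (x.2, x.1) with hemb
  have hinj : Function.Injective emb := by
    rintro ⟨j, a⟩ ⟨j', a'⟩ h
    simp only [hemb, Sum.inl.injEq, Prod.mk.injEq] at h
    rw [h.1, h.2]
  set S : Fin m → (Fin n → Option (ZMod q)) → Prop := fun j w =>
    ∏ a, entryProb p P.θ (M.mat P a j) (w a) ≤ ∏ a, entryProb p P.θ ((X j).mat P a j) (w a) with hS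
  have hblocks := sum_blocks_ite_forall_not_le (fun j a => entryProb p P.θ (M.mat P a j))
    (fun j a k => h0 (.inl (a, j)) k) (fun j a => sum_entryProb _ _ _) S J (t := π)
    fun j hj => (hπ j hj).trans (le_of_eq (Finset.sum_congr rfl fun w _ => by congr))
  have hmarg := sum_comp_mul_prod (law P p M) emb hinj
    fun u => if ∀ j ∈ J, ¬ S j fun a => u (j, a) then 1 else 0
  have hone : ∏ i ∈ Finset.univ.filter (· ∉ Set.range emb), ∑ k, law P p M i k = 1 :=
    Finset.prod_eq_one fun i _ => sum_law P p M i
  rw [hone, mul_one] at hmarg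
  have htot : ∑ w : Coord n m → Option (ZMod q), ∏ i, law P p M i (w i) = 1 := by
    rw [sum_prod_apply (law P p M)]
    exact Finset.prod_eq_one fun i _ => sum_law P p M i
  have hno : ∑ w : Coord n m → Option (ZMod q),
      (if ∀ j ∈ J, ¬ S j fun a => (w ∘ emb) (j, a) then (1 : ℝ) else 0) * ∏ i, law P p M i (w i) ≤
      Real.exp (-(π * J.card)) := by
    rw [hmarg]
    refine le_trans (le_of_eq (Finset.sum_congr rfl fun u _ => ?_)) hblocks
    rw [ite_mul, one_mul, zero_mul]
    congr!
  rw [← htot]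
  refine le_trans (sub_le_sub_left hno _) ?_
  rw [← Finset.sum_sub_distrib]
  refine Finset.sum_le_sum fun w _ => ?_
  have hw0 : 0 ≤ ∏ i, law P p M i (w i) := Finset.prod_nonneg fun i _ => h0 _ _
  by_cases hno : ∀ j ∈ J, ¬ S j fun a => (w ∘ emb) (j, a)
  · rw [if_pos hno, one_mul, sub_self]
    split_ifs <;> first | exact hw0 | exact le_rfl
  · rw [if_neg hno, zero_mul, sub_zero, if_pos]
    push Not at hno
    obtain ⟨j, hj, hSj⟩ := hno
    refine ⟨j, hj, ?_⟩
    -- Only the factor of column `j` differs between `M` and `X j`.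
    have hsplit : ∀ Z : Instance q c g r n m, ∏ i, law P p Z i (w i) =
        (∏ a, entryProb p P.θ (Z.mat P a j) (w (.inl (a, j)))) *
          ((∏ j' ∈ Finset.univ.erase j, ∏ a, entryProb p P.θ (Z.mat P a j') (w (.inl (a, j')))) *
            ∏ e, edgeLaw q (pairProb P Z.part e) (w (.inr e))) := by
      intro Z
      have h := Finset.mul_prod_erase Finset.univ
        (fun j' => ∏ a, entryProb p P.θ (Z.mat P a j') (w (.inl (a, j')))) (Finset.mem_univ j)
      rw [Fintype.prod_sum_type, Fintype.prod_prod_type, Finset.prod_comm, ← mul_assoc]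
      exact congrArg (· * ∏ e, edgeLaw q (pairProb P Z.part e) (w (.inr e))) h.symm
    have hrest : ((∏ j' ∈ Finset.univ.erase j,
          ∏ a, entryProb p P.θ ((X j).mat P a j') (w (.inl (a, j')))) *
            ∏ e, edgeLaw q (pairProb P (X j).part e) (w (.inr e))) =
        ((∏ j' ∈ Finset.univ.erase j, ∏ a, entryProb p P.θ (M.mat P a j') (w (.inl (a, j')))) *
            ∏ e, edgeLaw q (pairProb P M.part e) (w (.inr e))) := by
      rw [hpart]
      congr 1
      refine Finset.prod_congr rfl fun j' hj' => Finset.prod_congr rfl fun a _ => ?_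
      rw [hX j a j' (Finset.ne_of_mem_erase hj')]
    rw [hsplit M, hsplit (X j), hrest]
    exact mul_le_mul_of_nonneg_right hSj (mul_nonneg
      (Finset.prod_nonneg fun j' _ => Finset.prod_nonneg fun a _ => h0 (.inl (a, j')) _)
      (Finset.prod_nonneg fun e _ => h0 (.inr e) _))

/-- Lower bound for the worst-case error from shifts of columns of a basis matrix. -/
theorem le_worstError_of_columns (P : Model q c g r) (hγ : 0 < P.γ) (hγβ : P.γ ≤ P.β)
    (hβα : P.β ≤ P.α) (hθ0 : 0 ≤ P.θ) (hθ1 : P.θ < 1) {p : ℝ} (hp : p ∈ Set.Icc (0 : ℝ) 1)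
    {δg δc η : ℝ} {M₁ : Instance q c g r n m} (hM₁ : M₁ ∈ matSet P n m (δg + η) (δc + η))
    (hcg : 0 < c * g) (hcgn : c * g ≤ n) (hm : 0 < m) {x : Fin c} {b : Fin r → ZMod q}
    (hb : P.code x *ᵥ b ≠ 0) {R J : Finset (Fin m)}
    (hR : ∀ B' : Matrix (Fin r) (Fin m) (ZMod q),
      (∀ i, ∀ j ∈ R, B' i j = M₁.basis x i j) → B'.rank = r)
    (hRJ : Disjoint R J) (hJ : (J.card : ℝ) ≤ η * m) {ξ Y W T : ℝ} (hξ0 : 0 ≤ ξ) (hξ1 : ξ ≤ 1)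
    (hxξ : p * entryInfo q P.θ * (1 + ξ) ≤ ξ)
    (hY : p * entryInfo q P.θ * ((n / (c * g) : ℕ) * hammingNorm (P.code x *ᵥ b)) ≤ Y)
    (hW : p * entryVar q P.θ * ((n / (c * g) : ℕ) * hammingNorm (P.code x *ᵥ b)) ≤ W)
    (hT : 0 < T) (hWT : 2 * W ≤ T ^ 2)
    (hbig : 3 ≤ Real.exp (-((1 + ξ) * Y) - T / 2) / 2 * J.card) (ψ : Estimator q n m) :
    1 / 4 ≤ worstError P p δg δc ψ := by
  have hα : 0 < P.α := by linarith
  have hβ : 0 < P.β := by linarith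
  have hθ : P.θ ∈ Set.Icc (0 : ℝ) 1 := ⟨hθ0, hθ1.le⟩
  set N := n / (c * g) with hN
  have hN0 : 0 < N := Nat.div_pos hcgn hcg
  have hcard : ∀ u, (Finset.univ.filter fun a => M₁.part a = u).card = N := fun u => by
    convert card_group_eq hM₁.1 hcg u
  -- All shifts along subsets of `J`: every member has a competitor for each `j ∈ J`, obtained by
  -- toggling that column.
  set F : Finset (Instance q c g r n m) := J.powerset.image (M₁.shiftColumns x b) with hF
  obtain ⟨i₀, hi₀⟩ := Function.ne_iff.1 hb
  have hi₀' : (P.code x *ᵥ b) i₀ ≠ 0 := hi₀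
  -- The ratings of a user in a group where the codeword is nonzero reveal which columns were
  -- shifted.
  obtain ⟨a₀, ha₀⟩ : ∃ a, M₁.part a = (x, i₀) := by
    obtain ⟨a, ha⟩ := Finset.card_pos.1 (hN0.trans_eq (hcard (x, i₀)).symm)
    exact ⟨a, (Finset.mem_filter.1 ha).2⟩
  have key := half_le_worstError (δg := δg) (δc := δc) P hα.le hβ.le hγ.le hp hθ ψ F
    ⟨_, Finset.mem_image_of_mem _ (Finset.empty_mem_powerset _)⟩ ?_ ?_ (κ := 1 / 2) ?_
  · linarith
  · intro X hX
    obtain ⟨h, hh, rfl⟩ := Finset.mem_image.1 hX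
    rw [Finset.mem_powerset] at hh
    have hvec : ∀ y i j, j ∉ J → M₁.vec P y i j = (M₁.shiftColumns x b h).vec P y i j := by
      intro y i j hj
      rw [vec_shiftColumns, if_neg fun h' => hj (hh h'.2), add_zero]
    refine ⟨⟨fun y => ?_, hM₁.1.2⟩, mem_lowerBounds_intraDistances hm hJ hvec hM₁.2.1,
      mem_lowerBounds_interDistances hm hJ hvec hM₁.2.2⟩
    by_cases hy : y = x
    · subst hy
      refine hR _ fun i j hj => ?_
      have : j ∉ h := fun h' => Finset.disjoint_left.1 hRJ hj (hh h')
      simp [Instance.shiftColumns, this]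
    · simp only [Instance.shiftColumns, hy, if_false]
      exact hM₁.1.1 y
  · intro X hX X' hX' hmat
    obtain ⟨h, -, rfl⟩ := Finset.mem_image.1 hX
    obtain ⟨h', -, rfl⟩ := Finset.mem_image.1 hX'
    have : h = h' := by
      ext j
      have h1 := congrFun (congrFun hmat a₀) j
      simp only [mat_shiftColumns, ha₀, true_and, add_right_inj] at h1
      by_cases hj : j ∈ h <;> by_cases hj' : j ∈ h' <;> simp [hj, hj', hi₀', hi₀'.symm] at h1 ⊢
    rw [this]
  · intro M hM
    obtain ⟨h, hh, rfl⟩ := Finset.mem_image.1 hM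
    rw [Finset.mem_powerset] at hh
    set M := M₁.shiftColumns x b h with hMdef
    set X : Fin m → Instance q c g r n m := fun j => M₁.shiftColumns x b (symmDiff h {j}) with hX
    have hmem : ∀ j j', j' ≠ j → (j' ∈ symmDiff h {j} ↔ j' ∈ h) := fun j j' hj => by
      simp [Finset.mem_symmDiff, hj]
    have hmem' : ∀ j, j ∈ symmDiff h {j} ↔ j ∉ h := fun j => by
      simp [Finset.mem_symmDiff]
    have hdist : ∀ j, (hammingDist (fun a => M.mat P a j) (fun a => (X j).mat P a j) : ℝ) ≤
        N * hammingNorm (P.code x *ᵥ b) := by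
      intro j
      have h1 := (sum_ite_part_eq hcard x fun i => (P.code x *ᵥ b) i ≠ 0).trans
        (show _ = (N : ℝ) * hammingNorm (P.code x *ᵥ b) by unfold hammingNorm; congr!)
      refine le_trans ?_ h1.le
      rw [cast_hammingDist_eq_sum]
      refine Finset.sum_le_sum fun a _ => ?_
      by_cases hc : (M₁.part a).1 = x ∧ (P.code x *ᵥ b) (M₁.part a).2 ≠ 0
      · rw [if_pos hc]
        split_ifs <;> norm_num
      · rw [if_neg hc, if_pos]
        simp only [hMdef, hX, mat_shiftColumns]
        by_cases hx : (M₁.part a).1 = x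
        · have : (P.code x *ᵥ b) (M₁.part a).2 = 0 := by
            by_contra h'
            exact hc ⟨hx, h'⟩
          simp [this]
        · simp [hx]
    have hx0 : 0 ≤ p * entryInfo q P.θ := mul_nonneg hp.1 (by unfold entryInfo; positivity)
    have hv0 : 0 ≤ p * entryVar q P.θ := mul_nonneg hp.1 (entryVar_nonneg _ _)
    have hsel := le_sum_ite_shiftColumns P (law_nonneg P hα.le hβ.le hγ.le hp hθ M) X J
      (fun j => rfl)
      (fun j a j' hj => by
        simp only [hMdef, hX, mat_shiftColumns, hmem j j' hj])
      (π := Real.exp (-((1 + ξ) * Y) - T / 2) / 2)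
      (fun j _ => exp_le_sum_ite_column hθ0 hθ1 hp _ _ hξ0 hξ1 hxξ
        ((mul_le_mul_of_nonneg_left (hdist j) hx0).trans hY)
        ((mul_le_mul_of_nonneg_left (hdist j) hv0).trans hW) hT hWT)
    have hexp' : Real.exp (-(Real.exp (-((1 + ξ) * Y) - T / 2) / 2 * J.card)) ≤ 1 / 8 :=
      (Real.exp_le_exp.2 (by linarith)).trans exp_neg_three_le
    refine le_trans (by linarith) (hsel.trans (Finset.sum_le_sum fun w _ => ?_))
    have hw0 : 0 ≤ ∏ i, law P p M i (w i) :=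
      Finset.prod_nonneg fun i _ => law_nonneg P hα.le hβ.le hγ.le hp hθ M _ _
    by_cases hE : ∃ j ∈ J, ∏ i, law P p M i (w i) ≤ ∏ i, law P p (X j) i (w i)
    · rw [if_pos hE, if_pos]
      obtain ⟨j, hj, hle⟩ := hE
      refine ⟨X j, Finset.mem_image_of_mem _ (Finset.mem_powerset.2 fun j' hj' => ?_), ?_, hle⟩
      · by_cases hjj : j' = j
        · rw [hjj]; exact hj
        · exact hh ((hmem j j' hjj).1 hj')
      · intro heq
        have h1 := congrFun (congrFun (congrArg (Instance.mat P) heq) a₀) j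
        simp only [hMdef, hX, mat_shiftColumns, ha₀, true_and, add_right_inj, hmem' j] at h1
        by_cases hjh : j ∈ h <;> simp [hjh, hi₀', hi₀'.symm] at h1
    · rw [if_neg hE]
      split_ifs <;> first | exact hw0 | exact le_rfl

end ColumnConverse

/-! ### Below the threshold -/

section Converse

variable {q c g r : ℕ}

theorem matSet_anti {P : Model q c g r} {n m : ℕ} {δg δc δg' δc' : ℝ} (hg : δg ≤ δg')
    (hc : δc ≤ δc') : matSet P n m δg' δc' ⊆ matSet P n m δg δc :=
  fun _ hM => ⟨hM.1, fun _ hd => hg.trans (hM.2.1 hd), fun _ hd => hc.trans (hM.2.2 hd)⟩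

variable [Fact q.Prime]

/-- Below the threshold of the confusion of columns, no estimator succeeds. -/
theorem eventually_le_worstError_of_columns (P : Model q c g r) (hrg : r ≤ g)
    (hcode : ∀ x, IsMDS (P.code x)) (hγ : 0 < P.γ) (hγβ : P.γ ≤ P.β)
    (hβα : P.β ≤ P.α) (hθ0 : 0 ≤ P.θ) (hθ1 : P.θ < ((q : ℝ) - 1) / q) {n m : ℕ → ℕ}
    (hn : Tendsto n atTop atTop) (hm : Tendsto m atTop atTop)
    (hlogm : (fun k => Real.log (m k)) =o[atTop] (fun k => (n k : ℝ)))
    (hcg : 0 < c * g) (hr : 0 < r) {η ε : ℝ} (hη : 0 < η) (hη1 : η ≤ 1 / 2) (hε : 0 < ε)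
    (hε1 : ε ≤ 1) :
    ∀ᶠ k in atTop, ∀ (p δg δc : ℝ) (M₁ : Instance q c g r (n k) (m k)),
      p ∈ Set.Icc (0 : ℝ) 1 → M₁ ∈ matSet P (n k) (m k) (δg + η) (δc + η) →
      p * entryInfo q P.θ * (((g : ℝ) - r + 1) * (n k / (c * g : ℕ))) ≤
        (1 - ε) * Real.log (m k) →
      ∀ ψ : Estimator q (n k) (m k), 1 / 4 ≤ worstError P p δg δc ψ := by
  have hI := entryInfo_pos hθ0 hθ1
  have hV := entryVar_nonneg q P.θ
  set K := c * g with hK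
  have hK0 : (0 : ℝ) < K := by exact_mod_cast hcg
  set ξ := ε / 4 with hξ
  have hξ0 : 0 < ξ := by positivity
  set C := entryVar q P.θ / entryInfo q P.θ + 1 with hC
  have hC0 : 0 < C := by positivity
  have hlog := tendsto_log_of_tendsto hm
  filter_upwards [hn.eventually_ge_atTop (max K 1), hm.eventually_ge_atTop (2 * q ^ r),
    hm.eventually_ge_atTop 2,
    eventually_le_mul_of_tendsto (tendsto_natCast_atTop_atTop.comp hm) hη 2,
    hlogm.def (show 0 < ξ / (2 * K) by positivity),
    eventually_le_mul_of_tendsto hlog (show 0 < (ε / 8) ^ 2 by positivity) (2 * C),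
    eventually_le_mul_of_tendsto hlog (show 0 < ε / 16 by positivity) (Real.log 2),
    eventually_le_mul_of_tendsto hlog (show 0 < ε / 4 by positivity) 11,
    (tendsto_exp_neg_mul hlog (show 0 < ε / 4 by positivity)).eventually_le_const hη]
    with k hnk hmq hm2 hηm hlk hl1 hl2 hl3 he
  intro p δg δc M₁ hp hM₁ hcond ψ
  have hKn : K ≤ n k := (le_max_left _ _).trans hnk
  have hn0 : (0 : ℝ) < n k := by exact_mod_cast (le_max_right K 1).trans hnk
  have hm0 : (0 : ℝ) < m k := by exact_mod_cast (by omega : 0 < m k)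
  set ℓ := Real.log (m k) with hℓ
  have hℓ0 : 0 < ℓ := Real.log_pos (by exact_mod_cast (by omega : 1 < m k))
  have hmexp : Real.exp ℓ = m k := Real.exp_log hm0
  have hNK : (K : ℝ) * (n k / K : ℕ) = n k := mul_div_card_eq hM₁.1 hcg
  have hNK' : (n k : ℝ) / K = (n k / K : ℕ) := by rw [← hNK]; field_simp
  rw [hNK'] at hcond
  set N := n k / K with hN
  have hN0 : (0 : ℝ) < N := by
    rw [← hNK'] ; positivity
  let x : Fin c := ⟨0, Nat.pos_of_mul_pos_right hcg⟩
  obtain ⟨b, hb0, hb⟩ := exists_hammingNorm_mulVec_le (P.code x) hr hrg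
  have hbr : (hammingNorm (P.code x *ᵥ b) : ℝ) ≤ (g : ℝ) - r + 1 := by
    have : ((hammingNorm (P.code x *ᵥ b) + r : ℕ) : ℝ) ≤ (g + 1 : ℕ) := by exact_mod_cast hb
    push_cast at this
    linarith
  have hgr : (1 : ℝ) ≤ (g : ℝ) - r + 1 := by
    have : (r : ℝ) ≤ g := by exact_mod_cast hrg
    linarith
  have hb' : P.code x *ᵥ b ≠ 0 := fun h =>
    hb0 ((hcode x).mulVec_injective (h.trans (Matrix.mulVec_zero _).symm))
  obtain ⟨R, hRc, hR⟩ := exists_columns_detecting_rank (hM₁.1.1 x)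
  have hηm' : 0 ≤ η * m k := by positivity
  -- Avoiding the columns in `R` preserves the rank under all shifts. There is room because `η ≤ 1 /
  -- 2` and `m ≥ 2 * q ^ r`.
  obtain ⟨J, hJR, hJc⟩ := Finset.exists_subset_card_eq (s := Rᶜ) (n := ⌊η * m k⌋₊) (by
    rw [Finset.card_compl, Fintype.card_fin]
    have h1 : (⌊η * m k⌋₊ : ℝ) ≤ m k / 2 := by
      refine (Nat.floor_le hηm').trans ?_
      have := mul_le_mul_of_nonneg_right hη1 hm0.le
      linarith
    have h2 : 2 * ⌊η * m k⌋₊ ≤ m k := by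
      have : 2 * (⌊η * m k⌋₊ : ℝ) ≤ m k := by linarith
      exact_mod_cast this
    omega)
  have hJ1 : (J.card : ℝ) ≤ η * m k := by rw [hJc]; exact Nat.floor_le hηm'
  have hJ2 : Real.exp ((1 - ε / 4) * ℓ) / 2 ≤ J.card := by
    have h1 : Real.exp ((1 - ε / 4) * ℓ) = m k * Real.exp (-(ε / 4 * ℓ)) := by
      rw [← hmexp, ← Real.exp_add]; ring_nf
    have h2 := mul_le_mul_of_nonneg_left he hm0.le
    have h3 := Nat.lt_floor_add_one (η * m k)
    simp only [Function.comp_apply] at hηm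
    rw [h1, hJc]
    linarith
  set y := p * entryInfo q P.θ with hy
  have hy0 : 0 ≤ y := mul_nonneg hp.1 hI.le
  have hycond : y * (N * hammingNorm (P.code x *ᵥ b)) ≤ (1 - ε) * ℓ := by
    refine le_trans (mul_le_mul_of_nonneg_left ?_ hy0) hcond
    rw [mul_comm]
    exact mul_le_mul_of_nonneg_right hbr hN0.le
  have hεℓ := mul_nonneg hε.le hℓ0.le
  -- No edges are involved, so `three_le_exp_div_two_mul` is used with `b = 0`; this is the summand
  -- `2 * (0 * ℓ)`.
  refine le_worstError_of_columns P hγ hγβ hβα hθ0 (theta_lt_one hθ1) hp hM₁ hcg hKn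
    (by omega) hb' hR (Finset.disjoint_left.2 fun j hj hj' => Finset.mem_compl.1 (hJR hj') hj) hJ1
    (ξ := ξ) (Y := (1 - ε) * ℓ + 2 * (0 * ℓ)) (W := C * ℓ) (T := √(2 * (C * ℓ)))
    hξ0.le (by linarith) ?_ (by linarith) ?_ (Real.sqrt_pos.2 (by positivity))
    (by rw [Real.sq_sqrt (by positivity)])
    (three_le_exp_div_two_mul hε hε1 hℓ0 le_rfl (by linarith) hl1 hl2 hl3 hJ2) ψ
  -- Here `log m = o(n)` forces `p I` to be small.
  · have h1 : y * N ≤ ℓ := by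
      have h2 : y * N ≤ y * (((g : ℝ) - r + 1) * N) :=
        mul_le_mul_of_nonneg_left (le_mul_of_one_le_left hN0.le hgr) hy0
      linarith
    have h2 : ℓ ≤ ξ / 2 * N := by
      rw [Real.norm_eq_abs, Real.norm_eq_abs, Nat.abs_cast, ← hNK] at hlk
      refine (le_abs_self _).trans (hlk.trans (le_of_eq ?_))
      field_simp
    have h3 : y ≤ ξ / 2 := le_of_mul_le_mul_right (h1.trans h2) hN0
    have h4 : y * (1 + ξ) ≤ ξ / 2 * (1 + ξ) := mul_le_mul_of_nonneg_right h3 (by linarith)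
    have h5 : ξ / 2 * (1 + ξ) ≤ ξ / 2 * 2 := mul_le_mul_of_nonneg_left (by linarith) (by linarith)
    linarith
  · have h1 : p * entryVar q P.θ * (N * hammingNorm (P.code x *ᵥ b)) =
        entryVar q P.θ / entryInfo q P.θ * (y * (N * hammingNorm (P.code x *ᵥ b))) := by
      rw [hy]; field_simp
    have h2 : entryVar q P.θ / entryInfo q P.θ * (y * (N * hammingNorm (P.code x *ᵥ b))) ≤
        entryVar q P.θ / entryInfo q P.θ * ℓ :=
      mul_le_mul_of_nonneg_left (by linarith) (div_nonneg hV hI.le)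
    rw [h1, hC]
    linarith

/-- The three ways of being below the threshold. -/
theorem le_threshold_iff (P : Model q c g r) (hθ0 : 0 ≤ P.θ)
    (hθ1 : P.θ < ((q : ℝ) - 1) / q) {n m : ℕ} {δg δc s p : ℝ} :
    p ≤ threshold P n m δg δc s ↔
      p * entryInfo q P.θ ≤ (g : ℝ) * c * s / ((g : ℝ) - r + 1) * (Real.log m / n) ∨
      p * entryInfo q P.θ ≤ Real.log n / (δg * m) * (s - (√P.α - √P.β) ^ 2 / ((g : ℝ) * c)) ∨
      p * entryInfo q P.θ ≤ Real.log n / (δc * m) *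
        (s - ((√P.α - √P.γ) ^ 2 + ((g : ℝ) - 1) * (√P.β - √P.γ) ^ 2) / ((g : ℝ) * c)) := by
  have hI := entryInfo_pos hθ0 hθ1
  rw [← le_max_iff, ← le_max_iff, ← le_div_iff₀ hI]
  unfold threshold
  rw [← entryInfo, one_div_mul_eq_div]

/-- For `r = 0` all rating vectors vanish. A nonzero coefficient vector is needed for the column
shifts. -/
theorem dim_pos_of_isLeast_intraDistances {P : Model q c g r} {n m : ℕ} {M : Instance q c g r n m} {δ : ℝ}
    (h : IsLeast (M.intraDistances P) δ) (hδ : 0 < δ) : 0 < r := by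
  rcases Nat.eq_zero_or_pos r with h0 | h0
  · obtain ⟨x, i, j, _, hd⟩ := h.1
    have hv : ∀ i, M.vec P x i = 0 := by
      intro i
      funext t
      subst h0
      simp [Instance.vec, Matrix.mul_apply]
    rw [hv, hv, hammingDist_self, Nat.cast_zero, zero_div] at hd
    exact absurd hd hδ.ne'
  · exact h0

/-- Rearrangement of the conditions for the confusion of two groups. -/
theorem mul_add_le_of_le_div_mul {y δ m ℓ s J K d : ℝ} (hδm : 0 < δ * m) (hd : δ = d / m)
    (hm : 0 < m) (h : y ≤ ℓ / (δ * m) * (s - J / K)) : y * d + J / K * ℓ ≤ s * ℓ := by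
  have hdm : d = δ * m := by rw [hd]; field_simp
  have h1 := mul_le_mul_of_nonneg_right h hδm.le
  have h2 : ℓ / (δ * m) * (s - J / K) * (δ * m) = ℓ * (s - J / K) := by
    rw [div_mul_eq_mul_div, div_mul_cancel₀ _ hδm.ne']
  rw [hdm]
  linarith

/-- Below the threshold no sequence of estimators succeeds. -/
theorem eventually_le_worstError (P : Model q c g r)
    (hrg : r ≤ g) (hcode : ∀ x, IsMDS (P.code x))
    (hθ0 : 0 ≤ P.θ) (hθ1 : P.θ < ((q : ℝ) - 1) / q)
    (hγ : 0 < P.γ) (hγβ : P.γ ≤ P.β) (hβα : P.β ≤ P.α)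
    (n m : ℕ → ℕ) (hn : Tendsto n atTop atTop)
    (hm : (fun k => Real.log (n k)) =o[atTop] (fun k => (m k : ℝ)))
    (hlogm : (fun k => Real.log (m k)) =o[atTop] (fun k => (n k : ℝ)))
    (δg δc : ℕ → ℝ) (δ₀ : ℝ) (hδ₀ : 0 < δ₀) (hδg : ∀ k, δ₀ ≤ δg k) (hδc : ∀ k, δ₀ ≤ δc k)
    (hδ : ∀ k, ∃ M₀ : Instance q c g r (n k) (m k), M₀.WellFormed ∧
      IsLeast (M₀.intraDistances P) (δg k) ∧ IsLeast (M₀.interDistances P) (δc k))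
    (p : ℕ → ℝ) (hp : ∀ k, p k ∈ Set.Icc (0 : ℝ) 1) (ε : ℝ) (hε : 0 < ε) (η : ℝ) (hη : 0 < η)
    (hne : ∀ᶠ k in atTop, (matSet P (n k) (m k) (δg k + η) (δc k + η)).Nonempty)
    (hthr : ∀ᶠ k in atTop, p k ≤ threshold P (n k) (m k) (δg k) (δc k) (1 - ε))
    (ψ : ∀ k, Estimator q (n k) (m k)) :
    ∀ᶠ k in atTop, 1 / 4 ≤ worstError P (p k) (δg k) (δc k) (ψ k) := by
  obtain ⟨M₀, -, hM₀, -⟩ := hδ 0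
  have hcg := (pos_of_isLeast_intraDistances hM₀ (hδ₀.trans_le (hδg 0))).1
  have hr := dim_pos_of_isLeast_intraDistances hM₀ (hδ₀.trans_le (hδg 0))
  have hmt := tendsto_atTop_of_log_isLittleO hn hm
  have hε' : 0 < min ε 1 := lt_min hε one_pos
  have hη' : 0 < min η (1 / 2) := lt_min hη (by norm_num)
  have hK0 : (0 : ℝ) < (c * g : ℕ) := by exact_mod_cast hcg
  have hKc : (g : ℝ) * c = (c * g : ℕ) := by push_cast; ring
  filter_upwards [hne, hthr, hn.eventually_ge_atTop 1,
    eventually_le_worstError_of_columns P hrg hcode hγ hγβ hβα hθ0 hθ1 hn hmt hlogm hcg hr hη'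
      (min_le_right _ _) hε' (min_le_right _ _),
    eventually_le_worstError_of_users P hγ hγβ hβα hθ0 hθ1 hn hm hδ₀ hε' (min_le_right _ _)]
    with k hnek hthrk hn1 hcol husr
  obtain ⟨M₀, hw, hg, hc⟩ := hδ k
  have hM₀ := mem_matSet_of_isLeast hw hg hc
  have hδg0 := hδ₀.trans_le (hδg k)
  have hδc0 := hδ₀.trans_le (hδc k)
  have hmk := (pos_of_isLeast_intraDistances hg hδg0).2.1
  have hm0 : (0 : ℝ) < m k := by exact_mod_cast hmk
  have hn0 : (0 : ℝ) < n k := by exact_mod_cast hn1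
  have hlogn0 := Real.log_natCast_nonneg (n k)
  have hlogm0 := Real.log_natCast_nonneg (m k)
  have hεn : ∀ {x ℓ : ℝ}, 0 ≤ ℓ → x ≤ (1 - ε) * ℓ → x ≤ (1 - min ε 1) * ℓ := fun hℓ hx =>
    hx.trans (mul_le_mul_of_nonneg_right (by linarith [min_le_left ε 1]) hℓ)
  have hrows : ∀ u v, u ≠ v → δ₀ * m k ≤ hammingDist (M₀.row P u) (M₀.row P v) := fun u v huv =>
    le_hammingDist_row hM₀ hmk (hδg k) (hδc k) huv
  -- Column shifts start from a ground truth with slack in the distances. Confusions of users start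
  -- from `M₀`, which attains the minimum distances, at a pair of groups realizing the relevant
  -- minimum.
  rcases (le_threshold_iff P hθ0 hθ1).1 hthrk with h | h | h
  · obtain ⟨M₁, hM₁⟩ := hnek
    refine hcol (p k) (δg k) (δc k) M₁ (hp k) (matSet_anti ?_ ?_ hM₁) (hεn hlogm0 ?_) (ψ k)
    · linarith [min_le_left η (1 / 2)]
    · linarith [min_le_left η (1 / 2)]
    · have hgr : (0 : ℝ) < (g : ℝ) - r + 1 := by
        have : (r : ℝ) ≤ g := by exact_mod_cast hrg
        linarith
      have h1 : 0 < ((g : ℝ) - r + 1) * (n k / (c * g : ℕ)) := by positivity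
      refine (mul_le_mul_of_nonneg_right h h1.le).trans (le_of_eq ?_)
      rw [hKc]
      field_simp
  · obtain ⟨x, i, j, hij, hd⟩ := hg.1
    have hst : ((x, i) : Fin c × Fin g) ≠ (x, j) := fun h => hij (congrArg Prod.snd h)
    refine husr (p k) (δg k) (δc k) M₀ (x, i) (x, j) (hp k) hM₀ hst hrows (hεn hlogn0 ?_) (ψ k)
    rw [graphInfo_intra P hst rfl]
    rw [hKc] at h
    exact mul_add_le_of_le_div_mul (mul_pos hδg0 hm0) hd hm0 h
  · obtain ⟨x, y, i, j, hxy, hd⟩ := hc.1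
    have hst : ((x, i) : Fin c × Fin g) ≠ (y, j) := fun h => hxy (congrArg Prod.fst h)
    refine husr (p k) (δg k) (δc k) M₀ (x, i) (y, j) (hp k) hM₀ hst hrows (hεn hlogn0 ?_) (ψ k)
    rw [graphInfo_inter P (s := (x, i)) (t := (y, j)) hxy]
    rw [hKc] at h
    exact mul_add_le_of_le_div_mul (mul_pos hδc0 hm0) hd hm0 h

end Converse

end HierSBM
theorem theorem1 {q c g r : ℕ} [Fact q.Prime] (P : HierSBM.Model q c g r)
    (hrg : r ≤ g) (hcode : ∀ x, HierSBM.IsMDS (P.code x))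
    (hθ0 : 0 ≤ P.θ) (hθ1 : P.θ < ((q : ℝ) - 1) / q)
    (hγ : 0 < P.γ) (hγβ : P.γ ≤ P.β) (hβα : P.β ≤ P.α)
    -- the numbers of users and items along the sequence of problems
    (n m : ℕ → ℕ) (hn : Tendsto n atTop atTop)
    (hm : (fun k => Real.log (n k)) =o[atTop] (fun k => (m k : ℝ)))
    (hlogm : (fun k => Real.log (m k)) =o[atTop] (fun k => (n k : ℝ)))
    -- the minimum normalized distances of some ground truths, bounded away from zero
    (δg δc : ℕ → ℝ) (δ₀ : ℝ) (hδ₀ : 0 < δ₀) (hδg : ∀ k, δ₀ ≤ δg k) (hδc : ∀ k, δ₀ ≤ δc k)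
    (hδ : ∀ k, ∃ M₀ : HierSBM.Instance q c g r (n k) (m k), M₀.WellFormed ∧
      IsLeast (M₀.intraDistances P) (δg k) ∧ IsLeast (M₀.interDistances P) (δc k))
    -- the observation probabilities
    (p : ℕ → ℝ) (hp : ∀ k, p k ∈ Set.Icc (0 : ℝ) 1)
    (ε : ℝ) (hε : 0 < ε) :
    -- achievability, by maximum likelihood
    ((∀ᶠ k in atTop, HierSBM.threshold P (n k) (m k) (δg k) (δc k) (1 + ε) ≤ p k) →
      (∃ ψ : ∀ k, HierSBM.Estimator q (n k) (m k),
        ∀ k, HierSBM.IsMaxLikelihood P (p k) (δg k) (δc k) (ψ k)) ∧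
      ∀ ψ : ∀ k, HierSBM.Estimator q (n k) (m k),
        (∀ k, HierSBM.IsMaxLikelihood P (p k) (δg k) (δc k) (ψ k)) →
        Tendsto (fun k => HierSBM.worstError P (p k) (δg k) (δc k) (ψ k)) atTop (𝓝 0)) ∧
    -- converse, for distances that are not extremal
    ((∃ η : ℝ, 0 < η ∧
        ∀ᶠ k in atTop, (HierSBM.matSet P (n k) (m k) (δg k + η) (δc k + η)).Nonempty) →
      (∀ᶠ k in atTop, p k ≤ HierSBM.threshold P (n k) (m k) (δg k) (δc k) (1 - ε)) →
      ∀ ψ : ∀ k, HierSBM.Estimator q (n k) (m k), ∃ κ : ℝ, 0 < κ ∧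
        ∀ᶠ k in atTop, κ ≤ HierSBM.worstError P (p k) (δg k) (δc k) (ψ k)) := by
  constructor
  · refine fun hthr => ⟨?_, fun ψ hψ => HierSBM.tendsto_worstError_of_isMaxLikelihood P hrg hcode
      hθ0 hθ1 hγ hγβ hβα n m hn hm δg δc δ₀ hδ₀ hδg hδc hδ p hp ε hε hthr ψ hψ⟩
    have h : ∀ k, ∃ ψ : HierSBM.Estimator q (n k) (m k),
        HierSBM.IsMaxLikelihood P (p k) (δg k) (δc k) ψ := fun k => by
      obtain ⟨M₀, hM₀, hg, hc⟩ := hδ k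
      exact HierSBM.exists_isMaxLikelihood P _ _ _ ⟨M₀, HierSBM.mem_matSet_of_isLeast hM₀ hg hc⟩
    choose ψ hψ using h
    exact ⟨ψ, hψ⟩
  · rintro ⟨η, hη, hne⟩ hthr ψ
    exact ⟨1 / 4, by norm_num, HierSBM.eventually_le_worstError P hrg hcode hθ0 hθ1 hγ hγβ hβα n m hn
      hm hlogm δg δc δ₀ hδ₀ hδg hδc hδ p hp ε hε η hη hne hthr ψ⟩
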